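/- Let $d\in\{2,3\}$, $j\ge 0$, and let $\sigma,\gamma,\alpha,\beta$ be positive constants. Let $\Omega\subset\mathbb R^d$ be a polygonal/polyhedral domain with a conforming simplicial mesh $\mathcal T_h$ (the closed simplices fill $\overline\Omega$, and $\partial\Omega$ is a union of faces), which is shape-regular (each $K\in\mathcal T_h$ contains a ball of radius $\operatorname{diam}K/\sigma$) and quasi-uniform with characteristic mesh size $h>0$ ($h/\gamma\le \operatorname{diam}K\le\gamma h$). Let $\mathcal E_h$ be the set of its $(d-1)$-dimensional faces. Let $\mathbb A$ be a measurable symmetric matrix field with $\alpha\,\xi^T\xi\le\xi^T\mathbb A(x)\xi\le\beta\,\xi^T\xi$ for all $x\in\Omega$, $\xi\in\mathbb R^d$. Consider one of two pairs: $l=j$ and $G_j(K)=[P_j(K)]^d+\widehat P_j(K)\mathbf x$, where $\widehat P_j$ denotes homogeneous polynomials of degree $j$ (Raviart–Thomas), or $l=j+1$ and $G_j(K)=[P_{j+1}(K)]^d$ (Brezzi–Douglas–Marini). Let $V_h$ be the space of $v=\{v_0,v_b\}$ with $v_0|_K\in P_j(K)$ for $K\in\mathcal T_h$, $v_b|_e\in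 P_l(e)$ for $e\in\mathcal E_h$, and $v_b|_e=0$ for $e\subset\partial\Omega$; let $\mathcal V_h\subset H^1_0(\Omega)$ be the continuous piecewise linear functions on $\mathcal T_h$ vanishing on $\partial\Omega$. The weak gradient $(\nabla_wv)|_K\in G_j(K)$ is defined by $(\nabla_wv,\mathbf q)_K=-(v_0,\nabla\cdot\mathbf q)_K+\langle v_b,\mathbf q\cdot\mathbf n\rangle_{\partial K}$ for all $\mathbf q\in G_j(K)$, with $\mathbf n$ the outward unit normal. Put $$((v,\phi))=\sum_{K}\big[(v_0,\phi_0)_K+h(v_0-v_b,\phi_0-\phi_b)_{\partial K}\big],\qquad \|v\|_{0,h}^2=((v,v)),$$ $$|v|_{1,h}^2=\sum_K\big[\|\nabla v_0\|_K^2+h^{-1}\|v_0-v_b\|_{\partial K}^2\big],$$ $\|v\|_A^2=(\mathbb A\nabla_wv,\nabla_wv)$ for $v\in V_h$, and $\|w\|_{\mathcal A}^2=(\mathbb A\nabla w,\nabla w)$ for $w\in\mathcal V_h$; a function $w\in\mathcal V_h$ is identified with the pair $\{w|_K,w|_e\}$. Let $\rho_A$ be the spectral radius of the operator $A:V_h\to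 V_h$ with $((Au,v))=(\mathbb A\nabla_wu,\nabla_wv)$ for all $u,v\in V_h$, and let $\Pi=\{Q_0,Q_b\}:\mathcal V_h\to V_h$ be given by the local $L^2$ projections onto $P_j(K)$ and $P_l(e)$. Let $P:V_h\to\mathcal V_h$ be a linear operator obtained by prescribing, at each mesh vertex $\mathbf x$, the value $Pv(\mathbf x)$ as a convex combination (with coefficients not depending on $v$) of the values $v_0(\mathbf x)$ and $v_b(\mathbf x)$ on all the elements and faces that have $\mathbf x$ as a vertex, where for $\mathbf x\in\partial\Omega$ only the values of $v_b$ on boundary faces may have nonzero coefficients. Then there is a constant $C>0$, depending only on $d,j,\sigma,\gamma,\alpha,\beta$ and on which of the two pairs is used (in particular not on $h$), such that for all $v\in V_h$: $$\|v-Pv\|_{0,h}^2+h^2|v-Pv|_{1,h}^2\le C\,h^2|v|_{1,h}^2,$$ $$\|Pv\|_{\mathcal A}\le C\,\|v\|_A,\qquad \|v-\Pi Pv\|_{0,h}^2\le C\,\rho_A^{-1}\|v\|_A^2 .$$ -/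

import Mathlib

open MeasureTheory Set
open scoped Matrix MeasureTheory

noncomputable section

namespace WG

/-- The Euclidean space `ℝ^d`. -/
abbrev E (d : ℕ) : Type := EuclideanSpace ℝ (Fin d)

/-! ### Polynomial spaces -/

/-- The function on `ℝ^d` given by a polynomial in the coordinates. -/
def evalPoly (d : ℕ) : MvPolynomial (Fin d) ℝ →ₗ[ℝ] (E d → ℝ) :=
  LinearMap.pi fun x => (MvPolynomial.aeval (fun i => x i)).toLinearMap

/-- Polynomial functions of total degree at most `k`. A polynomial on a nondegenerate simplex
determines, and is determined by, a polynomial function on `ℝ^d`; so this also serves as `P_k(K)`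
for every element `K`. -/
def polySpace (d k : ℕ) : Submodule ℝ (E d → ℝ) :=
  (MvPolynomial.restrictTotalDegree (Fin d) ℝ k).map (evalPoly d)

/-- Homogeneous polynomial functions of degree `k`. -/
def homogSpace (d k : ℕ) : Submodule ℝ (E d → ℝ) :=
  (MvPolynomial.homogeneousSubmodule (Fin d) ℝ k).map (evalPoly d)

/-- Restriction of a function to the set `S`, extended by zero. -/
def restrictTo {d : ℕ} (S : Set (E d)) : (E d → ℝ) →ₗ[ℝ] (E d → ℝ) where
  toFun f := S.indicator f
  map_add' f g := Set.indicator_add S f g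
  map_smul' c f := Set.indicator_const_smul S c f

/-- `P_l(e)`: restrictions to the closed face `e` (the convex hull of the finite set `e`) of
polynomials of degree at most `l`, represented by their extension by zero. -/
def facePoly {d : ℕ} (e : Finset (E d)) (l : ℕ) : Submodule ℝ (E d → ℝ) :=
  (polySpace d l).map (restrictTo (convexHull ℝ (e : Set (E d))))

/-- `[P_k]^d`: vector fields with components in `P_k`. -/
def vecPoly (d k : ℕ) : Submodule ℝ (E d → E d) where
  carrier := {q | ∀ i, (fun x => q x i) ∈ polySpace d k}
  add_mem' hp hq i := (polySpace d k).add_mem (hp i) (hq i)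
  zero_mem' _ := (polySpace d k).zero_mem
  smul_mem' c _ hq i := (polySpace d k).smul_mem c (hq i)

/-- The linear map `r ↦ (x ↦ r(x) x)`. -/
def timesX (d : ℕ) : (E d → ℝ) →ₗ[ℝ] (E d → E d) where
  toFun r x := r x • x
  map_add' r s := by funext x; simp [add_smul]
  map_smul' c r := by funext x; simp [mul_smul]

/-- The two choices of weak Galerkin elements: `W_{j,j}` with the Raviart-Thomas element, and
`W_{j,j+1}` with the Brezzi-Douglas-Marini element. -/
inductive Pair
  | RT
  | BDM

/-- The polynomial degree `l` on faces: `j` for `W_{j,j}`, and `j + 1` for `W_{j,j+1}`. -/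
def Pair.faceDeg (pr : Pair) (j : ℕ) : ℕ :=
  match pr with
  | .RT => j
  | .BDM => j + 1

/-- The local space `G_j(K)` of weak gradients: `[P_j]^d + \hat P_j x` for the Raviart-Thomas
element, `[P_{j+1}]^d` for the Brezzi-Douglas-Marini element. -/
def Pair.gradSpace (pr : Pair) (d j : ℕ) : Submodule ℝ (E d → E d) :=
  match pr with
  | .RT => vecPoly d j ⊔ (homogSpace d j).map (timesX d)
  | .BDM => vecPoly d (j + 1)

/-! ### Meshes -/

open scoped Classical in
/-- A conforming simplicial mesh of a domain `Ω`. A simplex is given by the finite set of its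
vertices. -/
structure Mesh {d : ℕ} (Ω : Set (E d)) where
  /-- the elements (triangles for `d = 2`, tetrahedra for `d = 3`) -/
  elements : Finset (Finset (E d))
  card_eq : ∀ K ∈ elements, K.card = d + 1
  affineIndependent : ∀ K ∈ elements, AffineIndependent ℝ ((↑) : K → E d)
  /-- two elements meet in a common subsimplex, or not at all -/
  conforming : ∀ K ∈ elements, ∀ K' ∈ elements,
    convexHull ℝ (K : Set (E d)) ∩ convexHull ℝ (K' : Set (E d)) =
      convexHull ℝ ((K ∩ K' : Finset (E d)) : Set (E d))
  /-- the elements fill the domain -/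
  closure_eq : closure Ω = ⋃ K ∈ elements, convexHull ℝ (K : Set (E d))
  /-- the boundary of the domain is a union of faces of elements -/
  frontier_subset : ∀ x ∈ frontier Ω, ∃ K ∈ elements, ∃ e ∈ K.powersetCard d,
    x ∈ convexHull ℝ (e : Set (E d)) ∧ convexHull ℝ (e : Set (E d)) ⊆ frontier Ω

variable {d : ℕ} {Ω : Set (E d)}

open scoped Classical in
/-- The set `𝓔_h` of all faces (edges for `d = 2`, triangles for `d = 3`) of elements. -/
def Mesh.faces (T : Mesh Ω) : Finset (Finset (E d)) :=
  T.elements.biUnion fun K => K.powersetCard d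

open scoped Classical in
/-- The mesh vertices. -/
def Mesh.vertices (T : Mesh Ω) : Finset (E d) := T.elements.biUnion id

/-- The face `e` lies on the boundary of `Ω`. -/
def IsBoundaryFace (Ω : Set (E d)) (e : Finset (E d)) : Prop :=
  convexHull ℝ (e : Set (E d)) ⊆ frontier Ω

/-- Shape regularity with constant `σ`: every element `K` contains a ball of radius
`diam K / σ`. -/
def Mesh.IsShapeRegular (T : Mesh Ω) (σ : ℝ) : Prop :=
  ∀ K ∈ T.elements, ∃ z : E d,
    Metric.ball z (Metric.diam (convexHull ℝ (K : Set (E d))) / σ) ⊆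
      convexHull ℝ (K : Set (E d))

/-- Quasi-uniformity with constant `γ` and characteristic mesh size `h`: the diameters of all
elements are comparable to `h`. -/
def Mesh.IsQuasiUniform (T : Mesh Ω) (γ h : ℝ) : Prop :=
  ∀ K ∈ T.elements, h / γ ≤ Metric.diam (convexHull ℝ (K : Set (E d))) ∧
    Metric.diam (convexHull ℝ (K : Set (E d))) ≤ γ * h

/-- The integral `∫_K f`. -/
def intElem (K : Finset (E d)) (f : E d → ℝ) : ℝ :=
  ∫ x in convexHull ℝ (K : Set (E d)), f x

/-- The integral `∫_e f` with respect to `(d-1)`-dimensional surface measure. -/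
def intFace (e : Finset (E d)) (f : E d → ℝ) : ℝ :=
  ∫ x in convexHull ℝ (e : Set (E d)), f x ∂μHE[d - 1]

/-- The unit normal of the face `e` of the simplex `K` that points out of `K`: the normalized
component, orthogonal to `e`, of the vector from the centroid of `K` to the centroid of `e`. -/
def outwardNormal (K e : Finset (E d)) : E d :=
  let w := (vectorSpan ℝ (e : Set (E d)))ᗮ.starProjection
    (e.centroid ℝ id - K.centroid ℝ id)
  ‖w‖⁻¹ • w

/-! ### Weak functions and the spaces `V_h`, `𝒱_h` -/

/-- Pairs `{v_0, v_b}` of a function for each element and a function for each face. Only the values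
of `v_0` on its element and of `v_b` on its face matter in what follows. -/
abbrev WeakFun (T : Mesh Ω) : Type :=
  (T.elements → E d → ℝ) × (T.faces → E d → ℝ)

/-- A function on the domain as the weak function `{w|_K, w|_e}`. -/
def toWeak (T : Mesh Ω) (w : E d → ℝ) : WeakFun T := (fun _ => w, fun _ => w)

/-- The weak Galerkin space `V_h`. -/
def Vh (T : Mesh Ω) (pr : Pair) (j : ℕ) : Submodule ℝ (WeakFun T) where
  carrier := {v | (∀ K, v.1 K ∈ polySpace d j) ∧
    (∀ e, v.2 e ∈ facePoly e.1 (pr.faceDeg j)) ∧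
    ∀ e : T.faces, IsBoundaryFace Ω e.1 → v.2 e = 0}
  add_mem' {u v} hu hv := by
    refine ⟨fun K => ?_, fun e => ?_, fun e he => ?_⟩
    · rw [Prod.fst_add, Pi.add_apply]
      exact (polySpace d j).add_mem (hu.1 K) (hv.1 K)
    · rw [Prod.snd_add, Pi.add_apply]
      exact (facePoly e.1 (pr.faceDeg j)).add_mem (hu.2.1 e) (hv.2.1 e)
    · rw [Prod.snd_add, Pi.add_apply, hu.2.2 e he, hv.2.2 e he, add_zero]
  zero_mem' := by
    refine ⟨fun K => ?_, fun e => ?_, fun e he => ?_⟩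
    · rw [Prod.fst_zero, Pi.zero_apply]
      exact (polySpace d j).zero_mem
    · rw [Prod.snd_zero, Pi.zero_apply]
      exact (facePoly e.1 (pr.faceDeg j)).zero_mem
    · rw [Prod.snd_zero, Pi.zero_apply]
  smul_mem' c v hv := by
    refine ⟨fun K => ?_, fun e => ?_, fun e he => ?_⟩
    · rw [Prod.smul_fst, Pi.smul_apply]
      exact (polySpace d j).smul_mem c (hv.1 K)
    · rw [Prod.smul_snd, Pi.smul_apply]
      exact (facePoly e.1 (pr.faceDeg j)).smul_mem c (hv.2.1 e)
    · rw [Prod.smul_snd, Pi.smul_apply, hv.2.2 e he, smul_zero]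

/-- The conforming piecewise linear space `𝒱_h ⊆ H_0^1(Ω)`: continuous functions that are
affine on each element and vanish outside `Ω`. -/
def confVh (T : Mesh Ω) : Submodule ℝ (E d → ℝ) where
  carrier := {w | Continuous w ∧
    (∀ K ∈ T.elements, ∃ p ∈ polySpace d 1, EqOn w p (convexHull ℝ (K : Set (E d)))) ∧
    ∀ x ∉ Ω, w x = 0}
  add_mem' {u v} hu hv := by
    refine ⟨hu.1.add hv.1, fun K hK => ?_, fun x hx => by simp [hu.2.2 x hx, hv.2.2 x hx]⟩
    obtain ⟨p, hp, hup⟩ := hu.2.1 K hK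
    obtain ⟨q, hq, hvq⟩ := hv.2.1 K hK
    exact ⟨p + q, Submodule.add_mem _ hp hq, fun x hx => by simp [hup hx, hvq hx]⟩
  zero_mem' := ⟨continuous_zero, fun _ _ => ⟨0, Submodule.zero_mem _, fun _ _ => rfl⟩,
    fun _ _ => rfl⟩
  smul_mem' c v hv := by
    refine ⟨hv.1.const_smul c, fun K hK => ?_, fun x hx => by simp [hv.2.2 x hx]⟩
    obtain ⟨p, hp, hvp⟩ := hv.2.1 K hK
    exact ⟨c • p, Submodule.smul_mem _ c hp, fun x hx => by simp [hvp hx]⟩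

/-! ### Discrete inner product, norms and weak gradient -/

open scoped Classical in
/-- The sum over the faces of the element `K`. -/
def sumFaces (T : Mesh Ω) (K : T.elements) (F : T.faces → ℝ) : ℝ :=
  ∑ e : T.faces with e.1 ⊆ K.1, F e

/-- The discrete `L²` inner product
`∑_K [(v_0, φ_0)_K + h (v_0 - v_b, φ_0 - φ_b)_{∂K}]`. -/
def innerH {T : Mesh Ω} (h : ℝ) (v φ : WeakFun T) : ℝ :=
  ∑ K : T.elements, (intElem K.1 (fun x => v.1 K x * φ.1 K x) +
    h * sumFaces T K fun e =>
      intFace e.1 fun x => (v.1 K x - v.2 e x) * (φ.1 K x - φ.2 e x))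

/-- `‖v‖_{0,h}² = ∑_K [‖v_0‖_K² + h ‖v_0 - v_b‖_{∂K}²]`. -/
def normSq0h {T : Mesh Ω} (h : ℝ) (v : WeakFun T) : ℝ :=
  ∑ K : T.elements, (intElem K.1 (fun x => v.1 K x ^ 2) +
    h * sumFaces T K fun e => intFace e.1 fun x => (v.1 K x - v.2 e x) ^ 2)

/-- `|v|_{1,h}² = ∑_K [|v_0|_{1,K}² + h⁻¹ ‖v_0 - v_b‖_{∂K}²]`. -/
def seminormSq1h {T : Mesh Ω} (h : ℝ) (v : WeakFun T) : ℝ :=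
  ∑ K : T.elements, (intElem K.1 (fun x => ‖gradient (v.1 K) x‖ ^ 2) +
    h⁻¹ * sumFaces T K fun e => intFace e.1 fun x => (v.1 K x - v.2 e x) ^ 2)

/-- The divergence of a vector field. -/
def divergence (q : E d → E d) (x : E d) : ℝ :=
  ∑ i, fderiv ℝ (fun y => q y i) x (EuclideanSpace.single i 1)

/-- `g` is the discrete weak gradient of `v` on the element `K`: `g ∈ G_j(K)` and
`(g, q)_K = -(v_0, ∇·q)_K + ⟨v_b, q·n⟩_{∂K}` for all `q ∈ G_j(K)`. -/
def IsWeakGrad {T : Mesh Ω} (pr : Pair) (j : ℕ) (v : WeakFun T) (K : T.elements)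
    (g : E d → E d) : Prop :=
  g ∈ pr.gradSpace d j ∧ ∀ q ∈ pr.gradSpace d j,
    intElem K.1 (fun x => inner ℝ (g x) (q x)) =
      -intElem K.1 (fun x => v.1 K x * divergence q x) +
        sumFaces T K fun e =>
          intFace e.1 fun x => v.2 e x * inner ℝ (q x) (outwardNormal K.1 e.1)

/-- The discrete weak gradient `(∇_w v)|_K`: the unique solution of the equations above. -/
def weakGrad {T : Mesh Ω} (pr : Pair) (j : ℕ) (v : WeakFun T) (K : T.elements) : E d → E d :=
  Classical.epsilon (IsWeakGrad pr j v K)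

/-! ### The diffusion problem -/

/-- `𝔸` is a (measurable) diffusion matrix on `Ω`: symmetric with
`α ξᵀξ ≤ ξᵀ 𝔸(x) ξ ≤ β ξᵀξ`. -/
structure IsDiffusion (Ω : Set (E d)) (α β : ℝ) (𝔸 : E d → Matrix (Fin d) (Fin d) ℝ) : Prop where
  measurable : ∀ i k, AEMeasurable (fun x => 𝔸 x i k) (volume.restrict Ω)
  symm : ∀ x ∈ Ω, (𝔸 x).IsSymm
  lower : ∀ x ∈ Ω, ∀ ξ : Fin d → ℝ, α * (ξ ⬝ᵥ ξ) ≤ ξ ⬝ᵥ (𝔸 x *ᵥ ξ)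
  upper : ∀ x ∈ Ω, ∀ ξ : Fin d → ℝ, ξ ⬝ᵥ (𝔸 x *ᵥ ξ) ≤ β * (ξ ⬝ᵥ ξ)

/-- The pointwise pairing `(M p) · q`. -/
def pairing (M : Matrix (Fin d) (Fin d) ℝ) (p q : E d) : ℝ :=
  (M *ᵥ fun i => p i) ⬝ᵥ fun i => q i

/-- The bilinear form `a_h(u, v) = (𝔸 ∇_w u, ∇_w v)`. -/
def aForm {T : Mesh Ω} (pr : Pair) (j : ℕ) (𝔸 : E d → Matrix (Fin d) (Fin d) ℝ)
    (u v : WeakFun T) : ℝ :=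
  ∑ K : T.elements, intElem K.1 fun x =>
    pairing (𝔸 x) (weakGrad pr j u K x) (weakGrad pr j v K x)

/-- The operator `A : V_h → V_h` with `((A u, v)) = (𝔸 ∇_w u, ∇_w v)` for all `u, v ∈ V_h`. -/
def opA (T : Mesh Ω) (pr : Pair) (j : ℕ) (h : ℝ) (𝔸 : E d → Matrix (Fin d) (Fin d) ℝ) :
    Module.End ℝ (Vh T pr j) :=
  Classical.epsilon fun A : Module.End ℝ (Vh T pr j) =>
    ∀ u v : Vh T pr j, innerH h (A u : WeakFun T) (v : WeakFun T) =
      aForm pr j 𝔸 (u : WeakFun T) (v : WeakFun T)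

/-- The spectral radius `ρ_A` of the operator `A`. -/
def rhoA (T : Mesh Ω) (pr : Pair) (j : ℕ) (h : ℝ) (𝔸 : E d → Matrix (Fin d) (Fin d) ℝ) : ℝ :=
  (spectralRadius ℝ (opA T pr j h 𝔸)).toReal

/-- `‖v‖_A = (𝔸 ∇_w v, ∇_w v)^{1/2}`. -/
def normA {T : Mesh Ω} (pr : Pair) (j : ℕ) (𝔸 : E d → Matrix (Fin d) (Fin d) ℝ)
    (v : WeakFun T) : ℝ :=
  Real.sqrt (aForm pr j 𝔸 v v)

/-- `‖w‖_𝓐 = (𝔸 ∇w, ∇w)^{1/2}` on the conforming space. -/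
def normConfA (Ω : Set (E d)) (𝔸 : E d → Matrix (Fin d) (Fin d) ℝ) (w : E d → ℝ) : ℝ :=
  Real.sqrt (∫ x in Ω, pairing (𝔸 x) (gradient w x) (gradient w x))

/-! ### The operators `Π` and `P` -/

/-- The operator `Π = Q_h = {Q_0, Q_b} : 𝒱_h → V_h`, with `Q_0` and `Q_b` the local
`L²` projections onto `P_j(K)` and `P_l(e)`. -/
def opPi (T : Mesh Ω) (pr : Pair) (j : ℕ) : confVh T →ₗ[ℝ] Vh T pr j :=
  Classical.epsilon fun Q : confVh T →ₗ[ℝ] Vh T pr j => ∀ w : confVh T,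
    (∀ K : T.elements, ∀ q ∈ polySpace d j,
      intElem K.1 (fun x => (Q w : WeakFun T).1 K x * q x) =
        intElem K.1 fun x => (w : E d → ℝ) x * q x) ∧
    (∀ e : T.faces, ∀ q ∈ facePoly e.1 (pr.faceDeg j),
      intFace e.1 (fun x => (Q w : WeakFun T).2 e x * q x) =
        intFace e.1 fun x => (w : E d → ℝ) x * q x)

open scoped Classical in
/-- A choice, for each mesh vertex `x`, of the coefficients of a convex combination indexed by
the elements and the faces that have `x` as a vertex. For `x ∈ ∂Ω` only the boundary faces
may have a nonzero coefficient. -/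
structure ConvexWeights (T : Mesh Ω) where
  elem : E d → T.elements → ℝ
  face : E d → T.faces → ℝ
  elem_nonneg : ∀ x ∈ T.vertices, ∀ K, x ∈ K.1 → 0 ≤ elem x K
  face_nonneg : ∀ x ∈ T.vertices, ∀ e, x ∈ e.1 → 0 ≤ face x e
  sum_eq_one : ∀ x ∈ T.vertices,
    ∑ K : T.elements with x ∈ K.1, elem x K + ∑ e : T.faces with x ∈ e.1, face x e = 1
  elem_boundary : ∀ x ∈ T.vertices, x ∈ frontier Ω → ∀ K, x ∈ K.1 → elem x K = 0
  face_boundary : ∀ x ∈ T.vertices, x ∈ frontier Ω → ∀ e, x ∈ e.1 →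
    ¬ IsBoundaryFace Ω e.1 → face x e = 0

open scoped Classical in
/-- The prescribed convex combination, at the vertex `x`, of the values `v_0(x)` and `v_b(x)` on
all elements and faces that have `x` as a vertex. -/
def ConvexWeights.value {T : Mesh Ω} (c : ConvexWeights T) (v : WeakFun T) (x : E d) : ℝ :=
  ∑ K : T.elements with x ∈ K.1, c.elem x K * v.1 K x +
    ∑ e : T.faces with x ∈ e.1, c.face x e * v.2 e x

/-- The operator `P : V_h → 𝒱_h`: the linear operator for which `P v` takes the prescribed
convex combination as its value at each mesh vertex. -/
def opP {T : Mesh Ω} (pr : Pair) (j : ℕ) (c : ConvexWeights T) : Vh T pr j →ₗ[ℝ] confVh T :=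
  Classical.epsilon fun P : Vh T pr j →ₗ[ℝ] confVh T =>
    ∀ v : Vh T pr j, ∀ x ∈ T.vertices, (P v : E d → ℝ) x = c.value (v : WeakFun T) x

end WG

end

namespace WG

/-! ### Polynomial functions -/

/-! The seminorm `seminormSq1h` is the hub of the argument: the weak gradient controls it, and it
controls the distance from `v` to its conforming companion `P v`.

Weak gradient. After integration by parts, the weak gradient `g` of `{v, b}` on a simplex satisfies
`(g, q) = (∇v, q) + ⟨b - v, q·n⟩` (`IsLocalWeakGrad.identity`). The field `bubbleField` has
vanishing normal components on all faces and satisfies `(∇v, q) ≥ c h² ‖∇v‖²`, so testing with it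
bounds `∇v` by `g`. Testing with a lifting of the jump on one face (`exists_lifting`) then bounds
that jump. Together these give `exists_local_coercive`; testing with `g` itself gives the converse
`exists_local_bounded`. The norm-equivalence constants come from one compactness argument for
polynomials on a reference ball (`exists_bound_functional`), transported by dilations to balls
contained in the simplices and their faces. The divergence theorem on a simplex is obtained from
Fubini's theorem along edge directions.

Companion. Around a vertex `x`, the values at `x` of `v_0` on two elements sharing a face through
`x` differ by at most two jumps. Walk from an element `K` through interior faces containing `x`.
Either some reached element has a boundary face at `x`; then `v_b` vanishes there and so does `P v
(x)`. Or the reached elements cover a neighbourhood of `x` (`Mesh.reach_mem_nhds`), hence are all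
the elements at `x`. In both cases `v_0(x) - P v (x)` is bounded by jumps near `x`
(`Mesh.abs_sub_value_le`), with no assumption that the patch of a boundary vertex be connected
through faces. Linear interpolation then yields the `L²` estimate `exists_opP_l2`, and an inverse
inequality yields `exists_opP_h1`.

Conclusion. As `P v` is single valued, `v - P v` has the jumps of `v`, which gives the first
estimate; ellipticity and the coercivity of the weak gradient give the energy bound. Stability of
the projection (`exists_opPi_stable`) bounds `‖v - Π P v‖²` by `h² ‖v‖_A²`, and inverse inequalities
bound `ρ_A` by a multiple of `h⁻²` (`rhoA_le`), so `h²` may be replaced by `ρ_A⁻¹`. If `ρ_A = 0`,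
the symmetric operator `A` is zero and so is the energy, which is what the convention `0⁻¹ = 0`
requires.

Several objects are defined through `Classical.epsilon`; existence proofs by linear algebra and
nodal interpolation give access to their defining properties. -/

theorem mem_polySpace {d k : ℕ} {p : E d → ℝ} :
    p ∈ polySpace d k ↔ ∃ P : MvPolynomial (Fin d) ℝ, P.totalDegree ≤ k ∧
      p = fun x => MvPolynomial.eval (fun i => x i) P := by
  unfold polySpace evalPoly
  rw [Submodule.mem_map]
  constructor
  · rintro ⟨P, hP, rfl⟩
    refine ⟨P, (MvPolynomial.mem_restrictTotalDegree _ _ _).1 hP, ?_⟩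
    funext x
    simp
  · rintro ⟨P, hP, rfl⟩
    refine ⟨P, (MvPolynomial.mem_restrictTotalDegree _ _ _).2 hP, ?_⟩
    funext x
    simp

theorem polySpace_mono {d k l : ℕ} (h : k ≤ l) : polySpace d k ≤ polySpace d l := by
  intro p hp
  obtain ⟨P, hP, rfl⟩ := mem_polySpace.1 hp
  exact mem_polySpace.2 ⟨P, hP.trans h, rfl⟩

theorem const_mem_polySpace (d k : ℕ) (c : ℝ) : (fun _ : E d => c) ∈ polySpace d k :=
  mem_polySpace.2 ⟨MvPolynomial.C c, by simp, by simp⟩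

theorem coord_mem_polySpace {d : ℕ} (i : Fin d) : (fun x : E d => x i) ∈ polySpace d 1 :=
  mem_polySpace.2 ⟨MvPolynomial.X i, by simp, by simp⟩

theorem mul_mem_polySpace {d k l : ℕ} {p q : E d → ℝ} (hp : p ∈ polySpace d k)
    (hq : q ∈ polySpace d l) : (fun x => p x * q x) ∈ polySpace d (k + l) := by
  obtain ⟨P, hP, rfl⟩ := mem_polySpace.1 hp
  obtain ⟨Q, hQ, rfl⟩ := mem_polySpace.1 hq
  exact mem_polySpace.2 ⟨P * Q, (MvPolynomial.totalDegree_mul P Q).trans (by omega), by simp⟩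

theorem smul_fun_mem_polySpace {d k : ℕ} {p : E d → ℝ} (c : ℝ) (hp : p ∈ polySpace d k) :
    (fun x => c * p x) ∈ polySpace d k :=
  (polySpace d k).smul_mem c hp

theorem mul_const_mem_polySpace {d k : ℕ} {p : E d → ℝ} (hp : p ∈ polySpace d k) (c : ℝ) :
    (fun x => p x * c) ∈ polySpace d k := by
  simpa [mul_comm] using smul_fun_mem_polySpace c hp

theorem add_fun_mem_polySpace {d k : ℕ} {p q : E d → ℝ} (hp : p ∈ polySpace d k)
    (hq : q ∈ polySpace d k) : (fun x => p x + q x) ∈ polySpace d k :=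
  (polySpace d k).add_mem hp hq

theorem sub_fun_mem_polySpace {d k : ℕ} {p q : E d → ℝ} (hp : p ∈ polySpace d k)
    (hq : q ∈ polySpace d k) : (fun x => p x - q x) ∈ polySpace d k :=
  (polySpace d k).sub_mem hp hq

theorem sum_fun_mem_polySpace {ι : Type*} {d k : ℕ} (s : Finset ι) {p : ι → E d → ℝ}
    (hp : ∀ i ∈ s, p i ∈ polySpace d k) : (fun x => ∑ i ∈ s, p i x) ∈ polySpace d k := by
  have := (polySpace d k).sum_mem hp
  convert this using 1
  funext x
  simp

theorem affine_mem_polySpace {d : ℕ} (f : E d →ᵃ[ℝ] ℝ) : (fun x => f x) ∈ polySpace d 1 := by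
  have h : (fun x => f x) = fun x : E d =>
      ∑ i, x i * f.linear (EuclideanSpace.single i 1) + f 0 := by
    funext x
    have h1 : f x = f.linear x + f 0 := by
      have := f.map_vadd 0 x
      simpa using this
    rw [h1]
    congr 1
    have h2 : x = ∑ i, x i • EuclideanSpace.single i (1 : ℝ) := by
      have := (EuclideanSpace.basisFun (Fin d) ℝ).sum_repr x
      simpa using this.symm
    conv_lhs => rw [h2]
    simp
  rw [h]
  exact add_fun_mem_polySpace
    (sum_fun_mem_polySpace _ fun i _ => mul_const_mem_polySpace (coord_mem_polySpace i) _)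
    (const_mem_polySpace d 1 _)

theorem pow_mem_polySpace {d k : ℕ} {p : E d → ℝ} (hp : p ∈ polySpace d k) (m : ℕ) :
    (fun x => p x ^ m) ∈ polySpace d (m * k) := by
  obtain ⟨P, hP, rfl⟩ := mem_polySpace.1 hp
  exact mem_polySpace.2 ⟨P ^ m, (MvPolynomial.totalDegree_pow P m).trans
    (Nat.mul_le_mul_left m hP), by simp⟩

theorem prod_mem_polySpace {ι : Type*} {d : ℕ} (s : Finset ι) {p : ι → E d → ℝ} {m : ι → ℕ}
    (hp : ∀ i ∈ s, p i ∈ polySpace d (m i)) :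
    (fun x => ∏ i ∈ s, p i x) ∈ polySpace d (∑ i ∈ s, m i) := by
  classical
  induction s using Finset.induction_on with
  | empty => simpa using const_mem_polySpace d 0 1
  | insert a s ha ih =>
    simp only [Finset.prod_insert ha, Finset.sum_insert ha]
    exact mul_mem_polySpace (hp a (Finset.mem_insert_self a s))
      (ih fun i hi => hp i (Finset.mem_insert_of_mem hi))

/-- Each monomial becomes a product of powers of affine functions, so an affine substitution does
not raise the degree. Dilations, projections and face parametrizations all act on polynomials
through this fact. -/
theorem comp_mem_polySpace {m n k : ℕ} {p : E n → ℝ} (hp : p ∈ polySpace n k)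
    (f : E m →ᵃ[ℝ] E n) : (fun x => p (f x)) ∈ polySpace m k := by
  obtain ⟨P, hP, rfl⟩ := mem_polySpace.1 hp
  have hf : ∀ i, (fun x => f x i) ∈ polySpace m 1 := fun i =>
    affine_mem_polySpace
      (((EuclideanSpace.proj i : E n →L[ℝ] ℝ) : E n →ₗ[ℝ] ℝ).toAffineMap.comp f)
  simp only [MvPolynomial.eval_eq']
  refine sum_fun_mem_polySpace _ fun s hs => smul_fun_mem_polySpace _ ?_
  refine polySpace_mono (k := ∑ i, s i * 1) ?_ (prod_mem_polySpace _ fun i _ =>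
    pow_mem_polySpace (hf i) (s i))
  have := MvPolynomial.le_totalDegree hs
  rw [Finsupp.sum_fintype _ _ (fun _ => rfl)] at this
  simpa using this.trans hP

theorem analyticOnNhd_of_mem_polySpace {d k : ℕ} {p : E d → ℝ} (hp : p ∈ polySpace d k) :
    AnalyticOnNhd ℝ p univ := by
  obtain ⟨P, -, rfl⟩ := mem_polySpace.1 hp
  have := AnalyticOnNhd.aeval_mvPolynomial (𝕜 := ℝ) (s := (univ : Set (E d)))
    (f := fun (x : E d) (i : Fin d) => x i)
    (fun i => (EuclideanSpace.proj i : E d →L[ℝ] ℝ).analyticOnNhd _) P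
  simpa [MvPolynomial.coe_aeval_eq_eval] using this

theorem contDiff_of_mem_polySpace {d k : ℕ} {p : E d → ℝ} (hp : p ∈ polySpace d k) {n : ℕ∞} :
    ContDiff ℝ n p := by
  have := (analyticOnNhd_of_mem_polySpace hp).contDiffOn uniqueDiffOn_univ (n := n)
  exact contDiffOn_univ.1 this

theorem continuous_of_mem_polySpace {d k : ℕ} {p : E d → ℝ} (hp : p ∈ polySpace d k) :
    Continuous p :=
  (contDiff_of_mem_polySpace (n := 1) hp).continuous

theorem differentiable_of_mem_polySpace {d k : ℕ} {p : E d → ℝ} (hp : p ∈ polySpace d k) :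
    Differentiable ℝ p :=
  (contDiff_of_mem_polySpace (n := 1) hp).differentiable (by simp)

/-- Identity theorem for analytic functions. It makes the `L²` form over a bounded set with interior
points definite on polynomials. -/
theorem eq_zero_of_eqOn_open {d k : ℕ} {p : E d → ℝ} (hp : p ∈ polySpace d k) {U : Set (E d)}
    (hU : IsOpen U) (hne : U.Nonempty) (h : ∀ x ∈ U, p x = 0) : p = 0 := by
  obtain ⟨z, hz⟩ := hne
  have := (analyticOnNhd_of_mem_polySpace hp).eqOn_zero_of_preconnected_of_eventuallyEq_zero
    isPreconnected_univ (mem_univ z) (by filter_upwards [hU.mem_nhds hz] with x hx using h x hx)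
  funext x
  exact this (mem_univ x)

instance (d k : ℕ) : Module.Finite ℝ (polySpace d k) := by
  unfold polySpace
  infer_instance

/-- Formal partial derivatives compute the analytic derivative; this is how degrees of derivatives
are read off. -/
theorem hasFDerivAt_eval {d : ℕ} (P : MvPolynomial (Fin d) ℝ) (x : E d) :
    HasFDerivAt (fun y : E d => MvPolynomial.eval (fun i => y i) P)
      (∑ i, MvPolynomial.eval (fun i => x i) (MvPolynomial.pderiv i P) •
        (EuclideanSpace.proj i : E d →L[ℝ] ℝ)) x := by
  induction P using MvPolynomial.induction_on with
  | C a => simpa using hasFDerivAt_const a x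
  | add P Q hP hQ =>
    simp only [map_add, add_smul, Finset.sum_add_distrib]
    exact hP.add hQ
  | mul_X P n hP =>
    have hX : HasFDerivAt (fun y : E d => y n) (EuclideanSpace.proj n : E d →L[ℝ] ℝ) x :=
      (EuclideanSpace.proj n : E d →L[ℝ] ℝ).hasFDerivAt
    have h := hP.mul hX
    simp only [map_mul, MvPolynomial.eval_X]
    refine HasFDerivAt.congr_fderiv h ?_
    ext y
    simp only [MvPolynomial.pderiv_mul, MvPolynomial.pderiv_X, map_add, map_mul,
      MvPolynomial.eval_X, FunLike.coe_sum, Finset.sum_apply,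
      FunLike.coe_smul, Pi.smul_apply, smul_eq_mul, add_apply,
      add_mul, Finset.sum_add_distrib, Finset.mul_sum]
    rw [add_comm]
    congr 1
    · exact Finset.sum_congr rfl fun i _ => by ring
    · rw [Finset.sum_eq_single n]
      · simp
      · intro b _ hb
        simp [Pi.single_apply, hb.symm]
      · simp

theorem totalDegree_pderiv_le {d : ℕ} (P : MvPolynomial (Fin d) ℝ) (i : Fin d) :
    (MvPolynomial.pderiv i P).totalDegree ≤ P.totalDegree - 1 := by
  classical
  rw [P.as_sum, map_sum]
  -- The previous rewriting also expanded the polynomial inside the degree bound; this folds it back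
  -- there.
  rw [← P.as_sum]
  refine (MvPolynomial.totalDegree_finsetSum_le fun s hs => ?_)
  rw [MvPolynomial.pderiv_monomial]
  by_cases h0 : s i = 0
  · simp [h0]
  refine (MvPolynomial.totalDegree_monomial_le _ _).trans ?_
  have h1 := MvPolynomial.le_totalDegree hs
  have h2 : (s - Finsupp.single i 1).sum (fun _ e => e) + 1 = s.sum fun _ e => e := by
    have h3 : (s - Finsupp.single i 1) + Finsupp.single i 1 = s := by
      refine tsub_add_cancel_of_le ?_
      rw [Finsupp.single_le_iff]
      omega
    conv_rhs => rw [← h3]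
    rw [Finsupp.sum_add_index' (fun _ => rfl) (fun _ _ _ => rfl)]
    simp
  have h4 : ((s - Finsupp.single i 1).sum fun _ => id) =
    (s - Finsupp.single i 1).sum fun _ e => e := rfl
  omega

theorem fderiv_apply_mem_polySpace {d k : ℕ} {p : E d → ℝ} (hp : p ∈ polySpace d k) (u : E d) :
    (fun x => fderiv ℝ p x u) ∈ polySpace d (k - 1) := by
  obtain ⟨P, hP, rfl⟩ := mem_polySpace.1 hp
  have : (fun x => fderiv ℝ (fun y : E d => MvPolynomial.eval (fun i => y i) P) x u) =
      fun x : E d => ∑ i, MvPolynomial.eval (fun i => x i) (MvPolynomial.pderiv i P) * u i := by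
    funext x
    rw [(hasFDerivAt_eval P x).fderiv]
    simp
  rw [this]
  refine sum_fun_mem_polySpace _ fun i _ => mul_const_mem_polySpace ?_ _
  refine mem_polySpace.2 ⟨_, (totalDegree_pderiv_le P i).trans ?_, rfl⟩
  omega

theorem fderiv_eq_zero_of_mem_polySpace_zero {d : ℕ} {p : E d → ℝ} (hp : p ∈ polySpace d 0)
    (x : E d) : fderiv ℝ p x = 0 := by
  obtain ⟨P, hP, rfl⟩ := mem_polySpace.1 hp
  rw [MvPolynomial.totalDegree_eq_zero_iff_eq_C.1 (Nat.le_zero.1 hP)]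
  simp

/-- Differentiation loses a degree and the affine factor restores it. Degree zero is separate
because `0 - 1 = 0`; there the derivative itself vanishes. -/
theorem fderiv_mul_mem_polySpace {d k : ℕ} {p l : E d → ℝ} (hp : p ∈ polySpace d k)
    (hl : l ∈ polySpace d 1) (u : E d) : (fun x => fderiv ℝ p x u * l x) ∈ polySpace d k := by
  cases k with
  | zero =>
    simp only [fderiv_eq_zero_of_mem_polySpace_zero hp]
    simpa using const_mem_polySpace d 0 0
  | succ k => exact mul_mem_polySpace (fderiv_apply_mem_polySpace hp u) hl

/-- A polynomial of degree at most `k + 1` is its value at the origin plus a combination of the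
coordinates with coefficients of degree at most `k`, which may be chosen linearly. -/
theorem exists_linear_decomposition (d k : ℕ) :
    ∃ L : Fin d → polySpace d (k + 1) →ₗ[ℝ] polySpace d k, ∀ (p : polySpace d (k + 1)) (y : E d),
      (p : E d → ℝ) y = (p : E d → ℝ) 0 + ∑ i, y i * (L i p : E d → ℝ) y := by
  classical
  -- Existence first, polynomial by polynomial and monomial by monomial; linearity is arranged
  -- afterwards.
  have key : ∀ p : polySpace d (k + 1), ∃ r : Fin d → polySpace d k, ∀ y : E d,
      (p : E d → ℝ) y = (p : E d → ℝ) 0 + ∑ i, y i * (r i : E d → ℝ) y := by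
    rintro ⟨p, hp⟩
    obtain ⟨P, hP, rfl⟩ := mem_polySpace.1 hp
    have mono : ∀ s ∈ P.support, ∃ r : Fin d → polySpace d k, ∀ y : E d,
        P.coeff s * ∏ i, y i ^ s i = P.coeff s * ∏ i, (0 : E d) i ^ s i +
          ∑ i, y i * (r i : E d → ℝ) y := by
      intro s hs
      by_cases h0 : s = 0
      · refine ⟨0, fun y => ?_⟩
        simp [h0]
      · obtain ⟨i, hi⟩ : ∃ i, s i ≠ 0 := by
          by_contra! h
          exact h0 (Finsupp.ext h)
        -- One variable that occurs in the monomial is split off, so its exponent drops by one.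
        let t : Fin d → ℕ := fun a => if a = i then s a - 1 else s a
        have hdeg : ∑ a, t a ≤ k := by
          have := MvPolynomial.le_totalDegree hs
          rw [Finsupp.sum_fintype _ _ (fun _ => rfl)] at this
          have h2 : ∑ a, s a = ∑ a, t a + 1 := by
            rw [← Finset.add_sum_erase _ _ (Finset.mem_univ i),
              ← Finset.add_sum_erase (a := i) _ t (Finset.mem_univ i)]
            have h3 : ∑ a ∈ Finset.univ.erase i, s a = ∑ a ∈ Finset.univ.erase i, t a :=
              Finset.sum_congr rfl fun a ha => by simp [t, Finset.ne_of_mem_erase ha]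
            have h4 : t i = s i - 1 := by simp [t]
            omega
          omega
        have hq : (fun y : E d => P.coeff s * ∏ a, y a ^ t a) ∈ polySpace d k := by
          refine smul_fun_mem_polySpace _ (polySpace_mono (k := ∑ a, t a * 1) (by simpa using hdeg)
            (prod_mem_polySpace _ fun a _ => pow_mem_polySpace (coord_mem_polySpace a) (t a)))
        refine ⟨Pi.single i ⟨_, hq⟩, fun y => ?_⟩
        rw [Finset.sum_eq_single i (fun b _ hb => by simp [hb]) (by simp)]
        have hz : ∏ a, (0 : E d) a ^ s a = 0 :=
          Finset.prod_eq_zero (Finset.mem_univ i) (by simp [hi])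
        rw [hz, Pi.single_eq_same]
        have hsplit : ∏ a, y a ^ s a = y i * ∏ a, y a ^ t a := by
          rw [← Finset.mul_prod_erase _ _ (Finset.mem_univ i),
            ← Finset.mul_prod_erase (a := i) _ (fun a => y a ^ t a) (Finset.mem_univ i)]
          have h3 : ∏ a ∈ Finset.univ.erase i, y a ^ s a =
              ∏ a ∈ Finset.univ.erase i, y a ^ t a :=
            Finset.prod_congr rfl fun a ha => by simp [t, Finset.ne_of_mem_erase ha]
          have h4 : y i ^ s i = y i * y i ^ t i := by
            rw [← pow_succ']
            congr 1
            simp only [t, if_true]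
            omega
          rw [h3, h4]
          ring
        rw [hsplit]
        ring
    choose! r hr using mono
    refine ⟨fun i => ∑ s ∈ P.support, r s i, fun y => ?_⟩
    simp only [MvPolynomial.eval_eq']
    rw [Finset.sum_congr rfl fun s hs => hr s hs y, Finset.sum_add_distrib]
    congr 1
    rw [Finset.sum_comm]
    refine Finset.sum_congr rfl fun i _ => ?_
    simp [Finset.mul_sum]
  -- Choosing on a basis and extending linearly makes the coefficients linear in `p`, so that they
  -- can later be bounded as functionals.
  let b := Module.finBasis ℝ (polySpace d (k + 1))
  choose r hr using fun i => key (b i)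
  refine ⟨fun i => b.constr ℝ fun a => r a i, fun p y => ?_⟩
  let ev : E d → polySpace d (k + 1) →ₗ[ℝ] ℝ := fun y =>
    (LinearMap.proj y).comp (polySpace d (k + 1)).subtype
  let ev' : E d → polySpace d k →ₗ[ℝ] ℝ := fun y =>
    (LinearMap.proj y).comp (polySpace d k).subtype
  have h : ev y = ev 0 + ∑ i, y i • (ev' y).comp (b.constr ℝ fun a => r a i) := by
    refine b.ext fun a => ?_
    simp only [LinearMap.add_apply, LinearMap.sum_apply, LinearMap.smul_apply,
      LinearMap.comp_apply, Module.Basis.constr_basis, smul_eq_mul]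
    exact hr a y
  have := LinearMap.congr_fun h p
  simpa [ev, ev'] using this

end WG

namespace WG

/-! ### Norm equivalence on finite-dimensional spaces -/

/-- On a finite-dimensional space, a pointwise bounded family of linear functionals is bounded
uniformly by any positive definite quadratic form. -/
theorem exists_bound_of_posDef {V ι : Type*} [AddCommGroup V] [Module ℝ V] [Module.Finite ℝ V]
    (B : V →ₗ[ℝ] V →ₗ[ℝ] ℝ) (hB : ∀ v, v ≠ 0 → 0 < B v v) (f : ι → V →ₗ[ℝ] ℝ)
    (hf : ∀ v, ∃ M, ∀ i, |f i v| ≤ M) :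
    ∃ C, 0 < C ∧ ∀ v i, f i v ^ 2 ≤ C * B v v := by
  let b := Module.finBasis ℝ V
  let φ := b.equivFun
  have hQ : Continuous fun c => B (φ.symm c) (φ.symm c) := by
    have : (fun c => B (φ.symm c) (φ.symm c)) = fun c =>
        ∑ i, ∑ k, c i * c k * B (b i) (b k) := by
      funext c
      simp only [φ, Module.Basis.equivFun_symm_apply, map_sum, map_smul, LinearMap.sum_apply,
        LinearMap.smul_apply, smul_eq_mul, Finset.mul_sum]
      rw [Finset.sum_comm]
      exact Finset.sum_congr rfl fun i _ => Finset.sum_congr rfl fun k _ => by ring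
    rw [this]
    fun_prop
  -- The form is continuous and positive on the unit sphere, which is compact, so it has a positive
  -- minimum there. The sphere is empty when the space is trivial.
  obtain ⟨ε, hε, hmin⟩ : ∃ ε, 0 < ε ∧ ∀ c, ‖c‖ = 1 → ε ≤ B (φ.symm c) (φ.symm c) := by
    rcases (Metric.sphere (0 : Fin (Module.finrank ℝ V) → ℝ) 1).eq_empty_or_nonempty with h | h
    · refine ⟨1, one_pos, fun c hc => ?_⟩
      have : c ∈ Metric.sphere (0 : Fin (Module.finrank ℝ V) → ℝ) 1 := by simpa using hc
      rw [h] at this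
      exact this.elim
    · obtain ⟨c₀, hc₀, hmin⟩ := (isCompact_sphere (0 : Fin (Module.finrank ℝ V) → ℝ) 1)
        |>.exists_isMinOn h hQ.continuousOn
      refine ⟨_, hB (φ.symm c₀) ?_, fun c hc => hmin (by simpa using hc)⟩
      intro h0
      have : c₀ = 0 := by simpa using h0
      simp [this] at hc₀
  choose M hM using fun a => hf (b a)
  have hlow : ∀ v, ε * ‖φ v‖ ^ 2 ≤ B v v := by
    intro v
    by_cases h0 : φ v = 0
    · have : v = 0 := by simpa using h0
      simp [this]
    · have hn : 0 < ‖φ v‖ := norm_pos_iff.2 h0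
      have := hmin (‖φ v‖⁻¹ • φ v) (by rw [norm_smul, norm_inv, norm_norm, inv_mul_cancel₀ hn.ne'])
      simp only [map_smul, LinearEquiv.symm_apply_apply, LinearMap.smul_apply,
        smul_eq_mul] at this
      calc ε * ‖φ v‖ ^ 2 ≤ (‖φ v‖⁻¹ * (‖φ v‖⁻¹ * B v v)) * ‖φ v‖ ^ 2 := by gcongr
        _ = B v v := by field_simp
  -- `M a` bounds the whole family on the basis vector `b a`; the summand 1 only makes the constant
  -- positive.
  refine ⟨(∑ a, |M a|) ^ 2 / ε + 1, by positivity, fun v i => ?_⟩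
  have h1 : |f i v| ≤ (∑ a, |M a|) * ‖φ v‖ := by
    conv_lhs => rw [← b.sum_equivFun v]
    rw [map_sum, Finset.sum_mul]
    refine (Finset.abs_sum_le_sum_abs _ _).trans (Finset.sum_le_sum fun a _ => ?_)
    rw [map_smul, smul_eq_mul, abs_mul, mul_comm]
    exact mul_le_mul ((hM a i).trans (le_abs_self _)) (norm_le_pi_norm (φ v) a) (abs_nonneg _)
      (abs_nonneg _)
  have hBn : 0 ≤ B v v := le_trans (by positivity) (hlow v)
  calc f i v ^ 2 = |f i v| ^ 2 := (sq_abs _).symm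
    _ ≤ ((∑ a, |M a|) * ‖φ v‖) ^ 2 := by gcongr
    _ = (∑ a, |M a|) ^ 2 / ε * (ε * ‖φ v‖ ^ 2) := by field_simp
    _ ≤ (∑ a, |M a|) ^ 2 / ε * B v v := by gcongr; exact hlow v
    _ ≤ ((∑ a, |M a|) ^ 2 / ε + 1) * B v v := by nlinarith

/-- The `L²` pairing on a space of functions with integrable products. -/
noncomputable def l2Form {X : Type*} [MeasurableSpace X] (μ : Measure X)
    (V : Submodule ℝ (X → ℝ))
    (h : ∀ p ∈ V, ∀ q ∈ V, Integrable (fun x => p x * q x) μ) : V →ₗ[ℝ] V →ₗ[ℝ] ℝ :=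
  LinearMap.mk₂ ℝ (fun p q => ∫ x, (p : X → ℝ) x * (q : X → ℝ) x ∂μ)
    (fun p p' q => by
      simp only [Submodule.coe_add, Pi.add_apply, add_mul]
      exact integral_add (h p p.2 q q.2) (h p' p'.2 q q.2))
    (fun c p q => by
      simp only [Submodule.coe_smul, Pi.smul_apply, smul_eq_mul, mul_assoc]
      exact integral_const_mul c _)
    (fun p q q' => by
      simp only [Submodule.coe_add, Pi.add_apply, mul_add]
      exact integral_add (h p p.2 q q.2) (h p p.2 q' q'.2))
    (fun c p q => by
      simp only [Submodule.coe_smul, Pi.smul_apply, smul_eq_mul, mul_left_comm _ c]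
      exact integral_const_mul c _)

theorem l2Form_apply {X : Type*} [MeasurableSpace X] (μ : Measure X)
    (V : Submodule ℝ (X → ℝ)) (h : ∀ p ∈ V, ∀ q ∈ V, Integrable (fun x => p x * q x) μ)
    (p q : V) : l2Form μ V h p q = ∫ x, (p : X → ℝ) x * (q : X → ℝ) x ∂μ := rfl

theorem integrableOn_of_continuous {d : ℕ} {f : E d → ℝ} (hf : Continuous f) {s : Set (E d)}
    (hs : Bornology.IsBounded s) : IntegrableOn f s := by
  have h1 : IsCompact (closure s) := hs.isCompact_closure
  exact (hf.continuousOn.integrableOn_compact h1).mono_set subset_closure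

/-- The integral over the smaller open set vanishes too, so `p` vanishes almost everywhere there,
everywhere there by continuity, and globally by the identity theorem. -/
theorem eq_zero_of_setIntegral_sq_eq_zero {d k : ℕ} {p : E d → ℝ} (hp : p ∈ polySpace d k)
    {s U : Set (E d)} (hU : IsOpen U) (hne : U.Nonempty) (hUs : U ⊆ s)
    (hs : Bornology.IsBounded s) (h : ∫ x in s, p x ^ 2 ≤ 0) : p = 0 := by
  have hc := continuous_of_mem_polySpace hp
  have hU0 : ∫ x in U, p x ^ 2 = 0 := by
    refine le_antisymm (le_trans ?_ h) (integral_nonneg fun x => sq_nonneg _)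
    exact setIntegral_mono_set (integrableOn_of_continuous (by fun_prop) hs)
      (Filter.Eventually.of_forall fun x => sq_nonneg _) hUs.eventuallyLE
  have h1 := (integral_eq_zero_iff_of_nonneg (fun x => sq_nonneg (p x))
    (integrableOn_of_continuous (f := fun x => p x ^ 2) (by fun_prop) (hs.subset hUs))).1 hU0
  have h2 := Measure.eqOn_open_of_ae_eq h1 hU (by fun_prop) (by fun_prop)
  refine eq_zero_of_eqOn_open hp hU hne fun x hx => ?_
  simpa using h2 hx

/-- Norm equivalence on a fixed ball, uniform over a family of functionals. The scale-independent
constants of all inverse inequalities come from here. -/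
theorem exists_bound_functional (d k : ℕ) {ι : Type*} {r : ℝ} (hr : 0 < r)
    (f : ι → polySpace d k →ₗ[ℝ] ℝ) (hf : ∀ v, ∃ M, ∀ i, |f i v| ≤ M) :
    ∃ C, 0 < C ∧ ∀ (p : polySpace d k) i,
      f i p ^ 2 ≤ C * ∫ x in Metric.ball 0 r, (p : E d → ℝ) x ^ 2 := by
  have hint : ∀ p ∈ polySpace d k, ∀ q ∈ polySpace d k,
      Integrable (fun x => p x * q x) (volume.restrict (Metric.ball (0 : E d) r)) :=
    fun p hp q hq => integrableOn_of_continuous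
      ((continuous_of_mem_polySpace hp).mul (continuous_of_mem_polySpace hq)) Metric.isBounded_ball
  obtain ⟨C, hC, h⟩ := exists_bound_of_posDef
    (l2Form (volume.restrict (Metric.ball (0 : E d) r)) (polySpace d k) hint) (fun p hp => by
      rw [l2Form_apply]
      by_contra! hle
      refine hp (Subtype.ext ?_)
      exact eq_zero_of_setIntegral_sq_eq_zero p.2 Metric.isOpen_ball
        ⟨0, Metric.mem_ball_self hr⟩ subset_rfl Metric.isBounded_ball (by simpa [sq] using hle)) f hf
  refine ⟨C, hC, fun p i => (h p i).trans_eq ?_⟩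
  simp only [l2Form_apply, sq]

/-- The affine map `y ↦ z + h y`. -/
noncomputable def scaleMap {d : ℕ} (z : E d) (h : ℝ) : E d →ᵃ[ℝ] E d :=
  (h • (LinearMap.id : E d →ₗ[ℝ] E d)).toAffineMap + AffineMap.const ℝ (E d) z

theorem scaleMap_apply {d : ℕ} (z : E d) (h : ℝ) (y : E d) : scaleMap z h y = h • y + z := by
  simp [scaleMap]

theorem setIntegral_scaleMap {d : ℕ} (f : E d → ℝ) (z : E d) {h : ℝ} (hh : 0 < h) (r : ℝ) :
    ∫ y in Metric.ball 0 r, f (scaleMap z h y) =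
      (h ^ d)⁻¹ * ∫ x in Metric.ball z (r * h), f x := by
  have h1 := Measure.setIntegral_comp_smul_of_pos (volume : Measure (E d))
    (fun y => f (y + z)) (Metric.ball 0 r) hh
  simp only [scaleMap_apply]
  rw [h1, finrank_euclideanSpace_fin, smul_eq_mul, smul_ball hh.ne', smul_zero,
    Real.norm_of_nonneg hh.le]
  congr 1
  have h2 := (measurePreserving_add_right (volume : Measure (E d)) z).setIntegral_preimage_emb
    (MeasurableEquiv.addRight z).measurableEmbedding f (Metric.ball z (r * h))
  rw [← h2]
  congr 2
  ext x
  simp [mul_comm]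

/-- Inverse inequalities: pointwise values and derivatives of polynomials are controlled by `L²`
norms over a ball. -/
theorem exists_inverse_ball (d k : ℕ) {r : ℝ} (R : ℝ) (hr : 0 < r) :
    ∃ C, 0 < C ∧ ∀ p ∈ polySpace d k, ∀ h, 0 < h → ∀ z x : E d, ‖x - z‖ ≤ R * h →
      p x ^ 2 ≤ C * ((h ^ d)⁻¹ * ∫ y in Metric.ball z (r * h), p y ^ 2) ∧
      ‖fderiv ℝ p x‖ ^ 2 ≤
        C * (h ^ 2)⁻¹ * ((h ^ d)⁻¹ * ∫ y in Metric.ball z (r * h), p y ^ 2) := by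
  let K := Metric.closedBall (0 : E d) R
  have hK : IsCompact K := isCompact_closedBall _ _
  -- Point evaluations on a fixed compact ball are pointwise bounded by continuity.
  obtain ⟨C₁, hC₁, H₁⟩ := exists_bound_functional d k hr
    (fun x : K => (LinearMap.proj (x : E d)).comp (polySpace d k).subtype) (by
      intro p
      obtain ⟨M, hM⟩ := hK.exists_bound_of_continuousOn
        (continuous_of_mem_polySpace p.2).continuousOn
      exact ⟨M, fun x => hM x x.2⟩)
  -- Directional derivatives, indexed by a point of the compact ball and a direction of length at
  -- most one.
  let D : (K × Metric.closedBall (0 : E d) 1) → polySpace d k →ₗ[ℝ] ℝ := fun xu =>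
    { toFun := fun p => fderiv ℝ (p : E d → ℝ) xu.1 xu.2
      map_add' := fun p q => by
        rw [Submodule.coe_add, fderiv_add (differentiable_of_mem_polySpace p.2 _)
          (differentiable_of_mem_polySpace q.2 _)]
        rfl
      map_smul' := fun c p => by
        rw [Submodule.coe_smul, fderiv_const_smul (differentiable_of_mem_polySpace p.2 _)]
        rfl }
  obtain ⟨C₂, hC₂, H₂⟩ := exists_bound_functional d k hr D (by
      intro p
      obtain ⟨M, hM⟩ := hK.exists_bound_of_continuousOn
        ((contDiff_of_mem_polySpace (n := 1) p.2).continuous_fderiv (by simp)).continuousOn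
      refine ⟨M, fun xu => ?_⟩
      have h1 := (fderiv ℝ (p : E d → ℝ) xu.1).le_opNorm xu.2
      have h2 : ‖(xu.2 : E d)‖ ≤ 1 := mem_closedBall_zero_iff.1 xu.2.2
      have h3 := hM xu.1 xu.1.2
      calc |D xu p| = ‖fderiv ℝ (p : E d → ℝ) xu.1 xu.2‖ := rfl
        _ ≤ ‖fderiv ℝ (p : E d → ℝ) xu.1‖ * 1 := h1.trans (by gcongr)
        _ ≤ M := by simpa using h3)
  refine ⟨max C₁ C₂, lt_max_of_lt_left hC₁, fun p hp h hh z x hx => ?_⟩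
  set y : E d := h⁻¹ • (x - z) with hy
  have hyx : scaleMap z h y = x := by
    rw [scaleMap_apply, hy, smul_smul, mul_inv_cancel₀ hh.ne', one_smul, sub_add_cancel]
  have hyK : y ∈ K := by
    rw [mem_closedBall_zero_iff, hy, norm_smul, norm_inv, Real.norm_of_nonneg hh.le]
    calc h⁻¹ * ‖x - z‖ ≤ h⁻¹ * (R * h) := by gcongr
      _ = R := by field_simp
  have hq := comp_mem_polySpace hp (scaleMap z h)
  have hI := setIntegral_scaleMap (fun y => p y ^ 2) z hh r
  have hI0 : 0 ≤ (h ^ d)⁻¹ * ∫ x in Metric.ball z (r * h), p x ^ 2 :=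
    mul_nonneg (by positivity) (integral_nonneg fun x => sq_nonneg _)
  constructor
  · have := H₁ ⟨_, hq⟩ ⟨y, hyK⟩
    simp only [LinearMap.comp_apply, Submodule.subtype_apply, LinearMap.proj_apply, hyx] at this
    rw [hI] at this
    exact this.trans (by gcongr; exact le_max_left _ _)
  -- The chain rule for the dilation produces a factor `h`, hence `h⁻²` in the squared bound.
  · have hder : ∀ u, fderiv ℝ (fun y => p (scaleMap z h y)) y u = h * fderiv ℝ p x u := by
      intro u
      have hs : HasFDerivAt (fun y => scaleMap z h y) (h • ContinuousLinearMap.id ℝ (E d)) y := by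
        have : (fun y => scaleMap z h y) = fun y => h • y + z := funext (scaleMap_apply z h)
        rw [this]
        exact ((hasFDerivAt_id y).const_smul h).add_const z
      have hp' : HasFDerivAt p (fderiv ℝ p x) (scaleMap z h y) := by
        rw [hyx]
        exact (differentiable_of_mem_polySpace hp x).hasFDerivAt
      have := (hp'.comp y hs).fderiv
      rw [Function.comp_def] at this
      rw [this]
      simp
    set Q := (h ^ d)⁻¹ * ∫ x in Metric.ball z (r * h), p x ^ 2 with hQ
    have hle : ‖fderiv ℝ p x‖ ≤ h⁻¹ * Real.sqrt (C₂ * Q) := by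
      refine ContinuousLinearMap.opNorm_le_of_unit_norm (by positivity) fun u hu => ?_
      have := H₂ ⟨_, hq⟩ (⟨y, hyK⟩, ⟨u, by simp [hu]⟩)
      simp only [D, LinearMap.coe_mk, AddHom.coe_mk, hder] at this
      rw [hI] at this
      have h2 := Real.abs_le_sqrt this
      rw [abs_mul, abs_of_pos hh] at h2
      rw [Real.norm_eq_abs, inv_mul_eq_div, le_div_iff₀ hh, mul_comm]
      exact h2
    calc ‖fderiv ℝ p x‖ ^ 2 ≤ (h⁻¹ * Real.sqrt (C₂ * Q)) ^ 2 := by gcongr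
      _ = C₂ * (h ^ 2)⁻¹ * Q := by
        rw [mul_pow, Real.sq_sqrt (by positivity), inv_pow]; ring
      _ ≤ _ := by gcongr; exact le_max_right _ _

/-- The decomposition `p(x) = p(z) + ∑ (x - z)_i / h * r_i(x)` with bounded coefficients. -/
theorem exists_bounded_decomposition (d k : ℕ) (R : ℝ) :
    ∃ C, 0 < C ∧ ∀ p ∈ polySpace d (k + 1), ∀ h, 0 < h → ∀ z : E d,
      ∃ r : Fin d → E d → ℝ, (∀ i, r i ∈ polySpace d k) ∧
        (∀ x, p x = p z + ∑ i, ((x - z) i / h) * r i x) ∧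
        ∀ M, (∀ x ∈ Metric.closedBall z h, |p x| ≤ M) →
          ∀ i x, ‖x - z‖ ≤ R * h → |r i x| ≤ C * M := by
  obtain ⟨L, hL⟩ := exists_linear_decomposition d k
  let K := Metric.closedBall (0 : E d) R
  have hK : IsCompact K := isCompact_closedBall _ _
  -- For fixed `i` and `x`, the value at `x` of the `i`-th coefficient is a linear functional of
  -- `p`, so the `L²` norm over the unit ball bounds it.
  obtain ⟨C, hC, H⟩ := exists_bound_functional d (k + 1) one_pos
    (fun x : Fin d × K => (LinearMap.proj (x.2 : E d)).comp
      ((polySpace d k).subtype.comp (L x.1))) (by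
      intro p
      have : ∀ i, ∃ M, ∀ x ∈ K, ‖(L i p : E d → ℝ) x‖ ≤ M := fun i =>
        hK.exists_bound_of_continuousOn (continuous_of_mem_polySpace (L i p).2).continuousOn
      choose M hM using this
      refine ⟨∑ i, |M i|, fun x => ((hM x.1 x.2 x.2.2).trans (le_abs_self _)).trans ?_⟩
      exact Finset.single_le_sum (f := fun i => |M i|) (fun i _ => abs_nonneg _)
        (Finset.mem_univ x.1))
  set v := (volume (Metric.ball (0 : E d) 1)).toReal with hv
  refine ⟨Real.sqrt (C * v) + 1, by positivity, fun p hp h hh z => ?_⟩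
  have hq := comp_mem_polySpace hp (scaleMap z h)
  have hinv : ∀ x, scaleMap (-(h⁻¹ • z)) h⁻¹ x = h⁻¹ • (x - z) := fun x => by
    rw [scaleMap_apply, smul_sub, sub_eq_add_neg]
  refine ⟨fun i x => (L i ⟨_, hq⟩ : E d → ℝ) (scaleMap (-(h⁻¹ • z)) h⁻¹ x), fun i =>
    comp_mem_polySpace (L i ⟨_, hq⟩).2 _, fun x => ?_, fun M hM i x hx => ?_⟩
  · have := hL ⟨_, hq⟩ (h⁻¹ • (x - z))
    simp only [scaleMap_apply, smul_smul, mul_inv_cancel₀ hh.ne', one_smul, sub_add_cancel,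
      smul_zero, zero_add] at this
    rw [this]
    congr 1
    refine Finset.sum_congr rfl fun i _ => ?_
    simp only [hinv, PiLp.smul_apply, smul_eq_mul, scaleMap_apply]
    ring
  · have hM0 : 0 ≤ M := (abs_nonneg _).trans (hM z (Metric.mem_closedBall_self hh.le))
    have hy : h⁻¹ • (x - z) ∈ K := by
      rw [mem_closedBall_zero_iff, norm_smul, norm_inv, Real.norm_of_nonneg hh.le]
      calc h⁻¹ * ‖x - z‖ ≤ h⁻¹ * (R * h) := by gcongr
        _ = R := by field_simp
    have h1 := H ⟨_, hq⟩ (i, ⟨_, hy⟩)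
    simp only [LinearMap.comp_apply, Submodule.subtype_apply, LinearMap.proj_apply] at h1
    have h2 : ∫ x in Metric.ball (0 : E d) 1, p (scaleMap z h x) ^ 2 ≤ M ^ 2 * v := by
      have : ∀ x ∈ Metric.ball (0 : E d) 1, ‖p (scaleMap z h x) ^ 2‖ ≤ M ^ 2 := by
        intro x hx
        rw [norm_pow, Real.norm_eq_abs]
        gcongr
        refine hM _ ?_
        rw [scaleMap_apply, mem_closedBall_iff_norm, add_sub_cancel_right, norm_smul,
          Real.norm_of_nonneg hh.le]
        have := (mem_ball_zero_iff.1 hx).le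
        nlinarith
      exact (le_abs_self _).trans (norm_setIntegral_le_of_norm_le_const measure_ball_lt_top this)
    have h3 := Real.abs_le_sqrt (h1.trans (mul_le_mul_of_nonneg_left h2 hC.le))
    simp only [hinv]
    refine h3.trans ?_
    rw [show C * (M ^ 2 * v) = C * v * M ^ 2 by ring, Real.sqrt_mul (by positivity),
      Real.sqrt_sq hM0]
    nlinarith

end WG

namespace WG

/-! ### Simplices and barycentric coordinates -/

variable {d : ℕ}

/-- The finite set `K` is the vertex set of a nondegenerate simplex. -/
structure IsSimplex (K : Finset (E d)) : Prop where
  card_eq : K.card = d + 1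
  indep : AffineIndependent ℝ ((↑) : K → E d)

/-- The vertices of a simplex as an affine basis. -/
noncomputable def IsSimplex.basis {K : Finset (E d)} (hK : IsSimplex K) :
    AffineBasis K ℝ (E d) where
  toFun := (↑)
  ind' := hK.indep
  tot' := by
    rw [hK.indep.affineSpan_eq_top_iff_card_eq_finrank_add_one]
    simp [hK.card_eq]

theorem IsSimplex.basis_apply {K : Finset (E d)} (hK : IsSimplex K) (a : K) :
    hK.basis a = a := rfl

open scoped Classical in
/-- The barycentric coordinate of the simplex `K` at the vertex `a`. -/
noncomputable def lam (K : Finset (E d)) (a : E d) : E d →ᵃ[ℝ] ℝ :=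
  if h : IsSimplex K ∧ a ∈ K then h.1.basis.coord ⟨a, h.2⟩ else 0

theorem lam_eq_coord {K : Finset (E d)} (hK : IsSimplex K) {a : E d} (ha : a ∈ K) :
    lam K a = hK.basis.coord ⟨a, ha⟩ := dif_pos ⟨hK, ha⟩

section

variable {K : Finset (E d)} (hK : IsSimplex K)
include hK

theorem IsSimplex.lam_self {a : E d} (ha : a ∈ K) : lam K a a = 1 := by
  rw [lam_eq_coord hK ha]
  exact hK.basis.coord_apply_eq ⟨a, ha⟩

theorem IsSimplex.lam_of_ne {a b : E d} (ha : a ∈ K) (hb : b ∈ K) (hab : a ≠ b) :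
    lam K a b = 0 := by
  rw [lam_eq_coord hK ha]
  exact hK.basis.coord_apply_ne (i := ⟨a, ha⟩) (j := ⟨b, hb⟩) (by simpa using hab)

theorem IsSimplex.sum_lam (x : E d) : ∑ a ∈ K, lam K a x = 1 := by
  have := hK.basis.sum_coord_apply_eq_one x
  rw [← Finset.sum_coe_sort]
  rw [← this]
  exact Finset.sum_congr rfl fun a _ => by rw [lam_eq_coord hK a.2]

theorem IsSimplex.sum_lam_smul (x : E d) : ∑ a ∈ K, lam K a x • a = x := by
  have := hK.basis.linear_combination_coord_eq_self x
  rw [← Finset.sum_coe_sort]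
  conv_rhs => rw [← this]
  exact Finset.sum_congr rfl fun a _ => by rw [lam_eq_coord hK a.2, hK.basis_apply]

theorem IsSimplex.convexHull_eq :
    convexHull ℝ (K : Set (E d)) = convexHull ℝ (range hK.basis) := by
  congr 1
  ext x
  simp [hK.basis_apply]

theorem IsSimplex.mem_convexHull_iff {x : E d} :
    x ∈ convexHull ℝ (K : Set (E d)) ↔ ∀ a ∈ K, 0 ≤ lam K a x := by
  rw [hK.convexHull_eq, hK.basis.convexHull_eq_nonneg_coord]
  constructor
  · intro h a ha
    rw [lam_eq_coord hK ha]
    exact h _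
  · intro h a
    have := h a a.2
    rwa [lam_eq_coord hK a.2] at this

theorem IsSimplex.mem_interior_iff {x : E d} :
    x ∈ interior (convexHull ℝ (K : Set (E d))) ↔ ∀ a ∈ K, 0 < lam K a x := by
  rw [hK.convexHull_eq, hK.basis.interior_convexHull]
  constructor
  · intro h a ha
    rw [lam_eq_coord hK ha]
    exact h _
  · intro h a
    have := h a a.2
    rwa [lam_eq_coord hK a.2] at this

theorem IsSimplex.nonempty : K.Nonempty := by
  rw [← Finset.card_pos, hK.card_eq]
  omega

theorem IsSimplex.affine_apply (f : E d →ᵃ[ℝ] ℝ) (x : E d) :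
    f x = ∑ a ∈ K, lam K a x * f a := by
  have h1 : ∀ y, f y = f.linear y + f 0 := fun y => by simpa using f.map_vadd 0 y
  rw [h1 x]
  conv_lhs => rw [← hK.sum_lam_smul x]
  rw [map_sum]
  conv_lhs => rw [← one_mul (f 0), ← hK.sum_lam x, Finset.sum_mul]
  rw [← Finset.sum_add_distrib]
  refine Finset.sum_congr rfl fun a _ => ?_
  rw [map_smul, smul_eq_mul, h1 a]
  ring

theorem IsSimplex.lam_le_one {x : E d} (hx : x ∈ convexHull ℝ (K : Set (E d))) {a : E d}
    (ha : a ∈ K) : lam K a x ≤ 1 := by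
  rw [← hK.sum_lam x]
  exact Finset.single_le_sum (f := fun a => lam K a x)
    (fun b hb => hK.mem_convexHull_iff.1 hx b hb) ha

/-- Coordinates of a point of the affine hull of some of the vertices. -/
theorem IsSimplex.lam_eq_zero_of_mem_affineSpan {e : Finset (E d)} (he : e ⊆ K) {a : E d}
    (ha : a ∈ K) (hae : a ∉ e) {x : E d} (hx : x ∈ affineSpan ℝ (e : Set (E d))) :
    lam K a x = 0 := by
  have h2 : affineSpan ℝ (e : Set (E d)) ≤
      (affineSpan ℝ ({0} : Set ℝ)).comap (lam K a) := by
    rw [affineSpan_le]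
    intro b hb
    have : lam K a b = 0 := hK.lam_of_ne ha (he hb) (by rintro rfl; exact hae hb)
    simp [this]
  simpa using h2 hx

theorem IsSimplex.mem_convexHull_face_iff {e : Finset (E d)} (he : e ⊆ K) {x : E d} :
    x ∈ convexHull ℝ (e : Set (E d)) ↔
      (∀ a ∈ K, 0 ≤ lam K a x) ∧ ∀ a ∈ K, a ∉ e → lam K a x = 0 := by
  constructor
  · intro hx
    refine ⟨hK.mem_convexHull_iff.1 (convexHull_mono (by exact_mod_cast he) hx), fun a ha hae => ?_⟩
    exact hK.lam_eq_zero_of_mem_affineSpan he ha hae (convexHull_subset_affineSpan _ hx)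
  · rintro ⟨h0, hz⟩
    have hsum : ∑ a ∈ e, lam K a x = 1 := by
      rw [← hK.sum_lam x]
      exact Finset.sum_subset he fun a ha hae => hz a ha hae
    have hx : ∑ a ∈ e, lam K a x • a = x := by
      conv_rhs => rw [← hK.sum_lam_smul x]
      exact Finset.sum_subset he fun a ha hae => by rw [hz a ha hae, zero_smul]
    rw [← hx]
    refine (convex_convexHull ℝ _).sum_mem (fun a ha => h0 a (he ha)) hsum fun a ha =>
      subset_convexHull ℝ _ (by exact_mod_cast ha)

theorem IsSimplex.mem_face_erase_iff [DecidableEq (E d)] {a : E d} (ha : a ∈ K) {x : E d} :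
    x ∈ convexHull ℝ ((K.erase a : Finset (E d)) : Set (E d)) ↔
      (∀ b ∈ K, 0 ≤ lam K b x) ∧ lam K a x = 0 := by
  rw [hK.mem_convexHull_face_iff (Finset.erase_subset a K)]
  refine and_congr_right fun _ => ⟨fun h => h a ha (Finset.notMem_erase a K), fun h b hb hbe => ?_⟩
  have : b = a := by
    by_contra hne
    exact hbe (Finset.mem_erase.2 ⟨hne, hb⟩)
  rwa [this]

theorem IsSimplex.isCompact : IsCompact (convexHull ℝ (K : Set (E d))) :=
  Set.Finite.isCompact_convexHull (𝕜 := ℝ) K.finite_toSet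

theorem IsSimplex.isBounded : Bornology.IsBounded (convexHull ℝ (K : Set (E d))) :=
  hK.isCompact.isBounded

theorem IsSimplex.interior_nonempty : (interior (convexHull ℝ (K : Set (E d)))).Nonempty := by
  rw [hK.convexHull_eq]
  exact ⟨_, hK.basis.centroid_mem_interior_convexHull⟩

end

theorem lam_mem_polySpace (K : Finset (E d)) (a : E d) :
    (fun x => lam K a x) ∈ polySpace d 1 := affine_mem_polySpace _

/-- The gradient of the barycentric coordinate `lam K a`. -/
noncomputable def lamGrad (K : Finset (E d)) (a : E d) : E d :=
  (InnerProductSpace.toDual ℝ (E d)).symm (lam K a).linear.toContinuousLinearMap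

theorem inner_lamGrad (K : Finset (E d)) (a x y : E d) :
    inner ℝ (lamGrad K a) (x - y) = lam K a x - lam K a y := by
  rw [lamGrad, InnerProductSpace.toDual_symm_apply]
  have := (lam K a).linearMap_vsub x y
  simpa using this

/-- The height of the simplex `K` over the face opposite to `a`. -/
noncomputable def height (K : Finset (E d)) (a : E d) : ℝ := ‖lamGrad K a‖⁻¹

theorem affineMap_centroid {s : Finset (E d)} (hs : s.Nonempty) (f : E d →ᵃ[ℝ] ℝ) :
    f (s.centroid ℝ id) = (s.card : ℝ)⁻¹ * ∑ a ∈ s, f a := by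
  have h1 : ∑ a ∈ s, s.centroidWeights ℝ a = 1 :=
    s.sum_centroidWeights_eq_one_of_nonempty ℝ hs
  rw [Finset.centroid_def, Finset.map_affineCombination _ _ _ h1,
    Finset.affineCombination_eq_linear_combination _ _ _ h1]
  simp [Finset.mul_sum]

section

variable {K : Finset (E d)} (hK : IsSimplex K) (hd : 1 ≤ d)
include hK hd

theorem IsSimplex.exists_ne {a : E d} (ha : a ∈ K) : ∃ b ∈ K, b ≠ a := by
  have : 1 < K.card := by rw [hK.card_eq]; omega
  obtain ⟨b, hb, hne⟩ := Finset.exists_mem_ne this a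
  exact ⟨b, hb, hne⟩

theorem IsSimplex.lamGrad_ne_zero {a : E d} (ha : a ∈ K) : lamGrad K a ≠ 0 := by
  intro h
  obtain ⟨b, hb, hne⟩ := hK.exists_ne hd ha
  have := inner_lamGrad K a a b
  rw [h, inner_zero_left, hK.lam_self ha, hK.lam_of_ne ha hb hne.symm] at this
  norm_num at this

theorem IsSimplex.height_pos {a : E d} (ha : a ∈ K) : 0 < height K a :=
  inv_pos.2 (norm_pos_iff.2 (hK.lamGrad_ne_zero hd ha))

/-- The orthogonal complement of the face directions is a line, and the gradient of `λ_a` spans it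
because `λ_a` is constant on the face. Projecting the difference of centroids onto this line leaves
only a sign to determine. -/
theorem IsSimplex.outwardNormal_eq [DecidableEq (E d)] {a : E d} (ha : a ∈ K) :
    outwardNormal K (K.erase a) = -(height K a • lamGrad K a) := by
  set e := K.erase a with he
  have hg := hK.lamGrad_ne_zero hd ha
  have hecard : e.card = (d - 1) + 1 := by
    rw [he, Finset.card_erase_of_mem ha, hK.card_eq]; omega
  have hene : e.Nonempty := by rw [← Finset.card_pos]; omega
  have hei : AffineIndependent ℝ ((↑) : e → E d) :=
    hK.indep.mono (by exact_mod_cast Finset.erase_subset a K)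
  have hrank : Module.finrank ℝ (vectorSpan ℝ (e : Set (E d))) = d - 1 := by
    have := hei.finrank_vectorSpan (n := d - 1) (by simpa using hecard)
    rw [Subtype.range_coe_subtype] at this
    simpa using this
  have hperp : lamGrad K a ∈ (vectorSpan ℝ (e : Set (E d)))ᗮ := by
    rw [Submodule.mem_orthogonal']
    intro u hu
    rw [vectorSpan_def] at hu
    induction hu using Submodule.span_induction with
    | mem u hu =>
      obtain ⟨x, hx, y, hy, rfl⟩ := Set.mem_vsub.1 hu
      have hx' := Finset.mem_erase.1 (Finset.mem_coe.1 hx)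
      have hy' := Finset.mem_erase.1 (Finset.mem_coe.1 hy)
      rw [vsub_eq_sub, inner_lamGrad, hK.lam_of_ne ha hx'.2 hx'.1.symm,
        hK.lam_of_ne ha hy'.2 hy'.1.symm, sub_zero]
    | zero => simp
    | add u v _ _ h1 h2 => rw [inner_add_right, h1, h2, add_zero]
    | smul c u _ h => rw [inner_smul_right, h, mul_zero]
  have hspan : (vectorSpan ℝ (e : Set (E d)))ᗮ = Submodule.span ℝ {lamGrad K a} := by
    symm
    apply Submodule.eq_of_le_of_finrank_eq
    · rw [Submodule.span_singleton_le_iff_mem]; exact hperp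
    · rw [finrank_span_singleton hg]
      have := (vectorSpan ℝ (e : Set (E d))).finrank_add_finrank_orthogonal
      rw [hrank, finrank_euclideanSpace_fin] at this
      omega
  -- `λ_a` is 0 at the centroid of the face and `1/(d+1)` at that of the simplex; the negative sign
  -- is what makes the normal point outwards.
  have hval : inner ℝ (lamGrad K a) (e.centroid ℝ id - K.centroid ℝ id) =
      -((d : ℝ) + 1)⁻¹ := by
    rw [inner_lamGrad, affineMap_centroid hene, affineMap_centroid hK.nonempty]
    have h1 : ∑ b ∈ e, lam K a b = 0 := Finset.sum_eq_zero fun b hb => by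
      have hb' := Finset.mem_erase.1 hb
      exact hK.lam_of_ne ha hb'.2 hb'.1.symm
    have h2 : ∑ b ∈ K, lam K a b = 1 := by
      rw [← Finset.add_sum_erase _ _ ha, ← he, h1, hK.lam_self ha, add_zero]
    rw [h1, h2, hK.card_eq]
    push_cast
    ring
  have hgn : 0 < ‖lamGrad K a‖ := norm_pos_iff.2 hg
  have hw : (vectorSpan ℝ (e : Set (E d)))ᗮ.starProjection (e.centroid ℝ id - K.centroid ℝ id) =
      -((((d : ℝ) + 1)⁻¹ / ‖lamGrad K a‖ ^ 2) • lamGrad K a) := by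
    simp only [hspan]
    rw [Submodule.starProjection_singleton, hval, neg_div, neg_smul]
    rfl
  simp only [outwardNormal]
  rw [hw, norm_neg, norm_smul, Real.norm_of_nonneg (by positivity), smul_neg, smul_smul, height]
  congr 2
  field_simp

theorem IsSimplex.norm_outwardNormal [DecidableEq (E d)] {a : E d} (ha : a ∈ K) :
    ‖outwardNormal K (K.erase a)‖ = 1 := by
  rw [hK.outwardNormal_eq hd ha, norm_neg, norm_smul, Real.norm_of_nonneg (hK.height_pos hd ha).le,
    height, inv_mul_cancel₀ (norm_ne_zero_iff.2 (hK.lamGrad_ne_zero hd ha))]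

/-- Reduces the normal components of the explicit test fields built from barycentric coordinates to
evaluations of those coordinates. -/
theorem IsSimplex.inner_outwardNormal [DecidableEq (E d)] {a : E d} (ha : a ∈ K) (x y : E d) :
    inner ℝ (x - y) (outwardNormal K (K.erase a)) = height K a * (lam K a y - lam K a x) := by
  rw [hK.outwardNormal_eq hd ha, inner_neg_right, inner_smul_right, real_inner_comm, inner_lamGrad]
  ring

end

end WG

namespace WG

variable {d : ℕ}

/-! ### Hyperplanes: parametrization and Fubini's theorem -/

/-- An isometric parametrization `ι` of the hyperplane through `p` with unit normal `ν`, together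
with Fubini's theorem along any direction `u` transversal to it. -/
theorem exists_hyperplane_param (hd : 1 ≤ d) (p ν : E d) (hν : ‖ν‖ = 1) :
    ∃ ι : E (d - 1) →ᵃⁱ[ℝ] E d, range ι = {x | inner ℝ (x - p) ν = 0} ∧
      ∀ u : E d, inner ℝ u ν ≠ 0 → ∀ F : E d → ℝ, Integrable F →
        ∫ x, F x = |inner ℝ u ν| * ∫ y, ∫ t : ℝ, F (ι y + t • u) := by
  have hν0 : ν ≠ 0 := by rintro rfl; simp at hν
  let S : Submodule ℝ (E d) := Submodule.span ℝ {ν}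
  have hrank : Module.finrank ℝ Sᗮ = d - 1 := by
    have h1 := S.finrank_add_finrank_orthogonal
    rw [finrank_span_singleton hν0, finrank_euclideanSpace_fin] at h1
    omega
  let B := (stdOrthonormalBasis ℝ Sᗮ).reindex (finCongr hrank)
  let φ : E (d - 1) ≃ₗᵢ[ℝ] Sᗮ := B.repr.symm
  let ι : E (d - 1) →ᵃⁱ[ℝ] E d :=
    ((AffineIsometryEquiv.vaddConst ℝ p).toAffineIsometry).comp
      (Sᗮ.subtypeₗᵢ.comp φ.toLinearIsometry).toAffineIsometry
  have hι : ∀ y, ι y = (φ y : E d) + p := fun y => rfl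
  have hmemS : ∀ x : E d, x ∈ Sᗮ ↔ inner ℝ x ν = 0 := fun x => by
    rw [Submodule.mem_orthogonal_singleton_iff_inner_left]
  refine ⟨ι, ?_, fun u hu F hF => ?_⟩
  · ext x
    simp only [mem_range, hι, mem_ofPred_eq]
    constructor
    · rintro ⟨y, rfl⟩
      rw [add_sub_cancel_right]
      exact (hmemS _).1 (φ y).2
    · intro hx
      exact ⟨φ.symm ⟨x - p, (hmemS _).2 hx⟩, by simp⟩
  · set c := inner ℝ u ν with hc
    let ψ : ℝ ≃ₗᵢ[ℝ] S := LinearIsometryEquiv.toSpanUnitSingleton ν hν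
    -- The orthogonal splitting along `ν` preserves Lebesgue measure.
    have hmp1 : MeasurePreserving (fun ty : ℝ × E (d - 1) => ι ty.2 + ty.1 • ν)
        (volume.prod volume) volume := by
      have h1 : MeasurePreserving (S.measurableEquivProd p).symm (volume.prod volume) volume := by
        have := S.measurePreserving_measurableEquivProd (P := E d) p
        rw [InnerProductSpace.euclideanHausdorffMeasure_eq_volume] at this
        exact this.symm
      have h2 := (ψ.measurePreserving.prod φ.measurePreserving)
      have h3 := h1.comp h2
      convert h3 using 1
      funext ty
      simp [hι, ψ]
      abel
    have hw : u - c • ν ∈ Sᗮ := by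
      rw [hmemS, inner_sub_left, inner_smul_left, real_inner_self_eq_norm_sq, hν]
      simp [hc]
    set w := φ.symm ⟨_, hw⟩ with hwdef
    -- A shear turns the normal direction into `u = c ν + w`, with `w` tangential: the line
    -- parameter is scaled by `c`, which gives the Jacobian, and each slice is translated by a
    -- multiple of `w`.
    have hmp2 : MeasurePreserving (fun ty : ℝ × E (d - 1) => (c * ty.1, ty.2 + ty.1 • w))
        ((ENNReal.ofReal |c| • (volume : Measure ℝ)).prod volume) (volume.prod volume) := by
      refine MeasurePreserving.skew_product
        (⟨measurable_const_mul c, ?_⟩ : MeasurePreserving (fun t : ℝ => c * t) _ _)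
        (g := fun t y => y + t • w) (by fun_prop) (Filter.Eventually.of_forall fun t => ?_)
      · rw [Measure.map_smul]
        exact Real.smul_map_volume_mul_left hu
      · exact (measurePreserving_add_right volume (t • w)).map_eq
    have hmp := hmp1.comp hmp2
    have hΨ : ((fun ty : ℝ × E (d - 1) => ι ty.2 + ty.1 • ν) ∘
        fun ty : ℝ × E (d - 1) => (c * ty.1, ty.2 + ty.1 • w)) =
        fun ty => ι ty.2 + ty.1 • u := by
      funext ty
      have : (φ w : E d) = u - c • ν := by simp [hwdef]
      simp only [Function.comp_apply, hι, map_add, map_smul, Submodule.coe_add,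
        Submodule.coe_smul, this]
      rw [smul_sub, smul_smul, mul_comm c]
      abel
    rw [hΨ] at hmp
    have h4 : Integrable (fun ty : ℝ × E (d - 1) => F (ι ty.2 + ty.1 • u))
        ((ENNReal.ofReal |c| • (volume : Measure ℝ)).prod volume) :=
      (hmp.integrable_comp hF.aestronglyMeasurable).2 hF
    conv_lhs => rw [← hmp.map_eq]
    rw [integral_map hmp.measurable.aemeasurable
      (by rw [hmp.map_eq]; exact hF.aestronglyMeasurable), integral_prod_symm _ h4]
    rw [← integral_const_mul]
    congr 1
    funext y
    rw [integral_smul_measure, ENNReal.toReal_ofReal (abs_nonneg c), smul_eq_mul]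

/-- Integrals over a subset of a hyperplane for the surface measure. -/
theorem setIntegral_hausdorff_eq (hd : 1 ≤ d) (ι : E (d - 1) →ᵃⁱ[ℝ] E d) {s : Set (E d)}
    (hs : MeasurableSet s) (hsub : s ⊆ range ι) {f : E d → ℝ} :
    ∫ x in s, f x ∂μHE[d - 1] = ∫ y in ι ⁻¹' s, f (ι y) := by
  have h1 : (volume : Measure (E (d - 1))).map ι =
      (μHE[d - 1] : Measure (E d)).restrict (range ι) := by
    rw [← EuclideanSpace.euclideanHausdorffMeasure_eq_volume]
    exact ι.isometry.map_euclideanHausdorffMeasure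
  have h2 : (μHE[d - 1] : Measure (E d)).restrict s =
      ((volume : Measure (E (d - 1))).map ι).restrict s := by
    rw [h1, Measure.restrict_restrict hs, inter_eq_self_of_subset_left hsub]
  have hemb : MeasurableEmbedding ι := ι.isometry.isClosedEmbedding.measurableEmbedding
  rw [h2, hemb.restrict_map, hemb.integral_map]

end WG

namespace WG

variable {d : ℕ}

/-! ### The divergence theorem on a simplex -/

theorem lam_add_smul (K : Finset (E d)) (c x a b : E d) (t : ℝ) :
    lam K c (x + t • (a - b)) = lam K c x + t * (lam K c a - lam K c b) := by
  have h1 := inner_lamGrad K c (x + t • (a - b)) x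
  rw [add_sub_cancel_left, inner_smul_right, inner_lamGrad] at h1
  linarith

theorem continuous_lam (K : Finset (E d)) (a : E d) : Continuous fun x => lam K a x :=
  continuous_of_mem_polySpace (lam_mem_polySpace K a)

theorem isClosed_face (e : Finset (E d)) : IsClosed (convexHull ℝ (e : Set (E d))) :=
  (Set.Finite.isCompact_convexHull (𝕜 := ℝ) e.finite_toSet).isClosed

theorem isCompact_face (e : Finset (E d)) : IsCompact (convexHull ℝ (e : Set (E d))) :=
  Set.Finite.isCompact_convexHull (𝕜 := ℝ) e.finite_toSet

section

variable {K : Finset (E d)} (hK : IsSimplex K) (hd : 1 ≤ d) [DecidableEq (E d)]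
include hK hd

/-- Face integrals become Lebesgue integrals on `ℝ^{d-1}`. The Fubini density in the direction `b -
c` is the absolute value of its normal component. -/
theorem IsSimplex.exists_face_param {a : E d} (ha : a ∈ K) :
    ∃ ι : E (d - 1) →ᵃⁱ[ℝ] E d, (∀ x, x ∈ range ι ↔ lam K a x = 0) ∧
      (∀ f, intFace (K.erase a) f =
        ∫ y in ι ⁻¹' convexHull ℝ ((K.erase a : Finset (E d)) : Set (E d)), f (ι y)) ∧
      ∀ b c, lam K a b ≠ lam K a c → ∀ F : E d → ℝ, Integrable F →
        ∫ x, F x = height K a * |lam K a b - lam K a c| *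
          ∫ y, ∫ t : ℝ, F (ι y + t • (b - c)) := by
  obtain ⟨p, hp, hpa⟩ := hK.exists_ne hd ha
  have hH := hK.height_pos hd ha
  obtain ⟨ι, hι, hF⟩ := exists_hyperplane_param hd p _ (hK.norm_outwardNormal hd ha)
  have hr : ∀ x, x ∈ range ι ↔ lam K a x = 0 := by
    intro x
    rw [hι, mem_ofPred_eq, hK.inner_outwardNormal hd ha, hK.lam_of_ne ha hp hpa.symm]
    simp [hH.ne']
  refine ⟨ι, hr, fun f => ?_, fun b c hbc F hFi => ?_⟩
  · refine setIntegral_hausdorff_eq hd ι (isClosed_face _).measurableSet fun x hx => ?_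
    exact (hr x).2 ((hK.mem_face_erase_iff ha).1 hx).2
  · have h1 := hK.inner_outwardNormal hd ha b c
    have h2 := hF (b - c) (by
      rw [h1]
      exact mul_ne_zero hH.ne' (sub_ne_zero.2 hbc.symm)) F hFi
    rw [h2, h1, abs_mul, abs_of_pos hH, abs_sub_comm]

/-- Transfer of face integrals along an edge direction. -/
theorem IsSimplex.intFace_transfer {a b : E d} (ha : a ∈ K) (hb : b ∈ K) (hab : a ≠ b)
    {g : E d → ℝ} (hg : Continuous g) :
    height K a * intFace (K.erase a) (fun x => g (x + lam K b x • (a - b))) =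
      height K b * intFace (K.erase b) g := by
  obtain ⟨ιa, hra, hIa, hFa⟩ := hK.exists_face_param hd ha
  obtain ⟨ιb, hrb, hIb, hFb⟩ := hK.exists_face_param hd hb
  set Sa := convexHull ℝ ((K.erase a : Finset (E d)) : Set (E d))
  set Sb := convexHull ℝ ((K.erase b : Finset (E d)) : Set (E d)) with hSb
  have hlaa := hK.lam_self ha
  have hlbb := hK.lam_self hb
  have hlab := hK.lam_of_ne ha hb hab
  have hlba := hK.lam_of_ne hb ha hab.symm
  have hcb := continuous_lam K b
  -- The map `x ↦ x + λ_b(x)(a - b)` projects onto the hyperplane `λ_b = 0` along `a - b`, so `P` is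
  -- a slanted prism over the face opposite `b`, and the integrand is constant along its fibres.
  -- Seen from either hyperplane the fibres are parameter intervals of length one; computing one
  -- integral by Fubini from both hyperplanes gives the two sides.
  let P : Set (E d) := {x | x + lam K b x • (a - b) ∈ Sb ∧ lam K b x ∈ Icc (0 : ℝ) 1}
  have hPc : IsCompact P := by
    refine Metric.isCompact_of_isClosed_isBounded ?_ ?_
    · exact ((isClosed_face _).preimage (by fun_prop)).inter (isClosed_Icc.preimage hcb)
    · obtain ⟨C, hC⟩ := (isCompact_face (K.erase b)).isBounded.exists_norm_le
      refine isBounded_iff_forall_norm_le.2 ⟨C + ‖a - b‖, fun x hx => ?_⟩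
      have h1 := hC _ hx.1
      have h2 : x = (x + lam K b x • (a - b)) - lam K b x • (a - b) := by abel
      rw [h2]
      refine (norm_sub_le _ _).trans (add_le_add h1 ?_)
      rw [norm_smul, Real.norm_of_nonneg hx.2.1]
      exact mul_le_of_le_one_left (norm_nonneg _) hx.2.2
  let F : E d → ℝ := P.indicator fun x => g (x + lam K b x • (a - b))
  have hFi : Integrable F := by
    rw [integrable_indicator_iff hPc.measurableSet]
    exact (Continuous.continuousOn (by fun_prop)).integrableOn_compact hPc
  have hIcc : ∀ α : ℝ, ∫ t, (Icc (α - 1) α).indicator (fun _ => (1 : ℝ)) t = 1 := by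
    intro α
    rw [integral_indicator measurableSet_Icc]
    simp
  have hA : ∫ x, F x = height K a * intFace (K.erase a) fun x => g (x + lam K b x • (a - b)) := by
    rw [hFa a b (by rw [hlaa, hlab]; norm_num) F hFi, hlaa, hlab, hIa, sub_zero, abs_one, mul_one,
      ← integral_indicator ((isClosed_face _).measurableSet.preimage ιa.continuous.measurable)]
    congr 2
    funext y
    have hy : lam K a (ιa y) = 0 := (hra _).1 (mem_range_self y)
    have key : ∀ t : ℝ, F (ιa y + t • (a - b)) =
        ((ιa ⁻¹' Sa).indicator (fun y => g (ιa y + lam K b (ιa y) • (a - b))) y) *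
          (Icc (lam K b (ιa y) - 1) (lam K b (ιa y))).indicator (fun _ => (1 : ℝ)) t := by
      intro t
      have h1 : lam K b (ιa y + t • (a - b)) = lam K b (ιa y) - t := by
        rw [lam_add_smul, hlba, hlbb]; ring
      have h2 : ιa y + t • (a - b) + lam K b (ιa y + t • (a - b)) • (a - b) =
          ιa y + lam K b (ιa y) • (a - b) := by
        rw [h1, sub_smul]; abel
      -- The projection identifies the two faces: on the face opposite `a` it merely exchanges the
      -- values of `λ_a` and `λ_b` and leaves the other coordinates alone.
      have h3 : ιa y + lam K b (ιa y) • (a - b) ∈ Sb ↔ y ∈ ιa ⁻¹' Sa := by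
        rw [hSb, hK.mem_face_erase_iff hb, mem_preimage, hK.mem_face_erase_iff ha]
        simp only [lam_add_smul, hy, hlba, hlbb]
        refine ⟨fun h => ⟨fun c hc => ?_, trivial⟩, fun h => ⟨fun c hc => ?_, by ring⟩⟩
        · by_cases hca : c = a
          · rw [hca, hy]
          by_cases hcb : c = b
          · have := h.1 a ha
            rw [hy, hlaa, hlab] at this
            rw [hcb]
            linarith
          · have := h.1 c hc
            rwa [hK.lam_of_ne hc ha hca, hK.lam_of_ne hc hb hcb, sub_zero, mul_zero,
              add_zero] at this
        · by_cases hca : c = a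
          · rw [hca, hy, hlaa, hlab]
            have := h.1 b hb
            linarith
          by_cases hcb : c = b
          · rw [hcb, hlba, hlbb]
            linarith
          · rw [hK.lam_of_ne hc ha hca, hK.lam_of_ne hc hb hcb, sub_zero, mul_zero, add_zero]
            exact h.1 c hc
      have h4 : ιa y + t • (a - b) ∈ P ↔
          y ∈ ιa ⁻¹' Sa ∧ t ∈ Icc (lam K b (ιa y) - 1) (lam K b (ιa y)) := by
        change (_ + _ ∈ Sb ∧ 0 ≤ _ ∧ _ ≤ 1) ↔ _ ∧ _ ≤ _ ∧ _ ≤ _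
        rw [h2, h1, h3]
        refine and_congr_right fun _ => ⟨fun h => ⟨by linarith [h.2], by linarith [h.1]⟩,
          fun h => ⟨by linarith [h.2], by linarith [h.1]⟩⟩
      change P.indicator _ _ = _
      by_cases h5 : ιa y + t • (a - b) ∈ P
      · rw [indicator_of_mem h5, indicator_of_mem (h4.1 h5).1, indicator_of_mem (h4.1 h5).2, h2,
          mul_one]
      · rw [indicator_of_notMem h5]
        by_cases h6 : y ∈ ιa ⁻¹' Sa
        · rw [indicator_of_notMem (fun h7 => h5 (h4.2 ⟨h6, h7⟩)), mul_zero]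
        · rw [indicator_of_notMem h6, zero_mul]
    simp only [key]
    rw [integral_const_mul, hIcc, mul_one]
  have hB : ∫ x, F x = height K b * intFace (K.erase b) g := by
    rw [hFb a b (by rw [hlba, hlbb]; norm_num) F hFi, hlba, hlbb, hIb, zero_sub, abs_neg, abs_one,
      mul_one, ← integral_indicator ((isClosed_face _).measurableSet.preimage
        ιb.continuous.measurable)]
    congr 2
    funext y
    have hy : lam K b (ιb y) = 0 := (hrb _).1 (mem_range_self y)
    have key : ∀ t : ℝ, F (ιb y + t • (a - b)) =
        ((ιb ⁻¹' Sb).indicator (fun y => g (ιb y)) y) *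
          (Icc (0 - 1) (0 : ℝ)).indicator (fun _ => (1 : ℝ)) t := by
      intro t
      have h1 : lam K b (ιb y + t • (a - b)) = - t := by
        rw [lam_add_smul, hlba, hlbb, hy]; ring
      have h2 : ιb y + t • (a - b) + lam K b (ιb y + t • (a - b)) • (a - b) = ιb y := by
        rw [h1, neg_smul]; abel
      have h4 : ιb y + t • (a - b) ∈ P ↔ y ∈ ιb ⁻¹' Sb ∧ t ∈ Icc (0 - 1) (0 : ℝ) := by
        change (_ + _ ∈ Sb ∧ 0 ≤ _ ∧ _ ≤ 1) ↔ _ ∈ Sb ∧ _ ≤ _ ∧ _ ≤ _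
        rw [h2, h1]
        refine and_congr_right fun _ => ⟨fun h => ⟨by linarith [h.2], by linarith [h.1]⟩,
          fun h => ⟨by linarith [h.2], by linarith [h.1]⟩⟩
      change P.indicator _ _ = _
      by_cases h5 : ιb y + t • (a - b) ∈ P
      · rw [indicator_of_mem h5, indicator_of_mem (h4.1 h5).1, indicator_of_mem (h4.1 h5).2, h2,
          mul_one]
      · rw [indicator_of_notMem h5]
        by_cases h6 : y ∈ ιb ⁻¹' Sb
        · rw [indicator_of_notMem (fun h7 => h5 (h4.2 ⟨h6, h7⟩)), mul_zero]
        · rw [indicator_of_notMem h6, zero_mul]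
    simp only [key]
    rw [integral_const_mul, hIcc, mul_one]
  rw [← hA, hB]

theorem IsSimplex.intFace_sub {a : E d} (ha : a ∈ K) {f g : E d → ℝ} (hf : Continuous f)
    (hg : Continuous g) : intFace (K.erase a) (fun x => f x - g x) =
      intFace (K.erase a) f - intFace (K.erase a) g := by
  obtain ⟨ι, -, hI, -⟩ := hK.exists_face_param hd ha
  have hcomp : IsCompact (ι ⁻¹' convexHull ℝ ((K.erase a : Finset (E d)) : Set (E d))) :=
    ι.isometry.isClosedEmbedding.isCompact_preimage (isCompact_face _)
  rw [hI, hI, hI]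
  exact integral_sub
    ((hf.comp ι.continuous).continuousOn.integrableOn_compact hcomp)
    ((hg.comp ι.continuous).continuousOn.integrableOn_compact hcomp)

/-- A line in the direction `a - b` enters `K` through the face `λ_a = 0` and leaves through `λ_b =
0`. The fundamental theorem of calculus on it gives exit minus entry value, and
`IsSimplex.intFace_transfer` turns the integral of the exit values into one over the face opposite
`b`. -/
theorem IsSimplex.integral_fderiv_edge {a b : E d} (ha : a ∈ K) (hb : b ∈ K) (hab : a ≠ b)
    {f : E d → ℝ} (hf : ContDiff ℝ 1 f) :
    intElem K (fun x => fderiv ℝ f x (a - b)) =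
      height K b * intFace (K.erase b) f - height K a * intFace (K.erase a) f := by
  obtain ⟨ιa, hra, hIa, hFa⟩ := hK.exists_face_param hd ha
  have hlaa := hK.lam_self ha
  have hlbb := hK.lam_self hb
  have hlab := hK.lam_of_ne ha hb hab
  have hlba := hK.lam_of_ne hb ha hab.symm
  have hcb := continuous_lam K b
  have hfd : Continuous fun x => fderiv ℝ f x (a - b) :=
    (hf.continuous_fderiv (by simp)).clm_apply continuous_const
  have hFi : Integrable ((convexHull ℝ (K : Set (E d))).indicator
      fun x => fderiv ℝ f x (a - b)) := by
    rw [integrable_indicator_iff hK.isCompact.measurableSet]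
    exact hfd.continuousOn.integrableOn_compact hK.isCompact
  rw [← hK.intFace_transfer hd ha hb hab hf.continuous, ← mul_sub,
    ← hK.intFace_sub hd ha (by fun_prop) hf.continuous]
  rw [intElem, ← integral_indicator hK.isCompact.measurableSet,
    hFa a b (by rw [hlaa, hlab]; norm_num) _ hFi, hlaa, hlab, hIa, sub_zero, abs_one, mul_one,
    ← integral_indicator ((isClosed_face _).measurableSet.preimage ιa.continuous.measurable)]
  congr 2
  funext y
  have hy : lam K a (ιa y) = 0 := (hra _).1 (mem_range_self y)
  set β := lam K b (ιa y) with hβ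
  -- Along the line `λ_a` equals `t` and `λ_b` equals `β - t`, while the other coordinates stay
  -- constant.
  have hmem : ∀ t : ℝ, ιa y + t • (a - b) ∈ convexHull ℝ (K : Set (E d)) ↔
      t ∈ Icc 0 β ∧ ∀ c ∈ K, c ≠ a → c ≠ b → 0 ≤ lam K c (ιa y) := by
    intro t
    rw [hK.mem_convexHull_iff]
    simp only [lam_add_smul]
    constructor
    · intro h
      refine ⟨⟨?_, ?_⟩, fun c hc hca hcb => ?_⟩
      · have := h a ha
        rw [hy, hlaa, hlab] at this
        linarith
      · have := h b hb
        rw [hlba, hlbb] at this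
        linarith
      · have := h c hc
        rwa [hK.lam_of_ne hc ha hca, hK.lam_of_ne hc hb hcb, sub_zero, mul_zero, add_zero] at this
    · rintro ⟨⟨h0, h1⟩, h2⟩ c hc
      by_cases hca : c = a
      · rw [hca, hy, hlaa, hlab]
        linarith
      by_cases hcb : c = b
      · rw [hcb, hlba, hlbb]
        linarith
      · rw [hK.lam_of_ne hc ha hca, hK.lam_of_ne hc hb hcb, sub_zero, mul_zero, add_zero]
        exact h2 c hc hca hcb
  have hface : y ∈ ιa ⁻¹' convexHull ℝ ((K.erase a : Finset (E d)) : Set (E d)) ↔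
      0 ≤ β ∧ ∀ c ∈ K, c ≠ a → c ≠ b → 0 ≤ lam K c (ιa y) := by
    rw [mem_preimage, hK.mem_face_erase_iff ha]
    refine ⟨fun h => ⟨h.1 b hb, fun c hc _ _ => h.1 c hc⟩, fun h => ⟨fun c hc => ?_, hy⟩⟩
    by_cases hca : c = a
    · rw [hca, hy]
    by_cases hcb : c = b
    · rw [hcb]; exact h.1
    · exact h.2 c hc hca hcb
  by_cases hin : y ∈ ιa ⁻¹' convexHull ℝ ((K.erase a : Finset (E d)) : Set (E d))
  · rw [indicator_of_mem hin]
    have hin' := hface.1 hin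
    have h1 : (fun t : ℝ => (convexHull ℝ (K : Set (E d))).indicator
        (fun x => fderiv ℝ f x (a - b)) (ιa y + t • (a - b))) =
        (Icc 0 β).indicator fun t => fderiv ℝ f (ιa y + t • (a - b)) (a - b) := by
      funext t
      by_cases ht : t ∈ Icc 0 β
      · rw [indicator_of_mem ht, indicator_of_mem ((hmem t).2 ⟨ht, hin'.2⟩)]
      · rw [indicator_of_notMem ht, indicator_of_notMem fun h => ht ((hmem t).1 h).1]
    rw [h1, integral_indicator measurableSet_Icc, integral_Icc_eq_integral_Ioc,
      ← intervalIntegral.integral_of_le hin'.1]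
    have hder : ∀ t ∈ uIcc 0 β, HasDerivAt (fun t : ℝ => f (ιa y + t • (a - b)))
        (fderiv ℝ f (ιa y + t • (a - b)) (a - b)) t := by
      intro t _
      have h2 : HasDerivAt (fun t : ℝ => ιa y + t • (a - b)) (a - b) t := by
        simpa using ((hasDerivAt_id t).smul_const (a - b)).const_add (ιa y)
      exact ((hf.differentiable (by simp)) _).hasFDerivAt.comp_hasDerivAt t h2
    rw [intervalIntegral.integral_eq_sub_of_hasDerivAt hder
      ((hfd.comp (by fun_prop : Continuous fun t : ℝ => ιa y + t • (a - b))).intervalIntegrable _ _)]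
    simp [hβ]
  · rw [indicator_of_notMem hin]
    have h1 : (fun t : ℝ => (convexHull ℝ (K : Set (E d))).indicator
        (fun x => fderiv ℝ f x (a - b)) (ιa y + t • (a - b))) = fun _ => 0 := by
      funext t
      refine indicator_of_notMem (fun h => hin (hface.2 ?_)) _
      have := (hmem t).1 h
      exact ⟨this.1.1.trans this.1.2, this.2⟩
    rw [h1, integral_zero]

/-- Both sides are linear in `u`, and the edges span the space. For an edge `a - b` only the normals
of the faces opposite `a` and `b` contribute. -/
theorem IsSimplex.integral_fderiv {f : E d → ℝ} (hf : ContDiff ℝ 1 f) (u : E d) :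
    intElem K (fun x => fderiv ℝ f x u) =
      ∑ c ∈ K, inner ℝ u (outwardNormal K (K.erase c)) * intFace (K.erase c) f := by
  have hfd : ∀ v, Continuous fun x => fderiv ℝ f x v := fun v =>
    (hf.continuous_fderiv (by simp)).clm_apply continuous_const
  have hedge : ∀ a ∈ K, ∀ b ∈ K, intElem K (fun x => fderiv ℝ f x (a - b)) =
      ∑ c ∈ K, inner ℝ (a - b) (outwardNormal K (K.erase c)) * intFace (K.erase c) f := by
    intro a ha b hb
    by_cases hab : a = b
    · simp [hab, intElem]
    · rw [hK.integral_fderiv_edge hd ha hb hab hf]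
      rw [← Finset.add_sum_erase _ _ ha,
        ← Finset.add_sum_erase _ _ (Finset.mem_erase.2 ⟨Ne.symm hab, hb⟩), Finset.sum_eq_zero]
      · rw [hK.inner_outwardNormal hd ha, hK.inner_outwardNormal hd hb, hK.lam_self ha,
          hK.lam_self hb, hK.lam_of_ne ha hb hab, hK.lam_of_ne hb ha (Ne.symm hab)]
        ring
      · intro c hc
        have h1 := Finset.mem_erase.1 hc
        have h2 := Finset.mem_erase.1 h1.2
        rw [hK.inner_outwardNormal hd h2.2, hK.lam_of_ne h2.2 ha h2.1, hK.lam_of_ne h2.2 hb h1.1]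
        ring
  obtain ⟨b, hb⟩ := hK.nonempty
  -- The barycentric coordinates of `b + u` express `u` through the edges at `b`.
  have hu : u = ∑ a ∈ K, lam K a (b + u) • (a - b) := by
    simp only [smul_sub, Finset.sum_sub_distrib, ← Finset.sum_smul]
    rw [hK.sum_lam, hK.sum_lam_smul]
    simp
  have hL : intElem K (fun x => fderiv ℝ f x u) =
      ∑ a ∈ K, lam K a (b + u) * intElem K (fun x => fderiv ℝ f x (a - b)) := by
    have h1 : (fun x => fderiv ℝ f x u) =
        fun x => ∑ a ∈ K, lam K a (b + u) * fderiv ℝ f x (a - b) := by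
      funext x
      conv_lhs => rw [hu]
      simp only [map_sum, map_smul, smul_eq_mul]
    rw [h1]
    unfold intElem
    rw [integral_finsetSum]
    · exact Finset.sum_congr rfl fun a _ => integral_const_mul _ _
    · exact fun a _ => ((hfd _).continuousOn.integrableOn_compact hK.isCompact).const_mul _
  rw [hL, Finset.sum_congr rfl fun a ha => by rw [hedge a ha b hb]]
  simp only [Finset.mul_sum]
  rw [Finset.sum_comm]
  refine Finset.sum_congr rfl fun c _ => ?_
  conv_rhs => rw [hu, sum_inner, Finset.sum_mul]
  refine Finset.sum_congr rfl fun a _ => ?_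
  rw [real_inner_smul_left]
  ring

end

end WG

namespace WG

variable {d : ℕ}

/-! ### Scaled estimates on shape-regular simplices -/

/-- The simplex `K` has size comparable to `h`: it contains a ball of radius `r h` and has diameter
at most `R h`. -/
structure HasShape (r R h : ℝ) (K : Finset (E d)) : Prop where
  simplex : IsSimplex K
  h_pos : 0 < h
  r_pos : 0 < r
  ball : ∃ z, Metric.ball z (r * h) ⊆ convexHull ℝ (K : Set (E d))
  diam : ∀ x ∈ convexHull ℝ (K : Set (E d)), ∀ y ∈ convexHull ℝ (K : Set (E d)),
    ‖x - y‖ ≤ R * h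

theorem vertex_mem {K : Finset (E d)} {a : E d} (ha : a ∈ K) :
    a ∈ convexHull ℝ (K : Set (E d)) := subset_convexHull ℝ _ (by exact_mod_cast ha)

theorem face_subset {e K : Finset (E d)} (he : e ⊆ K) :
    convexHull ℝ (e : Set (E d)) ⊆ convexHull ℝ (K : Set (E d)) :=
  convexHull_mono (by exact_mod_cast he)

section

variable {r R h : ℝ} {K : Finset (E d)}

/-- Moving from the centre of the inscribed ball by `r h / 2` along the gradient of `λ_a` stays in
`K`, where `λ_a` varies by at most 1; so the gradient has length at most `2/(r h)`. -/
theorem HasShape.height_ge (hK : HasShape r R h K) (hd : 1 ≤ d) {a : E d} (ha : a ∈ K) :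
    r / 2 * h ≤ height K a := by
  obtain ⟨z, hz⟩ := hK.ball
  have hs := hK.simplex
  have hg := hs.lamGrad_ne_zero hd ha
  have hgn : 0 < ‖lamGrad K a‖ := norm_pos_iff.2 hg
  have hrh : 0 < r * h := mul_pos hK.r_pos hK.h_pos
  let v : E d := (r * h / 2) • (‖lamGrad K a‖⁻¹ • lamGrad K a)
  have hv : ‖v‖ = r * h / 2 := by
    rw [norm_smul, norm_smul, norm_inv, norm_norm, inv_mul_cancel₀ hgn.ne', mul_one,
      Real.norm_of_nonneg (by positivity)]
  have h1 : z + v ∈ convexHull ℝ (K : Set (E d)) := hz (by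
    rw [Metric.mem_ball, dist_eq_norm, add_sub_cancel_left, hv]; linarith)
  have h2 : z ∈ convexHull ℝ (K : Set (E d)) := hz (Metric.mem_ball_self hrh)
  have h3 := inner_lamGrad K a (z + v) z
  rw [add_sub_cancel_left] at h3
  have h4 : inner ℝ (lamGrad K a) v = r * h / 2 * ‖lamGrad K a‖ := by
    simp only [v, inner_smul_right, real_inner_self_eq_norm_sq]
    field_simp
  have h5 := hs.lam_le_one h1 ha
  have h6 := hs.mem_convexHull_iff.1 h2 a ha
  rw [height, le_inv_comm₀ (by have := hK.r_pos; have := hK.h_pos; positivity) hgn, ← one_div,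
    le_div_iff₀ (by have := hK.r_pos; have := hK.h_pos; positivity)]
  nlinarith

/-- Project the inscribed ball from `a` onto the opposite face. The homothety centred at `a` that
sends the ball centre into the hyperplane has ratio `1/τ ≥ 1` with `τ = 1 - λ_a(z)`, so the radius
does not shrink. -/
theorem HasShape.exists_face_ball [DecidableEq (E d)] (hK : HasShape r R h K) (hd : 1 ≤ d)
    {a : E d} (ha : a ∈ K) :
    ∃ z ∈ convexHull ℝ ((K.erase a : Finset (E d)) : Set (E d)),
      ∀ x, lam K a x = 0 → ‖x - z‖ < r * h →
        x ∈ convexHull ℝ ((K.erase a : Finset (E d)) : Set (E d)) := by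
  obtain ⟨z, hz⟩ := hK.ball
  have hs := hK.simplex
  have hrh : 0 < r * h := mul_pos hK.r_pos hK.h_pos
  have hzi : z ∈ interior (convexHull ℝ (K : Set (E d))) :=
    mem_interior.2 ⟨_, hz, Metric.isOpen_ball, Metric.mem_ball_self hrh⟩
  have hpos := hs.mem_interior_iff.1 hzi
  set τ := 1 - lam K a z with hτ
  have hτ0 : 0 < τ := by
    obtain ⟨b, hb, hba⟩ := hs.exists_ne hd ha
    have h1 := hs.sum_lam z
    rw [← Finset.add_sum_erase _ _ ha] at h1
    have h2 : 0 < ∑ c ∈ K.erase a, lam K c z := Finset.sum_pos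
      (fun c hc => hpos c (Finset.mem_of_mem_erase hc)) ⟨b, Finset.mem_erase.2 ⟨hba, hb⟩⟩
    linarith
  have hτ1 : τ ≤ 1 := by linarith [hpos a ha]
  have hlam : ∀ (b x : E d) (t : ℝ), lam K b (a + t • (x - a)) =
      lam K b a + t * (lam K b x - lam K b a) := fun b x t => lam_add_smul K b a x a t
  have key : ∀ x, lam K a x = 0 → ‖x - (a + τ⁻¹ • (z - a))‖ < r * h →
        x ∈ convexHull ℝ ((K.erase a : Finset (E d)) : Set (E d)) := by
    intro x hx hxz
    have hy : a + τ • (x - a) ∈ convexHull ℝ (K : Set (E d)) := by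
      refine hz ?_
      rw [Metric.mem_ball, dist_eq_norm]
      have : a + τ • (x - a) - z = τ • (x - (a + τ⁻¹ • (z - a))) := by
        rw [sub_add_eq_sub_sub, smul_sub τ (x - a), smul_smul, mul_inv_cancel₀ hτ0.ne', one_smul]
        abel
      rw [this, norm_smul, Real.norm_of_nonneg hτ0.le]
      nlinarith [norm_nonneg (x - (a + τ⁻¹ • (z - a)))]
    rw [hs.mem_face_erase_iff ha]
    refine ⟨fun b hb => ?_, hx⟩
    by_cases hba : b = a
    · rw [hba, hx]
    · have h1 := hs.mem_convexHull_iff.1 hy b hb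
      rw [hlam, hs.lam_of_ne hb ha hba, zero_add, sub_zero] at h1
      exact nonneg_of_mul_nonneg_right h1 hτ0
  refine ⟨a + τ⁻¹ • (z - a), key _ ?_ (by simpa using hrh), key⟩
  rw [hlam, hs.lam_self ha]
  have : lam K a z - 1 = -τ := by rw [hτ]; ring
  rw [this]
  field_simp
  ring

end

/-- Pointwise bounds of polynomials and their gradients on an element by the `L²` norm. -/
theorem exists_elem_inverse (d k : ℕ) {r : ℝ} (R : ℝ) (hr : 0 < r) :
    ∃ C, 0 < C ∧ ∀ (K : Finset (E d)) (h : ℝ), HasShape r R h K → ∀ p ∈ polySpace d k,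
      ∀ x ∈ convexHull ℝ (K : Set (E d)),
        p x ^ 2 ≤ C * ((h ^ d)⁻¹ * intElem K fun y => p y ^ 2) ∧
        ‖fderiv ℝ p x‖ ^ 2 ≤ C * (h ^ 2)⁻¹ * ((h ^ d)⁻¹ * intElem K fun y => p y ^ 2) := by
  obtain ⟨C, hC, H⟩ := exists_inverse_ball d k R hr
  refine ⟨C, hC, fun K h hK p hp x hx => ?_⟩
  have hh := hK.h_pos
  obtain ⟨z, hz⟩ := hK.ball
  have hzK : z ∈ convexHull ℝ (K : Set (E d)) :=
    hz (Metric.mem_ball_self (mul_pos hr hh))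
  obtain ⟨h1, h2⟩ := H p hp h hh z x (hK.diam x hx z hzK)
  have h3 : ∫ y in Metric.ball z (r * h), p y ^ 2 ≤ intElem K fun y => p y ^ 2 :=
    setIntegral_mono_set (integrableOn_of_continuous
      ((continuous_of_mem_polySpace hp).pow 2) hK.simplex.isBounded)
      (Filter.Eventually.of_forall fun y => sq_nonneg _) hz.eventuallyLE
  exact ⟨h1.trans (by gcongr), h2.trans (by gcongr)⟩

/-- Pointwise bounds of polynomials on the hyperplane of a face by the `L²` norm on the face. -/
theorem exists_face_inverse (d k : ℕ) (hd : 1 ≤ d) [DecidableEq (E d)] {r : ℝ} (R R' : ℝ)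
    (hr : 0 < r) :
    ∃ C, 0 < C ∧ ∀ (K : Finset (E d)) (h : ℝ), HasShape r R h K → ∀ a ∈ K,
      ∀ p ∈ polySpace d k, ∀ x, lam K a x = 0 →
        ∀ y ∈ convexHull ℝ ((K.erase a : Finset (E d)) : Set (E d)), ‖x - y‖ ≤ R' * h →
        p x ^ 2 ≤ C * ((h ^ (d - 1))⁻¹ * intFace (K.erase a) fun y => p y ^ 2) := by
  -- The point `x` is within `R' h` of a point of the face, which is within `R h` of the centre of
  -- the ball inside the face.
  obtain ⟨C, hC, H⟩ := exists_inverse_ball (d - 1) k (R + R') hr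
  refine ⟨C, hC, fun K h hK a ha p hp x hx y hy hxy => ?_⟩
  have hh := hK.h_pos
  obtain ⟨z, hz, hball⟩ := hK.exists_face_ball hd ha
  obtain ⟨ι, hι, hI, -⟩ := hK.simplex.exists_face_param hd ha
  obtain ⟨x', rfl⟩ := (hι x).2 hx
  obtain ⟨z', rfl⟩ := (hι z).2 ((hK.simplex.mem_face_erase_iff ha).1 hz).2
  have hq := comp_mem_polySpace hp ι.toAffineMap
  have hdist : ‖x' - z'‖ ≤ (R + R') * h := by
    rw [← dist_eq_norm, ← ι.dist_map, dist_eq_norm]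
    have h1 := hK.diam y (face_subset (Finset.erase_subset a K) hy) _
      (face_subset (Finset.erase_subset a K) hz)
    calc ‖ι x' - ι z'‖ ≤ ‖ι x' - y‖ + ‖y - ι z'‖ := norm_sub_le_norm_sub_add_norm_sub _ _ _
      _ ≤ (R + R') * h := by linarith
  have h1 := (H _ hq h hh z' x' hdist).1
  refine h1.trans ?_
  have hsub : Metric.ball z' (r * h) ⊆
      ι ⁻¹' convexHull ℝ ((K.erase a : Finset (E d)) : Set (E d)) := fun w hw => by
    refine hball _ ((hι _).1 (mem_range_self w)) ?_
    rw [← dist_eq_norm, ι.dist_map]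
    exact hw
  have hb : Bornology.IsBounded (ι ⁻¹' convexHull ℝ ((K.erase a : Finset (E d)) : Set (E d))) :=
    (ι.isometry.isClosedEmbedding.isCompact_preimage (isCompact_face _)).isBounded
  have h3 : ∫ w in Metric.ball z' (r * h), p (ι w) ^ 2 ≤ intFace (K.erase a) fun y => p y ^ 2 := by
    rw [hI]
    exact setIntegral_mono_set (integrableOn_of_continuous
      ((continuous_of_mem_polySpace hq).pow 2) hb)
      (Filter.Eventually.of_forall fun y => sq_nonneg _) hsub.eventuallyLE
  simp only [AffineIsometry.coe_toAffineMap]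
  gcongr

/-- The volume of the unit ball. -/
noncomputable def ballVol (n : ℕ) : ℝ := volume.real (Metric.ball (0 : E n) 1)

theorem ballVol_nonneg (n : ℕ) : 0 ≤ ballVol n := measureReal_nonneg

theorem volume_closedBall_real {n : ℕ} (z : E n) {ρ : ℝ} (hρ : 0 ≤ ρ) :
    volume.real (Metric.closedBall z ρ) = ρ ^ n * ballVol n := by
  rw [measureReal_def, Measure.addHaar_closedBall _ _ hρ, ENNReal.toReal_mul,
    ENNReal.toReal_ofReal (by positivity), finrank_euclideanSpace_fin]
  rfl

theorem setIntegral_le_of_subset_closedBall {n : ℕ} {s : Set (E n)} {z : E n} {ρ M : ℝ}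
    (hρ : 0 ≤ ρ) (hs : s ⊆ Metric.closedBall z ρ) {f : E n → ℝ} (hM : 0 ≤ M)
    (hf : ∀ x ∈ s, |f x| ≤ M) : ∫ x in s, f x ≤ M * (ρ ^ n * ballVol n) := by
  have hlt : volume s < ⊤ := (measure_mono hs).trans_lt measure_closedBall_lt_top
  have h1 := norm_setIntegral_le_of_norm_le_const (f := f) hlt hf
  refine (le_abs_self _).trans (h1.trans ?_)
  gcongr
  rw [← volume_closedBall_real z hρ]
  exact measureReal_mono hs measure_closedBall_lt_top.ne

section

variable {r R h : ℝ} {K : Finset (E d)}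

theorem HasShape.R_nonneg (hK : HasShape r R h K) : 0 ≤ R := by
  obtain ⟨a, ha⟩ := hK.simplex.nonempty
  have h1 := hK.diam a (vertex_mem ha) a (vertex_mem ha)
  rw [sub_self, norm_zero] at h1
  exact nonneg_of_mul_nonneg_left h1 hK.h_pos

theorem HasShape.intElem_le (hK : HasShape r R h K) {f : E d → ℝ} {M : ℝ} (hM : 0 ≤ M)
    (hf : ∀ x ∈ convexHull ℝ (K : Set (E d)), |f x| ≤ M) :
    intElem K f ≤ R ^ d * ballVol d * (h ^ d * M) := by
  obtain ⟨a, ha⟩ := hK.simplex.nonempty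
  have h1 := setIntegral_le_of_subset_closedBall (z := a)
    (mul_nonneg hK.R_nonneg hK.h_pos.le) (fun x hx => by
      rw [Metric.mem_closedBall, dist_eq_norm]
      exact hK.diam x hx a (vertex_mem ha)) hM hf
  refine h1.trans_eq ?_
  rw [mul_pow]
  ring

theorem HasShape.intFace_le [DecidableEq (E d)] (hK : HasShape r R h K) (hd : 1 ≤ d) {a : E d}
    (ha : a ∈ K) {f : E d → ℝ} {M : ℝ} (hM : 0 ≤ M)
    (hf : ∀ x ∈ convexHull ℝ ((K.erase a : Finset (E d)) : Set (E d)), |f x| ≤ M) :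
    intFace (K.erase a) f ≤ R ^ (d - 1) * ballVol (d - 1) * (h ^ (d - 1) * M) := by
  obtain ⟨z, hz, -⟩ := hK.exists_face_ball hd ha
  obtain ⟨ι, hι, hI, -⟩ := hK.simplex.exists_face_param hd ha
  obtain ⟨z', rfl⟩ := (hι z).2 ((hK.simplex.mem_face_erase_iff ha).1 hz).2
  rw [hI]
  have h1 := setIntegral_le_of_subset_closedBall (z := z')
    (s := ι ⁻¹' convexHull ℝ ((K.erase a : Finset (E d)) : Set (E d)))
    (mul_nonneg hK.R_nonneg hK.h_pos.le) (fun x hx => by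
      rw [Metric.mem_closedBall, ← ι.dist_map, dist_eq_norm]
      exact hK.diam _ (face_subset (Finset.erase_subset a K) hx) _
        (face_subset (Finset.erase_subset a K) hz)) hM (f := fun y => f (ι y))
    (fun y hy => hf _ hy)
  refine h1.trans_eq ?_
  rw [mul_pow]
  ring

end

/-- The discrete trace inequality. -/
theorem exists_trace (d k : ℕ) (hd : 1 ≤ d) [DecidableEq (E d)] {r : ℝ} (R : ℝ) (hr : 0 < r) :
    ∃ C, 0 < C ∧ ∀ (K : Finset (E d)) (h : ℝ), HasShape r R h K → ∀ a ∈ K,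
      ∀ p ∈ polySpace d k,
        intFace (K.erase a) (fun y => p y ^ 2) ≤ C * (h⁻¹ * intElem K fun y => p y ^ 2) := by
  obtain ⟨C, hC, H⟩ := exists_elem_inverse d k R hr
  refine ⟨|R| ^ (d - 1) * ballVol (d - 1) * C + 1, by
    have := ballVol_nonneg (d - 1); positivity, fun K h hK a ha p hp => ?_⟩
  have hh := hK.h_pos
  set I := intElem K fun y => p y ^ 2 with hI
  have hI0 : 0 ≤ I := integral_nonneg fun x => sq_nonneg _
  have h1 := hK.intFace_le hd ha (f := fun y => p y ^ 2) (M := C * ((h ^ d)⁻¹ * I))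
    (by positivity) (fun x hx => by
      rw [abs_of_nonneg (sq_nonneg _)]
      exact (H K h hK p hp x (face_subset (Finset.erase_subset a K) hx)).1)
  refine h1.trans ?_
  rw [abs_of_nonneg hK.R_nonneg]
  -- The surface factor `h^(d-1)` against the volume factor `h^d` leaves `h⁻¹`.
  have h2 : h ^ (d - 1) * (C * ((h ^ d)⁻¹ * I)) = C * (h⁻¹ * I) := by
    have : h ^ d = h ^ (d - 1) * h := by rw [← pow_succ]; congr 1; omega
    rw [this]
    field_simp
  rw [h2]
  have : 0 ≤ h⁻¹ * I := by positivity
  nlinarith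

end WG

namespace WG

variable {d : ℕ}

/-! ### Integration by parts -/

theorem hausdorff_restrict_eq (hd : 1 ≤ d) (ι : E (d - 1) →ᵃⁱ[ℝ] E d) {s : Set (E d)}
    (hs : MeasurableSet s) (hsub : s ⊆ range ι) :
    (μHE[d - 1] : Measure (E d)).restrict s =
      ((volume : Measure (E (d - 1))).restrict (ι ⁻¹' s)).map ι := by
  have h1 : (volume : Measure (E (d - 1))).map ι =
      (μHE[d - 1] : Measure (E d)).restrict (range ι) := by
    rw [← EuclideanSpace.euclideanHausdorffMeasure_eq_volume]
    exact ι.isometry.map_euclideanHausdorffMeasure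
  rw [← ι.isometry.isClosedEmbedding.measurableEmbedding.restrict_map, h1,
    Measure.restrict_restrict hs, inter_eq_self_of_subset_left hsub]

theorem IsSimplex.integrableOn_face [DecidableEq (E d)] {K : Finset (E d)} (hK : IsSimplex K)
    (hd : 1 ≤ d) {a : E d} (ha : a ∈ K) {f : E d → ℝ} (hf : Continuous f) :
    IntegrableOn f (convexHull ℝ ((K.erase a : Finset (E d)) : Set (E d))) μHE[d - 1] := by
  obtain ⟨ι, hι, -, -⟩ := hK.exists_face_param hd ha
  have hemb : MeasurableEmbedding ι := ι.isometry.isClosedEmbedding.measurableEmbedding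
  rw [IntegrableOn, hausdorff_restrict_eq hd ι (isClosed_face _).measurableSet
    (fun x hx => (hι x).2 ((hK.mem_face_erase_iff ha).1 hx).2), hemb.integrable_map_iff]
  exact (hf.comp ι.continuous).continuousOn.integrableOn_compact
    (ι.isometry.isClosedEmbedding.isCompact_preimage (isCompact_face _))

theorem IsSimplex.integrableOn_elem {K : Finset (E d)} (hK : IsSimplex K) {f : E d → ℝ}
    (hf : Continuous f) : IntegrableOn f (convexHull ℝ (K : Set (E d))) :=
  hf.continuousOn.integrableOn_compact hK.isCompact

theorem continuous_of_mem_vecPoly {k : ℕ} {q : E d → E d} (hq : q ∈ vecPoly d k) :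
    Continuous q := by
  have h1 : Continuous fun x i => q x i :=
    continuous_pi fun i => continuous_of_mem_polySpace (hq i)
  exact (PiLp.continuous_toLp 2 (fun _ : Fin d => ℝ)).comp h1

theorem vecPoly_mono {k l : ℕ} (h : k ≤ l) : vecPoly d k ≤ vecPoly d l :=
  fun _ hq i => polySpace_mono h (hq i)

theorem smul_const_mem_vecPoly {k : ℕ} {p : E d → ℝ} (hp : p ∈ polySpace d k) (u : E d) :
    (fun x => p x • u) ∈ vecPoly d k := fun i => by
  simpa using mul_const_mem_polySpace hp (u i)

theorem smul_id_mem_vecPoly {k : ℕ} {p : E d → ℝ} (hp : p ∈ polySpace d k) :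
    (fun x => p x • x) ∈ vecPoly d (k + 1) := fun i => by
  simpa using mul_mem_polySpace hp (coord_mem_polySpace i)

/-- The degree-`j` homogeneous part of `p` times `x` is the enrichment of the Raviart-Thomas space;
the lower parts times `x` already lie in `[P_j]^d`. -/
theorem smul_id_mem_RT {j : ℕ} {p : E d → ℝ} (hp : p ∈ polySpace d j) :
    (fun x => p x • x) ∈ Pair.RT.gradSpace d j := by
  obtain ⟨P, hP, rfl⟩ := mem_polySpace.1 hp
  have h1 : P = ∑ i ∈ Finset.range (j + 1), MvPolynomial.homogeneousComponent i P := by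
    conv_lhs => rw [← MvPolynomial.sum_homogeneousComponent P]
    refine Finset.sum_subset (fun i hi => ?_) fun i _ hi => ?_
    · rw [Finset.mem_range] at hi ⊢
      omega
    · refine MvPolynomial.homogeneousComponent_eq_zero _ _ ?_
      rw [Finset.mem_range] at hi
      omega
  have h2 : (fun x : E d => MvPolynomial.eval (fun i => x i) P • x) =
      ∑ i ∈ Finset.range (j + 1), fun x : E d =>
        MvPolynomial.eval (fun i => x i) (MvPolynomial.homogeneousComponent i P) • x := by
    funext x
    conv_lhs => rw [h1]
    rw [map_sum, Finset.sum_smul, Finset.sum_apply]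
  rw [h2]
  refine Submodule.sum_mem _ fun i hi => ?_
  have hi' := Finset.mem_range.1 hi
  have hdeg : (MvPolynomial.homogeneousComponent i P).totalDegree ≤ i :=
    (MvPolynomial.homogeneousComponent_isHomogeneous i P).totalDegree_le
  by_cases hij : i = j
  · refine Submodule.mem_sup_right ⟨fun x => MvPolynomial.eval (fun i => x i)
      (MvPolynomial.homogeneousComponent i P), ⟨MvPolynomial.homogeneousComponent i P, ?_, ?_⟩, rfl⟩
    · exact hij ▸ MvPolynomial.homogeneousComponent_isHomogeneous i P
    · funext x
      simp [evalPoly]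
  · refine Submodule.mem_sup_left (vecPoly_mono (show i + 1 ≤ j by omega) ?_)
    exact smul_id_mem_vecPoly (mem_polySpace.2 ⟨_, hdeg, rfl⟩)

/-- These fields belong to both spaces of weak gradients, which allows one bubble field to serve
both pairs. -/
theorem smul_sub_mem_gradSpace (pr : Pair) {j : ℕ} {p : E d → ℝ} (hp : p ∈ polySpace d j)
    (a : E d) : (fun x => p x • (x - a)) ∈ pr.gradSpace d j := by
  have h : (fun x => p x • (x - a)) = (fun x => p x • x) - fun x => p x • a := by
    funext x
    simp [smul_sub]
  rw [h]
  cases pr with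
  | RT =>
    exact Submodule.sub_mem _ (smul_id_mem_RT hp)
      (Submodule.mem_sup_left (smul_const_mem_vecPoly hp a))
  | BDM =>
    exact Submodule.sub_mem _ (smul_id_mem_vecPoly hp)
      (vecPoly_mono (Nat.le_succ j) (smul_const_mem_vecPoly hp a))

theorem gradSpace_le (pr : Pair) (j : ℕ) : pr.gradSpace d j ≤ vecPoly d (j + 1) := by
  cases pr with
  | RT =>
    refine sup_le (vecPoly_mono (Nat.le_succ j)) ?_
    rintro _ ⟨_, ⟨P, hP, rfl⟩, rfl⟩
    refine smul_id_mem_vecPoly (mem_polySpace.2 ⟨P, ?_, ?_⟩)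
    · exact MvPolynomial.IsHomogeneous.totalDegree_le hP
    · funext x
      simp [evalPoly]
  | BDM => exact le_rfl

theorem inner_eq_sum (x y : E d) : inner ℝ x y = ∑ i, x i * y i := by
  simp [PiLp.inner_apply, mul_comm]

theorem clm_apply_eq_sum (f : E d →L[ℝ] ℝ) (x : E d) :
    f x = ∑ i, x i * f (EuclideanSpace.single i 1) := by
  have h := (EuclideanSpace.basisFun (Fin d) ℝ).sum_repr x
  conv_lhs => rw [← h]
  simp

theorem divergence_mem_polySpace {k : ℕ} {q : E d → E d} (hq : q ∈ vecPoly d k) :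
    divergence q ∈ polySpace d k :=
  sum_fun_mem_polySpace _ fun i _ =>
    polySpace_mono (Nat.sub_le k 1) (fderiv_apply_mem_polySpace (hq i) _)

section

variable {K : Finset (E d)} (hK : IsSimplex K) (hd : 1 ≤ d) [DecidableEq (E d)]
include hK hd

/-- Apply the divergence theorem to `v q_i` in the direction of the `i`-th coordinate and sum over
`i`. -/
theorem IsSimplex.integration_by_parts {k l : ℕ} {v : E d → ℝ} (hv : v ∈ polySpace d k)
    {q : E d → E d} (hq : q ∈ vecPoly d l) :
    intElem K (fun x => fderiv ℝ v x (q x)) =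
      -intElem K (fun x => v x * divergence q x) +
        ∑ a ∈ K, intFace (K.erase a) fun x =>
          v x * inner ℝ (q x) (outwardNormal K (K.erase a)) := by
  have hvc := continuous_of_mem_polySpace hv
  have hqc := fun i => continuous_of_mem_polySpace (hq i)
  have hvd : ∀ u, Continuous fun x => fderiv ℝ v x u := fun u =>
    continuous_of_mem_polySpace (fderiv_apply_mem_polySpace hv u)
  have hqd : ∀ i u, Continuous fun x => fderiv ℝ (fun y => q y i) x u := fun i u =>
    continuous_of_mem_polySpace (fderiv_apply_mem_polySpace (hq i) u)
  have h1 : ∀ i, intElem K (fun x => v x * fderiv ℝ (fun y => q y i) x (EuclideanSpace.single i 1)) +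
      intElem K (fun x => q x i * fderiv ℝ v x (EuclideanSpace.single i 1)) =
      ∑ a ∈ K, inner ℝ (EuclideanSpace.single i 1) (outwardNormal K (K.erase a)) *
        intFace (K.erase a) fun x => v x * q x i := by
    intro i
    have h2 := hK.integral_fderiv hd (f := fun x => v x * q x i)
      (contDiff_of_mem_polySpace (n := 1) (mul_mem_polySpace hv (hq i)))
      (EuclideanSpace.single i 1)
    rw [← h2]
    unfold intElem
    refine (integral_add (hK.integrableOn_elem (hvc.mul (hqd i _)))
      (hK.integrableOn_elem ((hqc i).mul (hvd _)))).symm.trans ?_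
    congr 1
    funext x
    have h6 := fderiv_fun_mul (differentiable_of_mem_polySpace hv x)
      (differentiable_of_mem_polySpace (hq i) x)
    simp only [h6, Pi.mul_apply, add_apply, FunLike.coe_smul, Pi.smul_apply, smul_eq_mul]
  have h3 : intElem K (fun x => v x * divergence q x) =
      ∑ i, intElem K (fun x => v x * fderiv ℝ (fun y => q y i) x (EuclideanSpace.single i 1)) := by
    unfold intElem divergence
    simp only [Finset.mul_sum]
    exact integral_finsetSum _ fun i _ => hK.integrableOn_elem (hvc.mul (hqd i _))
  have h4 : intElem K (fun x => fderiv ℝ v x (q x)) =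
      ∑ i, intElem K (fun x => q x i * fderiv ℝ v x (EuclideanSpace.single i 1)) := by
    unfold intElem
    simp only [fun x => clm_apply_eq_sum (fderiv ℝ v x) (q x)]
    exact integral_finsetSum _ fun i _ => hK.integrableOn_elem ((hqc i).mul (hvd _))
  have h5 : ∀ a ∈ K, intFace (K.erase a) (fun x =>
      v x * inner ℝ (q x) (outwardNormal K (K.erase a))) =
      ∑ i, inner ℝ (EuclideanSpace.single i 1) (outwardNormal K (K.erase a)) *
        intFace (K.erase a) fun x => v x * q x i := by
    intro a ha
    unfold intFace
    simp only [← integral_const_mul]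
    refine Eq.trans ?_ (integral_finsetSum _ fun i _ =>
      (hK.integrableOn_face hd ha (hvc.mul (hqc i))).const_mul _)
    congr 1
    funext x
    rw [inner_eq_sum, Finset.mul_sum]
    refine Finset.sum_congr rfl fun i _ => ?_
    rw [EuclideanSpace.inner_single_left]
    simp
    ring
  rw [Finset.sum_congr rfl h5, Finset.sum_comm, ← Finset.sum_congr rfl fun i _ => h1 i, h3, h4,
    Finset.sum_add_distrib]
  ring

end

end WG

namespace WG

variable {d : ℕ}

/-! ### Test fields with vanishing normal traces -/

/-- The field `∑ λ_a (∇v · a) (a - x)`, whose normal components vanish on all faces of `K`. -/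
noncomputable def bubbleField (K : Finset (E d)) (v : E d → ℝ) (x : E d) : E d :=
  ∑ a ∈ K, (fderiv ℝ v x a * lam K a x) • (a - x)

/-- The coefficient `(∇v · a) λ_a` still has degree at most `j`, since differentiation makes room
for the barycentric coordinate. -/
theorem bubbleField_mem (K : Finset (E d)) (pr : Pair) {j : ℕ} {v : E d → ℝ}
    (hv : v ∈ polySpace d j) : bubbleField K v ∈ pr.gradSpace d j := by
  have h : bubbleField K v =
      -∑ a ∈ K, fun x => (fderiv ℝ v x a * lam K a x) • (x - a) := by
    funext x
    rw [Pi.neg_apply, Finset.sum_apply, ← Finset.sum_neg_distrib]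
    exact Finset.sum_congr rfl fun a _ => by rw [← smul_neg, neg_sub]
  rw [h]
  exact Submodule.neg_mem _ (Submodule.sum_mem _ fun a _ =>
    smul_sub_mem_gradSpace pr (fderiv_mul_mem_polySpace hv (lam_mem_polySpace K a) a) a)

section

variable {K : Finset (E d)} (hK : IsSimplex K)
include hK

/-- On the face opposite `c`, the vector `a - x` is tangential for `a ≠ c`, and the remaining
summand carries the vanishing factor `λ_c`. -/
theorem IsSimplex.inner_bubbleField [DecidableEq (E d)] (hd : 1 ≤ d) (v : E d → ℝ) {c : E d}
    (hc : c ∈ K) {x : E d} (hx : lam K c x = 0) :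
    inner ℝ (bubbleField K v x) (outwardNormal K (K.erase c)) = 0 := by
  rw [bubbleField, sum_inner]
  refine Finset.sum_eq_zero fun a ha => ?_
  rw [real_inner_smul_left, hK.inner_outwardNormal hd hc, hx]
  by_cases hac : a = c
  · rw [hac, hx]; ring
  · rw [hK.lam_of_ne hc ha (Ne.symm hac)]; ring

/-- Since `∑ λ_a (a - x) = 0`, replacing `∇v · a` by `∇v · (a - x)` changes nothing. In this form
the pairing with `∇v` is a sum of squares and the size of the field is visible. -/
theorem IsSimplex.bubbleField_eq (v : E d → ℝ) (x : E d) :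
    bubbleField K v x = ∑ a ∈ K, (lam K a x * fderiv ℝ v x (a - x)) • (a - x) := by
  have h1 : ∑ a ∈ K, (lam K a x * fderiv ℝ v x x) • (a - x) = 0 := by
    simp only [mul_comm _ (fderiv ℝ v x x), mul_smul, ← Finset.smul_sum, smul_sub,
      Finset.sum_sub_distrib, ← Finset.sum_smul]
    rw [hK.sum_lam_smul, hK.sum_lam, one_smul, sub_self]
  rw [bubbleField, ← sub_zero (∑ a ∈ K, _), ← h1, ← Finset.sum_sub_distrib]
  refine Finset.sum_congr rfl fun a _ => ?_
  rw [← sub_smul, map_sub]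
  congr 1
  ring

theorem IsSimplex.fderiv_bubbleField (v : E d → ℝ) (x : E d) :
    fderiv ℝ v x (bubbleField K v x) = ∑ a ∈ K, lam K a x * fderiv ℝ v x (a - x) ^ 2 := by
  rw [hK.bubbleField_eq, map_sum]
  refine Finset.sum_congr rfl fun a _ => ?_
  rw [map_smul, smul_eq_mul]
  ring

end

section

variable {r R h : ℝ} {K : Finset (E d)} (hK : HasShape r R h K)
include hK

theorem HasShape.norm_bubbleField_le (v : E d → ℝ) {x : E d}
    (hx : x ∈ convexHull ℝ (K : Set (E d))) :
    ‖bubbleField K v x‖ ≤ (R * h) ^ 2 * ‖fderiv ℝ v x‖ := by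
  rw [hK.simplex.bubbleField_eq]
  refine (norm_sum_le _ _).trans ?_
  rw [← one_mul ((R * h) ^ 2 * _), ← hK.simplex.sum_lam x, Finset.sum_mul]
  refine Finset.sum_le_sum fun a ha => ?_
  have h1 := hK.simplex.mem_convexHull_iff.1 hx a ha
  have h2 := hK.diam a (vertex_mem ha) x hx
  have h3 := (fderiv ℝ v x).le_opNorm (a - x)
  have h4 := norm_nonneg (a - x)
  rw [norm_smul, norm_mul, Real.norm_of_nonneg h1, mul_assoc]
  refine mul_le_mul_of_nonneg_left ?_ h1
  calc ‖fderiv ℝ v x (a - x)‖ * ‖a - x‖ ≤ (‖fderiv ℝ v x‖ * ‖a - x‖) * ‖a - x‖ := by gcongr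
    _ = ‖a - x‖ ^ 2 * ‖fderiv ℝ v x‖ := by ring
    _ ≤ (R * h) ^ 2 * ‖fderiv ℝ v x‖ := by gcongr

/-- Moving from `x` away from `a` by the fraction `s = r/(4(R+1))` of the distance stays in the
inscribed ball; nonnegativity of `λ_a` there reads `(1 + s) λ_a(x) ≥ s`. -/
theorem HasShape.lam_ge {z : E d} (hz : Metric.ball z (r * h) ⊆ convexHull ℝ (K : Set (E d)))
    {x : E d} (hx : x ∈ Metric.ball z (r / 2 * h)) {a : E d} (ha : a ∈ K) :
    r / (4 * (R + 1)) / (1 + r / (4 * (R + 1))) ≤ lam K a x := by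
  have hr := hK.r_pos
  have hh := hK.h_pos
  have hR := hK.R_nonneg
  set s := r / (4 * (R + 1)) with hs
  have hs0 : 0 < s := by positivity
  rw [Metric.mem_ball, dist_eq_norm] at hx
  have hxK : x ∈ convexHull ℝ (K : Set (E d)) := hz (by
    rw [Metric.mem_ball, dist_eq_norm]; nlinarith)
  have h1 : x + s • (x - a) ∈ convexHull ℝ (K : Set (E d)) := by
    refine hz ?_
    rw [Metric.mem_ball, dist_eq_norm]
    have h2 := hK.diam x hxK a (vertex_mem ha)
    have h3 : s * (R * h) ≤ r / 4 * h := by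
      rw [hs, div_mul_eq_mul_div, div_le_iff₀ (by positivity)]
      nlinarith [mul_pos hr hh]
    calc ‖x + s • (x - a) - z‖ = ‖(x - z) + s • (x - a)‖ := by congr 1; abel
      _ ≤ ‖x - z‖ + s * ‖x - a‖ := by
        refine (norm_add_le _ _).trans_eq ?_
        rw [norm_smul, Real.norm_of_nonneg hs0.le]
      _ ≤ ‖x - z‖ + s * (R * h) := by gcongr
      _ < r * h := by nlinarith [mul_pos hr hh]
  have h2 := hK.simplex.mem_convexHull_iff.1 h1 a ha
  rw [lam_add_smul, hK.simplex.lam_self ha] at h2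
  rw [div_le_iff₀ (by positivity)]
  linarith

/-- A step `w` of length `r h / 4` in the direction of steepest ascent of `f` stays in `K`, and
`f(w) = (r/4) h ‖f‖` is a convex combination of the numbers `f(a - x)`; one of them is at least as
large. -/
theorem HasShape.exists_vertex_ge {z : E d}
    (hz : Metric.ball z (r * h) ⊆ convexHull ℝ (K : Set (E d)))
    {x : E d} (hx : x ∈ Metric.ball z (r / 2 * h)) (f : E d →L[ℝ] ℝ) :
    ∃ a ∈ K, r / 4 * h * ‖f‖ ≤ f (a - x) := by
  have hr := hK.r_pos
  have hh := hK.h_pos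
  rw [Metric.mem_ball, dist_eq_norm] at hx
  let u := (InnerProductSpace.toDual ℝ (E d)).symm f
  have hu : ‖u‖ = ‖f‖ := by simp [u]
  have hfu : ∀ w, f w = inner ℝ u w := fun w => by simp [u, InnerProductSpace.toDual_symm_apply]
  by_cases h0 : ‖f‖ = 0
  · obtain ⟨a, ha⟩ := hK.simplex.nonempty
    refine ⟨a, ha, ?_⟩
    rw [norm_eq_zero.1 h0]
    simp
  have hpos : 0 < ‖f‖ := lt_of_le_of_ne (norm_nonneg f) (Ne.symm h0)
  set w : E d := (r / 4 * h) • (‖f‖⁻¹ • u) with hw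
  have hwn : ‖w‖ = r / 4 * h := by
    rw [hw, norm_smul, norm_smul, norm_inv, norm_norm, hu, inv_mul_cancel₀ h0, mul_one,
      Real.norm_of_nonneg (by positivity)]
  have hfw : f w = r / 4 * h * ‖f‖ := by
    rw [hfu, hw, inner_smul_right, inner_smul_right, real_inner_self_eq_norm_sq, hu]
    field_simp
  have hy : x + w ∈ convexHull ℝ (K : Set (E d)) := by
    refine hz ?_
    rw [Metric.mem_ball, dist_eq_norm]
    calc ‖x + w - z‖ = ‖(x - z) + w‖ := by congr 1; abel
      _ ≤ ‖x - z‖ + ‖w‖ := norm_add_le _ _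
      _ < r * h := by rw [hwn]; nlinarith [mul_pos hr hh]
  have hlam := hK.simplex.mem_convexHull_iff.1 hy
  have hsum : ∑ a ∈ K, lam K a (x + w) * f (a - x) = r / 4 * h * ‖f‖ := by
    rw [← hfw]
    have h1 : w = ∑ a ∈ K, lam K a (x + w) • (a - x) := by
      simp only [smul_sub, Finset.sum_sub_distrib, ← Finset.sum_smul]
      rw [hK.simplex.sum_lam_smul, hK.simplex.sum_lam, one_smul, add_sub_cancel_left]
    conv_rhs => rw [h1]
    rw [map_sum]
    exact Finset.sum_congr rfl fun a _ => by rw [map_smul, smul_eq_mul]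
  by_contra! hcon
  have h2 : ∑ a ∈ K, lam K a (x + w) * (r / 4 * h * ‖f‖ - f (a - x)) ≤ 0 := by
    simp only [mul_sub, Finset.sum_sub_distrib, ← Finset.sum_mul]
    rw [hK.simplex.sum_lam, hsum]
    simp
  have h3 : ∀ a ∈ K, lam K a (x + w) * (r / 4 * h * ‖f‖ - f (a - x)) = 0 := by
    have hnn : ∀ a ∈ K, 0 ≤ lam K a (x + w) * (r / 4 * h * ‖f‖ - f (a - x)) := fun a ha =>
      mul_nonneg (hlam a ha) (sub_nonneg.2 (hcon a ha).le)
    exact (Finset.sum_eq_zero_iff_of_nonneg hnn).1 (le_antisymm h2 (Finset.sum_nonneg hnn))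
  have h4 : ∑ a ∈ K, lam K a (x + w) = 0 := Finset.sum_eq_zero fun a ha =>
    (mul_eq_zero.1 (h3 a ha)).resolve_right (sub_ne_zero.2 (hcon a ha).ne')
  rw [hK.simplex.sum_lam] at h4
  norm_num at h4

theorem HasShape.bubble_ge {z : E d}
    (hz : Metric.ball z (r * h) ⊆ convexHull ℝ (K : Set (E d)))
    {x : E d} (hx : x ∈ Metric.ball z (r / 2 * h)) (v : E d → ℝ) :
    r / (4 * (R + 1)) / (1 + r / (4 * (R + 1))) * (r / 4) ^ 2 * (h ^ 2 * ‖fderiv ℝ v x‖ ^ 2) ≤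
      fderiv ℝ v x (bubbleField K v x) := by
  have hr := hK.r_pos
  have hh := hK.h_pos
  have hR := hK.R_nonneg
  have hlow := fun a ha => hK.lam_ge hz hx (a := a) ha
  obtain ⟨a, ha, hfa⟩ := hK.exists_vertex_ge hz hx (fderiv ℝ v x)
  rw [hK.simplex.fderiv_bubbleField]
  have hc0 : 0 ≤ r / (4 * (R + 1)) / (1 + r / (4 * (R + 1))) := by positivity
  set c := r / (4 * (R + 1)) / (1 + r / (4 * (R + 1)))
  calc c * (r / 4) ^ 2 * (h ^ 2 * ‖fderiv ℝ v x‖ ^ 2)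
      = c * (r / 4 * h * ‖fderiv ℝ v x‖) ^ 2 := by ring
    _ ≤ lam K a x * fderiv ℝ v x (a - x) ^ 2 := by
      have h1 := hlow a ha
      have h2 := hc0.trans h1
      gcongr
    _ ≤ _ := Finset.single_le_sum (f := fun a => lam K a x * fderiv ℝ v x (a - x) ^ 2)
      (fun b hb => mul_nonneg (hc0.trans (hlow b hb)) (sq_nonneg _)) ha

end

theorem norm_clm_sq (f : E d →L[ℝ] ℝ) : ‖f‖ ^ 2 = ∑ i, f (EuclideanSpace.single i 1) ^ 2 := by
  have h1 : ‖(InnerProductSpace.toDual ℝ (E d)).symm f‖ = ‖f‖ := by simp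
  rw [← h1, EuclideanSpace.norm_sq_eq]
  refine Finset.sum_congr rfl fun i _ => ?_
  have h2 : f (EuclideanSpace.single i 1) =
      inner ℝ ((InnerProductSpace.toDual ℝ (E d)).symm f) (EuclideanSpace.single i 1) := by
    rw [InnerProductSpace.toDual_symm_apply]
  rw [h2, EuclideanSpace.inner_single_right]
  simp

theorem continuous_norm_fderiv_sq {k : ℕ} {v : E d → ℝ} (hv : v ∈ polySpace d k) :
    Continuous fun x => ‖fderiv ℝ v x‖ ^ 2 :=
  ((contDiff_of_mem_polySpace (n := 1) hv).continuous_fderiv (by simp)).norm.pow 2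

/-- The `L²` norm of a polynomial gradient on an element is controlled by a small ball. -/
theorem exists_grad_ball (d k : ℕ) {r : ℝ} (R : ℝ) (hr : 0 < r) :
    ∃ C, 0 < C ∧ ∀ (K : Finset (E d)) (h : ℝ), HasShape r R h K → ∀ v ∈ polySpace d k, ∀ z,
      Metric.ball z (r * h) ⊆ convexHull ℝ (K : Set (E d)) →
      intElem K (fun x => ‖fderiv ℝ v x‖ ^ 2) ≤
        C * ∫ x in Metric.ball z (r / 2 * h), ‖fderiv ℝ v x‖ ^ 2 := by
  -- The inverse inequality is applied to each component of the gradient, a polynomial of degree `k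
  -- - 1`.
  obtain ⟨C, hC, H⟩ := exists_inverse_ball d (k - 1) R (half_pos hr)
  refine ⟨|R| ^ d * ballVol d * C + 1, by
    have := ballVol_nonneg d; positivity, fun K h hK v hv z hz => ?_⟩
  have hh := hK.h_pos
  have hv' := fun i => fderiv_apply_mem_polySpace hv (EuclideanSpace.single (𝕜 := ℝ) i (1 : ℝ))
  set J := ∫ x in Metric.ball z (r / 2 * h), ‖fderiv ℝ v x‖ ^ 2 with hJ
  have hJ0 : 0 ≤ J := integral_nonneg fun x => sq_nonneg _
  have hJs : ∑ i, ∫ x in Metric.ball z (r / 2 * h),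
      fderiv ℝ v x (EuclideanSpace.single i 1) ^ 2 = J := by
    rw [hJ]
    simp only [norm_clm_sq]
    exact (integral_finsetSum _ fun i _ => integrableOn_of_continuous
      ((continuous_of_mem_polySpace (hv' i)).pow 2) Metric.isBounded_ball).symm
  have h1 : ∀ x ∈ convexHull ℝ (K : Set (E d)), |‖fderiv ℝ v x‖ ^ 2| ≤ C * ((h ^ d)⁻¹ * J) := by
    intro x hx
    rw [abs_of_nonneg (sq_nonneg _), norm_clm_sq, ← hJs, Finset.mul_sum, Finset.mul_sum]
    refine Finset.sum_le_sum fun i _ => ?_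
    exact (H _ (hv' i) h hh z x (hK.diam x hx z (hz (Metric.mem_ball_self (by positivity))))).1
  refine (hK.intElem_le (by positivity) h1).trans ?_
  rw [abs_of_nonneg hK.R_nonneg]
  have h2 : h ^ d * (C * ((h ^ d)⁻¹ * J)) = C * J := by field_simp
  rw [h2]
  nlinarith

/-- The barycentric coordinates degenerate at the boundary, so the pointwise bound
`HasShape.bubble_ge` is used only on the ball of half radius. Norm equivalence replaces that ball by
`K`, and the integrand is nonnegative on the rest. -/
theorem exists_bubble_coercive (d k : ℕ) {r : ℝ} (R : ℝ) (hr : 0 < r) (hR : 0 ≤ R) :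
    ∃ c, 0 < c ∧ ∀ (K : Finset (E d)) (h : ℝ), HasShape r R h K → ∀ v ∈ polySpace d k,
      c * (h ^ 2 * intElem K fun x => ‖fderiv ℝ v x‖ ^ 2) ≤
        intElem K fun x => fderiv ℝ v x (bubbleField K v x) := by
  obtain ⟨C, hC, H⟩ := exists_grad_ball d k R hr
  set κ := r / (4 * (R + 1)) / (1 + r / (4 * (R + 1))) * (r / 4) ^ 2 with hκ
  have hκ0 : 0 < κ := by positivity
  refine ⟨κ / C, by positivity, fun K h hK v hv => ?_⟩
  have hh := hK.h_pos
  obtain ⟨z, hz⟩ := hK.ball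
  have hcont : Continuous fun x => fderiv ℝ v x (bubbleField K v x) := by
    have h1 := continuous_of_mem_vecPoly (gradSpace_le Pair.BDM k (bubbleField_mem K Pair.BDM hv))
    exact ((contDiff_of_mem_polySpace (n := 1) hv).continuous_fderiv (by simp)).clm_apply h1
  have hsub : Metric.ball z (r / 2 * h) ⊆ convexHull ℝ (K : Set (E d)) :=
    (Metric.ball_subset_ball (by nlinarith)).trans hz
  calc κ / C * (h ^ 2 * intElem K fun x => ‖fderiv ℝ v x‖ ^ 2)
      ≤ κ / C * (h ^ 2 * (C * ∫ x in Metric.ball z (r / 2 * h), ‖fderiv ℝ v x‖ ^ 2)) := by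
        gcongr
        exact H K h hK v hv z hz
    _ = ∫ x in Metric.ball z (r / 2 * h), κ * (h ^ 2 * ‖fderiv ℝ v x‖ ^ 2) := by
        rw [integral_const_mul, integral_const_mul]
        field_simp
    _ ≤ ∫ x in Metric.ball z (r / 2 * h), fderiv ℝ v x (bubbleField K v x) := by
        refine setIntegral_mono_on ?_ ?_ measurableSet_ball fun x hx => hK.bubble_ge hz hx v
        · exact integrableOn_of_continuous
            (((continuous_norm_fderiv_sq hv).const_mul _).const_mul _) Metric.isBounded_ball
        · exact integrableOn_of_continuous hcont Metric.isBounded_ball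
    _ ≤ _ := by
        refine setIntegral_mono_set (hK.simplex.integrableOn_elem hcont) ?_ hsub.eventuallyLE
        refine (ae_restrict_iff' hK.simplex.isCompact.measurableSet).2
          (Filter.Eventually.of_forall fun x hx => ?_)
        change 0 ≤ fderiv ℝ v x (bubbleField K v x)
        rw [hK.simplex.fderiv_bubbleField]
        exact Finset.sum_nonneg fun a ha =>
          mul_nonneg (hK.simplex.mem_convexHull_iff.1 hx a ha) (sq_nonneg _)

end WG

namespace WG

variable {d : ℕ}

/-! ### Lifting of normal traces -/

/-- Extension of a polynomial from a face, constant along the normal direction. -/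
theorem exists_normal_extension (d k : ℕ) (hd : 1 ≤ d) [DecidableEq (E d)] {r : ℝ} (R ρ : ℝ)
    (hr : 0 < r) :
    ∃ C, 0 < C ∧ ∀ (K : Finset (E d)) (h : ℝ), HasShape r R h K → ∀ a ∈ K,
      ∀ μ ∈ polySpace d k, ∃ p ∈ polySpace d k, (∀ x, lam K a x = 0 → p x = μ x) ∧
        ∀ x, ∀ b ∈ convexHull ℝ ((K.erase a : Finset (E d)) : Set (E d)), ‖x - b‖ ≤ ρ * h →
          p x ^ 2 ≤ C * ((h ^ (d - 1))⁻¹ * intFace (K.erase a) fun y => μ y ^ 2) := by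
  -- The projection onto the hyperplane moves `x` by at most its distance to `b`, which doubles the
  -- radius.
  obtain ⟨C, hC, H⟩ := exists_face_inverse d k hd R (2 * ρ) hr
  refine ⟨C, hC, fun K h hK a ha μ hμ => ?_⟩
  have hs := hK.simplex
  have hH := hs.height_pos hd ha
  have hn := hs.norm_outwardNormal hd ha
  set n := outwardNormal K (K.erase a) with hndef
  -- The orthogonal projection onto the hyperplane of the face: `height K a * λ_a` is the signed
  -- distance to it.
  let π : E d →ᵃ[ℝ] E d := (LinearMap.toSpanSingleton ℝ (E d) (height K a • n)).toAffineMap.comp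
    (lam K a) + AffineMap.id ℝ (E d)
  have hπ : ∀ x, π x = lam K a x • height K a • n + x := fun x => by simp [π]
  have hπ0 : ∀ x, lam K a (π x) = 0 := by
    intro x
    have h1 := hs.inner_outwardNormal hd ha (π x) x
    rw [hπ, add_sub_cancel_right, inner_smul_left, inner_smul_left, ← hndef,
      real_inner_self_eq_norm_sq, hn, ← hπ] at h1
    simp only [conj_trivial, one_pow, mul_one] at h1
    have h2 : height K a * lam K a (π x) = 0 := by linarith
    exact (mul_eq_zero.1 h2).resolve_left hH.ne'
  refine ⟨fun x => μ (π x), comp_mem_polySpace hμ π, fun x hx => ?_, fun x b hb hxb => ?_⟩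
  · simp only
    rw [hπ, hx, zero_smul, zero_add]
  · refine H K h hK a ha μ hμ (π x) (hπ0 x) b hb ?_
    have hb0 := ((hs.mem_face_erase_iff ha).1 hb).2
    have h1 : ‖lam K a x • height K a • n‖ ≤ ‖x - b‖ := by
      have h2 := hs.inner_outwardNormal hd ha x b
      rw [hb0, zero_sub, ← hndef] at h2
      have h3 := abs_real_inner_le_norm (x - b) n
      rw [h2, hn, mul_one, abs_mul, abs_neg, abs_of_pos hH] at h3
      rw [norm_smul, norm_smul, hn, mul_one, Real.norm_eq_abs, Real.norm_of_nonneg hH.le, mul_comm]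
      exact h3
    calc ‖π x - b‖ = ‖lam K a x • height K a • n + (x - b)‖ := by rw [hπ]; congr 1; abel
      _ ≤ ‖x - b‖ + ‖x - b‖ := (norm_add_le _ _).trans (by gcongr)
      _ ≤ 2 * ρ * h := by linarith

/-- Lifting of a polynomial normal trace on one face into the space of weak gradients. -/
theorem exists_lifting (d j : ℕ) (pr : Pair) (hd : 1 ≤ d) [DecidableEq (E d)] {r : ℝ} (R : ℝ)
    (hr : 0 < r) (hR : 0 ≤ R) :
    ∃ C, 0 < C ∧ ∀ (K : Finset (E d)) (h : ℝ), HasShape r R h K → ∀ a ∈ K,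
      ∀ μ ∈ polySpace d (pr.faceDeg j), ∃ q ∈ pr.gradSpace d j,
        (∀ c ∈ K, ∀ x ∈ convexHull ℝ ((K.erase c : Finset (E d)) : Set (E d)),
          inner ℝ (q x) (outwardNormal K (K.erase c)) = if c = a then μ x else 0) ∧
        intElem K (fun x => ‖q x‖ ^ 2) ≤ C * (h * intFace (K.erase a) fun y => μ y ^ 2) := by
  -- The radius `(R + 1) h` covers both `K` and the ball of radius `h` around a vertex on which
  -- `exists_bounded_decomposition` asks for a bound.
  obtain ⟨C, hC, H⟩ := exists_normal_extension d (pr.faceDeg j) hd R (R + 1) hr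
  have main : ∃ C', 0 < C' ∧ ∀ (K : Finset (E d)) (h : ℝ), HasShape r R h K → ∀ a ∈ K,
      ∀ μ ∈ polySpace d (pr.faceDeg j), ∃ q ∈ pr.gradSpace d j,
        (∀ c ∈ K, ∀ x ∈ convexHull ℝ ((K.erase c : Finset (E d)) : Set (E d)),
          inner ℝ (q x) (outwardNormal K (K.erase c)) = if c = a then μ x else 0) ∧
        ∀ x ∈ convexHull ℝ (K : Set (E d)), ‖q x‖ ^ 2 ≤
          C' * (C * ((h ^ (d - 1))⁻¹ * intFace (K.erase a) fun y => μ y ^ 2)) := by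
    cases pr with
    | RT =>
      refine ⟨(2 * R / r) ^ 2 + 1, by positivity, fun K h hK a ha μ hμ => ?_⟩
      have hh := hK.h_pos
      have hs := hK.simplex
      have hH := hs.height_pos hd ha
      obtain ⟨p, hp, hpμ, hpb⟩ := H K h hK a ha μ hμ
      obtain ⟨b, hb, hba⟩ := hs.exists_ne hd ha
      -- All faces other than the one opposite `a` contain `a`, so `x - a` is tangential on them; on
      -- the opposite face its normal component is the constant `height K a`.
      refine ⟨fun x => ((height K a)⁻¹ * p x) • (x - a),
        smul_sub_mem_gradSpace Pair.RT (smul_fun_mem_polySpace _ hp) a,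
        fun c hc x hx => ?_, fun x hx => ?_⟩
      · have hx' := (hs.mem_face_erase_iff hc).1 hx
        rw [real_inner_smul_left, hs.inner_outwardNormal hd hc, hx'.2]
        by_cases hca : c = a
        · subst hca
          rw [if_pos rfl, hs.lam_self ha, hpμ x hx'.2]
          field_simp
          ring
        · rw [if_neg hca, hs.lam_of_ne hc ha hca]
          ring
      · have h1 := hpb x b (vertex_mem (Finset.mem_erase.2 ⟨hba, hb⟩))
          ((hK.diam x hx b (vertex_mem hb)).trans (by nlinarith))
        have h2 := hK.diam x hx a (vertex_mem ha)
        have h3 := hK.height_ge hd ha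
        have h4 : (height K a)⁻¹ * ‖x - a‖ ≤ 2 * R / r := by
          rw [inv_mul_le_iff₀ hH]
          calc ‖x - a‖ ≤ R * h := h2
            _ = (r / 2 * h) * (2 * R / r) := by field_simp
            _ ≤ height K a * (2 * R / r) := by gcongr
        rw [norm_smul, norm_mul, norm_inv, Real.norm_of_nonneg hH.le, Real.norm_eq_abs]
        calc ((height K a)⁻¹ * |p x| * ‖x - a‖) ^ 2
            = ((height K a)⁻¹ * ‖x - a‖) ^ 2 * p x ^ 2 := by rw [mul_right_comm, mul_pow, sq_abs]
          _ ≤ (2 * R / r) ^ 2 * p x ^ 2 := by gcongr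
          _ ≤ ((2 * R / r) ^ 2 + 1) * p x ^ 2 := by nlinarith [sq_nonneg (p x)]
          _ ≤ _ := by gcongr
    | BDM =>
      obtain ⟨C₂, hC₂, H₂⟩ := exists_bounded_decomposition d j R
      refine ⟨(2 * R / r * (1 + d * (R * C₂))) ^ 2 + 1, by positivity, fun K h hK a ha μ hμ => ?_⟩
      have hh := hK.h_pos
      have hs := hK.simplex
      have hH := hs.height_pos hd ha
      obtain ⟨p, hp, hpμ, hpb⟩ := H K h hK a ha μ hμ
      obtain ⟨b, hb, hba⟩ := hs.exists_ne hd ha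
      have hbf : b ∈ convexHull ℝ ((K.erase a : Finset (E d)) : Set (E d)) :=
        vertex_mem (Finset.mem_erase.2 ⟨hba, hb⟩)
      obtain ⟨t, ht, hdec, hbound⟩ := H₂ p hp h hh b
      set Q := C * ((h ^ (d - 1))⁻¹ * intFace (K.erase a) fun y => μ y ^ 2) with hQ
      have hpabs : ∀ x, ‖x - b‖ ≤ (R + 1) * h → |p x| ≤ Real.sqrt Q := fun x hx =>
        Real.abs_le_sqrt (hpb x b hbf hx)
      have hQ0 : 0 ≤ Q := (sq_nonneg _).trans (hpb b b hbf (by simp; positivity))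
      have htb := hbound (Real.sqrt Q) fun x hx => hpabs x (by
        rw [Metric.mem_closedBall, dist_eq_norm] at hx
        nlinarith)
      -- Multiplying `p`, of degree `j + 1`, by `x - a` would exceed the degree of the BDM space.
      -- Instead `p` is written on the face as `∑ λ_k s_k` with `s_k` of degree `j`: the numbers `(k
      -- - b)_i` are the vertex values of the linear function `(x - b)_i` in the decomposition of
      -- `p`.
      let s : E d → E d → ℝ := fun k x => p b + ∑ i, ((k - b) i / h) * t i x
      have hsmem : ∀ k, s k ∈ polySpace d j := fun k =>
        add_fun_mem_polySpace (const_mem_polySpace d j _)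
          (sum_fun_mem_polySpace _ fun i _ => smul_fun_mem_polySpace _ (ht i))
      have hface : ∀ x, lam K a x = 0 → ∑ k ∈ K.erase a, lam K k x * s k x = p x := by
        intro x hx
        have h1 : ∑ k ∈ K.erase a, lam K k x * s k x = ∑ k ∈ K, lam K k x * s k x := by
          rw [← Finset.add_sum_erase _ _ ha, hx, zero_mul, zero_add]
        have h2 : ∀ i, (x - b) i = ∑ k ∈ K, lam K k x * (k - b) i := by
          intro i
          have h3 : x - b = ∑ k ∈ K, lam K k x • (k - b) := by
            simp only [smul_sub, Finset.sum_sub_distrib, ← Finset.sum_smul]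
            rw [hs.sum_lam_smul, hs.sum_lam, one_smul]
          rw [h3]
          simp
        rw [h1, hdec x]
        simp only [s, mul_add, Finset.sum_add_distrib, ← Finset.sum_mul, hs.sum_lam, one_mul, h2]
        congr 1
        simp only [Finset.mul_sum, Finset.sum_div, Finset.sum_mul]
        rw [Finset.sum_comm]
        refine Finset.sum_congr rfl fun i _ => Finset.sum_congr rfl fun k _ => ?_
        ring
      -- The constant vector `k - a` is tangential to every face containing both `a` and `k`. On the
      -- face opposite `k` the factor `λ_k` vanishes, and on the one opposite `a` the normal
      -- component of `k - a` is `height K a`.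
      refine ⟨∑ k ∈ K.erase a, fun x => ((height K a)⁻¹ * (lam K k x * s k x)) • (k - a), ?_,
        fun c hc x hx => ?_, fun x hx => ?_⟩
      · refine Submodule.sum_mem _ fun k _ => smul_const_mem_vecPoly ?_ _
        refine smul_fun_mem_polySpace _ (polySpace_mono (by omega)
          (mul_mem_polySpace (lam_mem_polySpace K k) (hsmem k)))
      · have hx' := (hs.mem_face_erase_iff hc).1 hx
        rw [Finset.sum_apply, sum_inner]
        simp only [real_inner_smul_left, hs.inner_outwardNormal hd hc]
        by_cases hca : c = a
        · subst hca
          rw [if_pos rfl, ← hpμ x hx'.2, ← hface x hx'.2]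
          refine Finset.sum_congr rfl fun k hk => ?_
          rw [hs.lam_self ha, hs.lam_of_ne ha (Finset.mem_of_mem_erase hk)
            (Finset.ne_of_mem_erase hk).symm]
          field_simp
          ring
        · rw [if_neg hca]
          refine Finset.sum_eq_zero fun k hk => ?_
          rw [hs.lam_of_ne hc ha hca]
          by_cases hck : c = k
          · rw [← hck, hx'.2]; ring
          · rw [hs.lam_of_ne hc (Finset.mem_of_mem_erase hk) hck]; ring
      · have hlam := hs.mem_convexHull_iff.1 hx
        have hxb := hK.diam x hx b (vertex_mem hb)
        have hsb : ∀ k ∈ K, |s k x| ≤ (1 + d * (R * C₂)) * Real.sqrt Q := by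
          intro k hk
          have hkb := hK.diam k (vertex_mem hk) b (vertex_mem hb)
          have h1 : ∀ i, |(k - b) i / h * t i x| ≤ R * (C₂ * Real.sqrt Q) := by
            intro i
            rw [abs_mul, abs_div, abs_of_pos hh]
            have h2 : |(k - b) i| ≤ R * h := (PiLp.norm_apply_le (k - b) i).trans hkb
            have h3 : |(k - b) i| / h ≤ R := by rwa [div_le_iff₀ hh]
            exact mul_le_mul h3 (htb i x hxb) (abs_nonneg _) hR
          calc |s k x| ≤ |p b| + |∑ i, (k - b) i / h * t i x| := abs_add_le _ _
            _ ≤ Real.sqrt Q + ∑ _i : Fin d, R * (C₂ * Real.sqrt Q) := by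
              refine add_le_add (hpabs b (by simp; positivity)) ?_
              exact (Finset.abs_sum_le_sum_abs _ _).trans (Finset.sum_le_sum fun i _ => h1 i)
            _ = _ := by
              rw [Finset.sum_const, Finset.card_univ, Fintype.card_fin, nsmul_eq_mul]
              ring
        have h4 : (height K a)⁻¹ * (R * h) ≤ 2 * R / r := by
          rw [inv_mul_le_iff₀ hH]
          calc R * h = (r / 2 * h) * (2 * R / r) := by field_simp
            _ ≤ height K a * (2 * R / r) := by
              have := hK.height_ge hd ha
              gcongr
        have h5 : ‖(∑ k ∈ K.erase a, fun x => ((height K a)⁻¹ * (lam K k x * s k x)) • (k - a)) x‖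
            ≤ 2 * R / r * (1 + d * (R * C₂)) * Real.sqrt Q := by
          rw [Finset.sum_apply]
          refine (norm_sum_le _ _).trans ?_
          have h6 : ∀ k ∈ K.erase a, ‖((height K a)⁻¹ * (lam K k x * s k x)) • (k - a)‖ ≤
              lam K k x * (2 * R / r * (1 + d * (R * C₂)) * Real.sqrt Q) := by
            intro k hk
            have hkK := Finset.mem_of_mem_erase hk
            rw [norm_smul, norm_mul, norm_mul, norm_inv, Real.norm_of_nonneg hH.le,
              Real.norm_of_nonneg (hlam k hkK), Real.norm_eq_abs]
            calc (height K a)⁻¹ * (lam K k x * |s k x|) * ‖k - a‖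
                = lam K k x * (((height K a)⁻¹ * ‖k - a‖) * |s k x|) := by ring
              _ ≤ lam K k x * ((2 * R / r) * ((1 + d * (R * C₂)) * Real.sqrt Q)) := by
                refine mul_le_mul_of_nonneg_left ?_ (hlam k hkK)
                refine mul_le_mul (le_trans ?_ h4) (hsb k hkK) (abs_nonneg _) (by positivity)
                have := hK.diam k (vertex_mem hkK) a (vertex_mem ha)
                gcongr
              _ = _ := by ring
          refine (Finset.sum_le_sum h6).trans ?_
          rw [← Finset.sum_mul]
          refine mul_le_of_le_one_left (by positivity) ?_
          rw [← hs.sum_lam x]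
          exact Finset.sum_le_sum_of_subset_of_nonneg (Finset.erase_subset a K)
            fun k hk _ => hlam k hk
        calc _ ≤ (2 * R / r * (1 + d * (R * C₂)) * Real.sqrt Q) ^ 2 := by gcongr
          _ = (2 * R / r * (1 + d * (R * C₂))) ^ 2 * Q := by rw [mul_pow, Real.sq_sqrt hQ0]
          _ ≤ _ := by nlinarith
  obtain ⟨C', hC', H'⟩ := main
  refine ⟨R ^ d * ballVol d * (C' * C) + 1, by
    have := ballVol_nonneg d; positivity, fun K h hK a ha μ hμ => ?_⟩
  obtain ⟨q, hq, hn, hb⟩ := H' K h hK a ha μ hμ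
  refine ⟨q, hq, hn, ?_⟩
  have hh := hK.h_pos
  set Y := intFace (K.erase a) fun y => μ y ^ 2 with hY
  have hY0 : 0 ≤ Y := integral_nonneg fun x => sq_nonneg _
  refine (hK.intElem_le (f := fun x => ‖q x‖ ^ 2)
    (M := C' * (C * ((h ^ (d - 1))⁻¹ * Y))) (by positivity) fun x hx => by
    rw [abs_of_nonneg (sq_nonneg _)]; exact hb x hx).trans ?_
  have h2 : h ^ d * (C' * (C * ((h ^ (d - 1))⁻¹ * Y))) = C' * C * (h * Y) := by
    have : h ^ d = h ^ (d - 1) * h := by rw [← pow_succ]; congr 1; omega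
    rw [this]
    field_simp
  rw [h2]
  have : 0 ≤ h * Y := by positivity
  nlinarith

end WG

namespace WG

variable {d : ℕ}

/-! ### Local estimates for the weak gradient -/

/-- The weak gradient on a single simplex, the boundary function being given by a polynomial
for each vertex (used on the opposite face). -/
def IsLocalWeakGrad [DecidableEq (E d)] (pr : Pair) (j : ℕ) (K : Finset (E d)) (v : E d → ℝ)
    (b : E d → E d → ℝ) (g : E d → E d) : Prop :=
  g ∈ pr.gradSpace d j ∧ ∀ q ∈ pr.gradSpace d j,
    intElem K (fun x => inner ℝ (g x) (q x)) = -intElem K (fun x => v x * divergence q x) +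
      ∑ a ∈ K, intFace (K.erase a) fun x => b a x * inner ℝ (q x) (outwardNormal K (K.erase a))

theorem continuous_of_mem_gradSpace {pr : Pair} {j : ℕ} {q : E d → E d}
    (hq : q ∈ pr.gradSpace d j) : Continuous q :=
  continuous_of_mem_vecPoly (gradSpace_le pr j hq)

/-- After integration by parts the face terms involve only the jump `b - v`, so a test field sees
either the gradient or selected jumps. -/
theorem IsLocalWeakGrad.identity [DecidableEq (E d)] {pr : Pair} {j : ℕ} {K : Finset (E d)}
    {v : E d → ℝ} {b : E d → E d → ℝ} {g : E d → E d} (hg : IsLocalWeakGrad pr j K v b g)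
    (hs : IsSimplex K) (hd : 1 ≤ d) (hv : v ∈ polySpace d j)
    (hb : ∀ a ∈ K, b a ∈ polySpace d (pr.faceDeg j)) {q : E d → E d}
    (hq : q ∈ pr.gradSpace d j) :
    intElem K (fun x => inner ℝ (g x) (q x)) = intElem K (fun x => fderiv ℝ v x (q x)) +
      ∑ a ∈ K, intFace (K.erase a) fun x =>
        (b a x - v x) * inner ℝ (q x) (outwardNormal K (K.erase a)) := by
  rw [hg.2 q hq, hs.integration_by_parts hd hv (gradSpace_le pr j hq), add_assoc,
    ← Finset.sum_add_distrib]
  congr 1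
  refine Finset.sum_congr rfl fun a ha => ?_
  have hc := continuous_of_mem_gradSpace hq
  have hvc := continuous_of_mem_polySpace hv
  have hbc := continuous_of_mem_polySpace (hb a ha)
  unfold intFace
  rw [← integral_add (hs.integrableOn_face hd ha (by fun_prop))
    (hs.integrableOn_face hd ha (by fun_prop))]
  congr 1
  funext x
  ring

theorem inner_le_young (x y : E d) {s : ℝ} (hs : 0 < s) :
    inner ℝ x y ≤ s * ‖x‖ ^ 2 + s⁻¹ * ‖y‖ ^ 2 := by
  have h1 := real_inner_le_norm x y
  have h2 : s * ‖x‖ ^ 2 + s⁻¹ * ‖y‖ ^ 2 - 2 * (‖x‖ * ‖y‖) = s⁻¹ * (s * ‖x‖ - ‖y‖) ^ 2 := by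
    field_simp
    ring
  have h3 : 0 ≤ s⁻¹ * (s * ‖x‖ - ‖y‖) ^ 2 := by positivity
  have h4 : 0 ≤ ‖x‖ * ‖y‖ := by positivity
  linarith

theorem intElem_nonneg {K : Finset (E d)} {f : E d → ℝ} (hf : ∀ x, 0 ≤ f x) : 0 ≤ intElem K f :=
  integral_nonneg hf

theorem intFace_nonneg {e : Finset (E d)} {f : E d → ℝ} (hf : ∀ x, 0 ≤ f x) : 0 ≤ intFace e f :=
  integral_nonneg hf

theorem IsSimplex.intElem_inner_le {K : Finset (E d)} (hK : IsSimplex K) {g q : E d → E d}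
    (hg : Continuous g) (hq : Continuous q) {s : ℝ} (hs : 0 < s) :
    intElem K (fun x => inner ℝ (g x) (q x)) ≤
      s * intElem K (fun x => ‖g x‖ ^ 2) + s⁻¹ * intElem K fun x => ‖q x‖ ^ 2 := by
  unfold intElem
  rw [← integral_const_mul, ← integral_const_mul,
    ← integral_add (hK.integrableOn_elem (by fun_prop)) (hK.integrableOn_elem (by fun_prop))]
  exact integral_mono (hK.integrableOn_elem (by fun_prop)) (hK.integrableOn_elem (by fun_prop))
    fun x => inner_le_young _ _ hs

theorem continuous_gradient {k : ℕ} {v : E d → ℝ} (hv : v ∈ polySpace d k) :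
    Continuous (gradient v) :=
  (InnerProductSpace.toDual ℝ (E d)).symm.continuous.comp
    ((contDiff_of_mem_polySpace (n := 1) hv).continuous_fderiv one_ne_zero)

theorem norm_gradient (v : E d → ℝ) (x : E d) : ‖gradient v x‖ = ‖fderiv ℝ v x‖ := by
  simp [gradient]

theorem inner_gradient (v : E d → ℝ) (x u : E d) : inner ℝ (gradient v x) u = fderiv ℝ v x u := by
  simp [gradient]

/-- The weak gradient controls the broken gradient and the jumps. -/
theorem exists_local_coercive (d j : ℕ) (pr : Pair) (hd : 1 ≤ d) [DecidableEq (E d)] {r : ℝ}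
    (R : ℝ) (hr : 0 < r) (hR : 0 ≤ R) :
    ∃ C, 0 < C ∧ ∀ (K : Finset (E d)) (h : ℝ), HasShape r R h K → ∀ v ∈ polySpace d j,
      ∀ b : E d → E d → ℝ, (∀ a ∈ K, b a ∈ polySpace d (pr.faceDeg j)) →
      ∀ g, IsLocalWeakGrad pr j K v b g →
        intElem K (fun x => ‖gradient v x‖ ^ 2) +
          h⁻¹ * ∑ a ∈ K, intFace (K.erase a) (fun x => (v x - b a x) ^ 2) ≤
        C * intElem K fun x => ‖g x‖ ^ 2 := by
  obtain ⟨c, hc, H⟩ := exists_bubble_coercive d j R hr hR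
  obtain ⟨C₂, hC₂, H₂⟩ := exists_lifting d j pr hd R hr hR
  refine ⟨4 * (R ^ 4 + 1) / c ^ 2 + (d + 1) * (8 * C₂ * (1 + 4 * (R ^ 4 + 1) / c ^ 2)),
    by positivity, fun K h hK v hv b hb g hg => ?_⟩
  have hh := hK.h_pos
  have hs := hK.simplex
  have hgc := continuous_of_mem_gradSpace hg.1
  set N := intElem K fun x => ‖g x‖ ^ 2
  set G := intElem K (fun x => ‖gradient v x‖ ^ 2) with hG
  have hN0 : 0 ≤ N := intElem_nonneg fun x => sq_nonneg _
  have hG0 : 0 ≤ G := intElem_nonneg fun x => sq_nonneg _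
  -- Test with the bubble field: all face terms disappear.
  have hGN : G ≤ 4 * (R ^ 4 + 1) / c ^ 2 * N := by
    have hq := bubbleField_mem K pr hv
    have h1 := H K h hK v hv
    have h2 := hg.identity hs hd hv hb hq
    have h3 : ∑ a ∈ K, intFace (K.erase a) (fun x =>
        (b a x - v x) * inner ℝ (bubbleField K v x) (outwardNormal K (K.erase a))) = 0 := by
      refine Finset.sum_eq_zero fun a ha => ?_
      refine setIntegral_eq_zero_of_forall_eq_zero fun x hx => ?_
      rw [hs.inner_bubbleField hd v ha ((hs.mem_face_erase_iff ha).1 hx).2, mul_zero]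
    rw [h3, add_zero] at h2
    have hqc := continuous_of_mem_gradSpace hq
    -- Since `‖q‖² ≤ (R h)⁴ G`, this Young parameter leaves at most half of the coercive term `c h²
    -- G` on the right. Using `R ^ 4 + 1` keeps it positive when `R = 0`.
    have hsp : 0 < 2 * (R ^ 4 + 1) * h ^ 2 / c := by positivity
    have h4 := hs.intElem_inner_le hgc hqc hsp
    have h5 : intElem K (fun x => ‖bubbleField K v x‖ ^ 2) ≤ (R * h) ^ 4 * G := by
      unfold intElem at hG ⊢
      rw [hG, ← integral_const_mul]
      refine setIntegral_mono_on (hs.integrableOn_elem (by fun_prop))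
        (hs.integrableOn_elem ?_) (isClosed_face K).measurableSet fun x hx => ?_
      · have := continuous_gradient hv
        fun_prop
      · rw [norm_gradient]
        calc ‖bubbleField K v x‖ ^ 2 ≤ ((R * h) ^ 2 * ‖fderiv ℝ v x‖) ^ 2 := by
              have := hK.norm_bubbleField_le v hx
              gcongr
          _ = _ := by ring
    simp only [← norm_gradient] at h1
    rw [← hG, ← h2] at h1
    have h6 : (2 * (R ^ 4 + 1) * h ^ 2 / c)⁻¹ * intElem K (fun x => ‖bubbleField K v x‖ ^ 2) ≤
        c / 2 * (h ^ 2 * G) := by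
      calc _ ≤ (2 * (R ^ 4 + 1) * h ^ 2 / c)⁻¹ * ((R * h) ^ 4 * G) := by gcongr
        _ = (R ^ 4 / (R ^ 4 + 1)) * (c / 2 * (h ^ 2 * G)) := by field_simp
        _ ≤ 1 * (c / 2 * (h ^ 2 * G)) := by
          gcongr
          rw [div_le_one (by positivity)]
          linarith
        _ = _ := one_mul _
    have h7 : c / 2 * (h ^ 2 * G) ≤ 2 * (R ^ 4 + 1) * h ^ 2 / c * N := by linarith
    have h8 : G = (c / 2 * (h ^ 2 * G)) * (2 / (c * h ^ 2)) := by field_simp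
    rw [h8]
    calc _ ≤ (2 * (R ^ 4 + 1) * h ^ 2 / c * N) * (2 / (c * h ^ 2)) := by gcongr
      _ = _ := by field_simp; ring
  have hY : ∀ a ∈ K, h⁻¹ * intFace (K.erase a) (fun x => (v x - b a x) ^ 2) ≤
      8 * C₂ * (1 + 4 * (R ^ 4 + 1) / c ^ 2) * N := by
    intro a ha
    have hvl : v ∈ polySpace d (pr.faceDeg j) := polySpace_mono (by cases pr <;> simp [Pair.faceDeg]) hv
    -- Test with the lifting of the jump on one face: the face terms reduce to the squared jump `Y`
    -- on that face.
    obtain ⟨q, hq, hqn, hqb⟩ := H₂ K h hK a ha _ (sub_fun_mem_polySpace (hb a ha) hvl)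
    set Y := intFace (K.erase a) (fun x => (v x - b a x) ^ 2) with hYdef
    have hY0 : 0 ≤ Y := intFace_nonneg fun x => sq_nonneg _
    have hYe : (intFace (K.erase a) fun y => (b a y - v y) ^ 2) = Y := by
      rw [hYdef]; congr 1; funext x; ring
    rw [hYe] at hqb
    have hqc := continuous_of_mem_gradSpace hq
    have h2 := hg.identity hs hd hv hb hq
    have h3 : ∑ c ∈ K, intFace (K.erase c) (fun x =>
        (b c x - v x) * inner ℝ (q x) (outwardNormal K (K.erase c))) = Y := by
      rw [Finset.sum_eq_single a]
      · rw [← hYe]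
        refine setIntegral_congr_fun (isClosed_face _).measurableSet fun x hx => ?_
        simp only [hqn a ha x hx, if_true]
        ring
      · intro c hcK hca
        refine setIntegral_eq_zero_of_forall_eq_zero fun x hx => ?_
        rw [hqn c hcK x hx, if_neg hca, mul_zero]
      · exact fun h => absurd ha h
    rw [h3] at h2
    -- The lifting satisfies `‖q‖² ≤ C₂ h Y`, so each of the two Young inequalities costs at most
    -- `Y/4`.
    have hsp : 0 < 4 * C₂ * h := by positivity
    have h4 := hs.intElem_inner_le hgc hqc hsp
    have hvc := continuous_gradient hv
    have h5 := hs.intElem_inner_le hvc.neg hqc hsp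
    have h6 : intElem K (fun x => inner ℝ ((-gradient v) x) (q x)) =
        -intElem K fun x => fderiv ℝ v x (q x) := by
      unfold intElem
      rw [← integral_neg]
      simp only [Pi.neg_apply, inner_neg_left, inner_gradient]
    rw [h6] at h5
    simp only [Pi.neg_apply, norm_neg] at h5
    have h7 : (4 * C₂ * h)⁻¹ * intElem K (fun x => ‖q x‖ ^ 2) ≤ Y / 4 := by
      calc _ ≤ (4 * C₂ * h)⁻¹ * (C₂ * (h * Y)) := by gcongr
        _ = _ := by field_simp
    have h8 : Y ≤ 8 * C₂ * h * (N + G) := by linarith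
    rw [inv_mul_le_iff₀ hh]
    calc Y ≤ 8 * C₂ * h * (N + G) := h8
      _ ≤ 8 * C₂ * h * (N + 4 * (R ^ 4 + 1) / c ^ 2 * N) := by gcongr
      _ = _ := by ring
  rw [Finset.mul_sum]
  have h9 := Finset.sum_le_sum hY
  rw [Finset.sum_const, hs.card_eq, nsmul_eq_mul] at h9
  push_cast at h9
  linarith

/-- The weak gradient is controlled by the broken gradient and the jumps. -/
theorem exists_local_bounded (d j : ℕ) (pr : Pair) (hd : 1 ≤ d) [DecidableEq (E d)] {r : ℝ}
    (R : ℝ) (hr : 0 < r) :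
    ∃ C, 0 < C ∧ ∀ (K : Finset (E d)) (h : ℝ), HasShape r R h K → ∀ v ∈ polySpace d j,
      ∀ b : E d → E d → ℝ, (∀ a ∈ K, b a ∈ polySpace d (pr.faceDeg j)) →
      ∀ g, IsLocalWeakGrad pr j K v b g →
        intElem K (fun x => ‖g x‖ ^ 2) ≤ C * (intElem K (fun x => ‖gradient v x‖ ^ 2) +
          h⁻¹ * ∑ a ∈ K, intFace (K.erase a) (fun x => (v x - b a x) ^ 2)) := by
  obtain ⟨C₁, hC₁, H⟩ := exists_trace d (j + 1) hd R hr
  refine ⟨4 * (1 + (d + 1) * C₁), by positivity, fun K h hK v hv b hb g hg => ?_⟩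
  have hh := hK.h_pos
  have hs := hK.simplex
  have hgc := continuous_of_mem_gradSpace hg.1
  set N := intElem K fun x => ‖g x‖ ^ 2 with hN
  set G := intElem K (fun x => ‖gradient v x‖ ^ 2) with hG
  have hN0 : 0 ≤ N := intElem_nonneg fun x => sq_nonneg _
  -- The weak gradient is its own test field.
  have hid := hg.identity hs hd hv hb hg.1
  simp only [real_inner_self_eq_norm_sq, ← inner_gradient] at hid
  rw [← hN] at hid
  -- Chosen so that the element term and the `d + 1` traces of `g` together cost exactly half of
  -- `N`.
  set s : ℝ := 2 * (1 + (d + 1) * C₁) with hsdef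
  have hsp : 0 < s := by positivity
  have h1 := hs.intElem_inner_le (continuous_gradient hv) hgc hsp
  have htr : ∀ a ∈ K, intFace (K.erase a) (fun x => ‖g x‖ ^ 2) ≤ C₁ * (h⁻¹ * N) := by
    intro a ha
    have hi : ∀ i, Continuous fun x => g x i ^ 2 := fun i => by fun_prop
    have e1 : intFace (K.erase a) (fun x => ‖g x‖ ^ 2) =
        ∑ i, intFace (K.erase a) fun x => g x i ^ 2 := by
      unfold intFace
      simp only [EuclideanSpace.real_norm_sq_eq]
      rw [integral_finsetSum _ fun i _ => hs.integrableOn_face hd ha (hi i)]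
    have e2 : N = ∑ i, intElem K fun x => g x i ^ 2 := by
      rw [hN]
      unfold intElem
      simp only [EuclideanSpace.real_norm_sq_eq]
      rw [integral_finsetSum _ fun i _ => hs.integrableOn_elem (hi i)]
    rw [e1, e2, Finset.mul_sum, Finset.mul_sum]
    exact Finset.sum_le_sum fun i _ => H K h hK a ha _ (gradSpace_le pr j hg.1 i)
  have h2 : ∀ a ∈ K, intFace (K.erase a) (fun x =>
      (b a x - v x) * inner ℝ (g x) (outwardNormal K (K.erase a))) ≤
      s * (h⁻¹ * intFace (K.erase a) fun x => (v x - b a x) ^ 2) + s⁻¹ * (C₁ * N) := by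
    intro a ha
    have hvc := continuous_of_mem_polySpace hv
    have hbc := continuous_of_mem_polySpace (hb a ha)
    have e1 : intFace (K.erase a) (fun x =>
        (b a x - v x) * inner ℝ (g x) (outwardNormal K (K.erase a))) ≤
        (s * h⁻¹) * intFace (K.erase a) (fun x => (v x - b a x) ^ 2) +
          (s * h⁻¹)⁻¹ * intFace (K.erase a) fun x => ‖g x‖ ^ 2 := by
      unfold intFace
      rw [← integral_const_mul, ← integral_const_mul, ← integral_add
        (hs.integrableOn_face hd ha (by fun_prop)) (hs.integrableOn_face hd ha (by fun_prop))]
      refine integral_mono (hs.integrableOn_face hd ha (by fun_prop))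
        (hs.integrableOn_face hd ha (by fun_prop)) fun x => ?_
      simp only
      have f1 := abs_real_inner_le_norm (g x) (outwardNormal K (K.erase a))
      rw [hs.norm_outwardNormal hd ha, mul_one] at f1
      have f2 := inner_le_young ((b a x - v x) • outwardNormal K (K.erase a)) (g x)
        (by positivity : 0 < s * h⁻¹)
      rw [norm_smul, hs.norm_outwardNormal hd ha, mul_one, real_inner_smul_left,
        real_inner_comm, Real.norm_eq_abs, sq_abs] at f2
      linarith [sq_abs (v x - b a x), show (v x - b a x) ^ 2 = (b a x - v x) ^ 2 by ring]
    have e2 : (s * h⁻¹)⁻¹ * intFace (K.erase a) (fun x => ‖g x‖ ^ 2) ≤ s⁻¹ * (C₁ * N) := by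
      calc _ ≤ (s * h⁻¹)⁻¹ * (C₁ * (h⁻¹ * N)) := by
            have := htr a ha
            gcongr
        _ = _ := by field_simp
    linarith
  have h3 := Finset.sum_le_sum h2
  rw [Finset.sum_add_distrib, Finset.sum_const, hs.card_eq, nsmul_eq_mul, ← Finset.mul_sum,
    ← Finset.mul_sum] at h3
  push_cast at h3
  have h4 : s⁻¹ * N + (d + 1) * (s⁻¹ * (C₁ * N)) = N / 2 := by
    rw [hsdef]
    field_simp
  have h5 : 4 * (1 + (d + 1) * C₁) = 2 * s := by rw [hsdef]; ring
  rw [h5]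
  linarith

theorem exists_gradient_inverse (d k : ℕ) {r : ℝ} (R : ℝ) (hr : 0 < r) (hR : 0 ≤ R) :
    ∃ C, 0 < C ∧ ∀ (K : Finset (E d)) (h : ℝ), HasShape r R h K → ∀ v ∈ polySpace d k,
      intElem K (fun x => ‖gradient v x‖ ^ 2) ≤ C * ((h ^ 2)⁻¹ * intElem K fun x => v x ^ 2) := by
  obtain ⟨C, hC, H⟩ := exists_elem_inverse d k R hr
  have hb := ballVol_nonneg d
  refine ⟨R ^ d * ballVol d * C + 1, by positivity, fun K h hK v hv => ?_⟩
  have hh := hK.h_pos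
  set N := intElem K fun x => v x ^ 2
  have hN0 : 0 ≤ N := intElem_nonneg fun x => sq_nonneg _
  have h1 := hK.intElem_le (f := fun x => ‖gradient v x‖ ^ 2)
    (M := C * (h ^ 2)⁻¹ * ((h ^ d)⁻¹ * N)) (by positivity) fun x hx => by
      rw [abs_of_nonneg (sq_nonneg _), norm_gradient]
      exact (H K h hK v hv x hx).2
  refine h1.trans ?_
  have h2 : R ^ d * ballVol d * (h ^ d * (C * (h ^ 2)⁻¹ * ((h ^ d)⁻¹ * N))) =
      R ^ d * ballVol d * C * ((h ^ 2)⁻¹ * N) := by field_simp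
  rw [h2, add_mul]
  have : 0 ≤ (h ^ 2)⁻¹ * N := by positivity
  linarith

end WG

namespace WG

open scoped Classical Topology

/-! ### Geometry of conforming meshes -/

variable {d : ℕ} {Ω : Set (E d)} (T : Mesh Ω)

theorem Mesh.isSimplex {K : Finset (E d)} (hK : K ∈ T.elements) : IsSimplex K :=
  ⟨T.card_eq K hK, T.affineIndependent K hK⟩

theorem Mesh.hasShape {σ γ h : ℝ} (hσ : 0 < σ) (hγ : 0 < γ) (hh : 0 < h)
    (hS : T.IsShapeRegular σ) (hQ : T.IsQuasiUniform γ h) {K : Finset (E d)}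
    (hK : K ∈ T.elements) : HasShape (1 / (γ * σ)) γ h K := by
  obtain ⟨h1, h2⟩ := hQ K hK
  refine ⟨T.isSimplex hK, hh, by positivity, ?_, fun x hx y hy => ?_⟩
  · obtain ⟨z, hz⟩ := hS K hK
    refine ⟨z, (Metric.ball_subset_ball ?_).trans hz⟩
    calc 1 / (γ * σ) * h = h / γ / σ := by field_simp
      _ ≤ _ := by gcongr
  · rw [← dist_eq_norm]
    exact (Metric.dist_le_diam_of_mem (T.isSimplex hK).isBounded hx hy).trans h2

/-- By conformity the point lies in the hull of the common vertices, and there the two coordinates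
are affine with the same vertex values. -/
theorem Mesh.lam_eq {K K' : Finset (E d)} (hK : K ∈ T.elements) (hK' : K' ∈ T.elements) {x : E d}
    (hx : x ∈ convexHull ℝ (K : Set (E d))) (hx' : x ∈ convexHull ℝ (K' : Set (E d))) {b : E d}
    (hb : b ∈ K) (hb' : b ∈ K') : lam K b x = lam K' b x := by
  have h1 : x ∈ convexHull ℝ ((K ∩ K' : Finset (E d)) : Set (E d)) := by
    rw [← T.conforming K hK K' hK']
    exact ⟨hx, hx'⟩
  have h2 : Convex ℝ {y | lam K b y = lam K' b y} := by
    have h3 := (convex_singleton (0 : ℝ)).affine_preimage (lam K b - lam K' b)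
    have h4 : {y | lam K b y = lam K' b y} = (lam K b - lam K' b) ⁻¹' {0} := by
      ext y
      simp [sub_eq_zero]
    rw [h4]
    exact h3
  refine convexHull_min (fun y hy => ?_) h2 h1
  rw [Finset.mem_coe, Finset.mem_inter] at hy
  change lam K b y = lam K' b y
  by_cases hyb : b = y
  · rw [← hyb, (T.isSimplex hK).lam_self hb, (T.isSimplex hK').lam_self hb']
  · rw [(T.isSimplex hK).lam_of_ne hb hy.1 hyb, (T.isSimplex hK').lam_of_ne hb' hy.2 hyb]

/-- A vertex of positive weight belongs to the smallest face carrying `x`, and by conformity that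
face is shared by every element containing `x`. -/
theorem Mesh.mem_of_lam_pos {K K' : Finset (E d)} (hK : K ∈ T.elements) (hK' : K' ∈ T.elements)
    {x : E d} (hx : x ∈ convexHull ℝ (K : Set (E d))) (hx' : x ∈ convexHull ℝ (K' : Set (E d)))
    {b : E d} (hb : b ∈ K) (hpos : 0 < lam K b x) : b ∈ K' := by
  by_contra hb'
  have h1 : x ∈ convexHull ℝ ((K ∩ K' : Finset (E d)) : Set (E d)) := by
    rw [← T.conforming K hK K' hK']
    exact ⟨hx, hx'⟩
  have h2 := (((T.isSimplex hK).mem_convexHull_face_iff Finset.inter_subset_left).1 h1).2 b hb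
    fun h => hb' (Finset.mem_inter.1 h).2
  exact hpos.ne' h2

theorem Mesh.mem_of_lam_pos_of_subset {K K' e : Finset (E d)} (hK : K ∈ T.elements)
    (hK' : K' ∈ T.elements) (he : e ⊆ K') {x : E d} (hx : x ∈ convexHull ℝ (K : Set (E d)))
    (hx' : x ∈ convexHull ℝ (e : Set (E d))) {b : E d} (hb : b ∈ K) (hpos : 0 < lam K b x) :
    b ∈ e := by
  have hx2 := face_subset he hx'
  have hb' := T.mem_of_lam_pos hK hK' hx hx2 hb hpos
  by_contra hbe
  have h2 := (((T.isSimplex hK').mem_convexHull_face_iff he).1 hx').2 b hb' hbe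
  rw [T.lam_eq hK hK' hx hx2 hb hb'] at hpos
  exact hpos.ne' h2

theorem Mesh.eq_of_interior {K K' : Finset (E d)} (hK : K ∈ T.elements) (hK' : K' ∈ T.elements)
    {x : E d} (hx : x ∈ interior (convexHull ℝ (K : Set (E d))))
    (hx' : x ∈ convexHull ℝ (K' : Set (E d))) : K = K' := by
  refine Finset.eq_of_subset_of_card_le (fun b hb => ?_) ?_
  · exact T.mem_of_lam_pos hK hK' (interior_subset hx) hx' hb
      ((T.isSimplex hK).mem_interior_iff.1 hx b hb)
  · rw [T.card_eq K hK, T.card_eq K' hK']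

theorem Mesh.elem_subset_closure {K : Finset (E d)} (hK : K ∈ T.elements) :
    convexHull ℝ (K : Set (E d)) ⊆ closure Ω := by
  rw [T.closure_eq]
  exact subset_biUnion_of_mem (u := fun K : Finset (E d) => convexHull ℝ (K : Set (E d))) hK

/-- The number of elements at a vertex is bounded in terms of the shape parameters. -/
theorem exists_card_bound (d : ℕ) (hd : 1 ≤ d) {r : ℝ} (R : ℝ) (hr : 0 < r) :
    ∃ N : ℝ, 0 < N ∧ ∀ (Ω : Set (E d)) (T : Mesh Ω) (h : ℝ),
      (∀ K ∈ T.elements, HasShape r R h K) → ∀ x : E d,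
      ((T.elements.filter fun K => x ∈ K).card : ℝ) ≤ N := by
  haveI : Nonempty (Fin d) := ⟨⟨0, hd⟩⟩
  -- Volume comparison: the elements at `x` contain disjoint balls of radius `r h`, all inside the
  -- ball of radius `R h` about `x`.
  refine ⟨(R / r) ^ d ⊔ 1, by positivity, fun Ω T h hT x => ?_⟩
  set S := T.elements.filter fun K => x ∈ K
  rcases S.eq_empty_or_nonempty with hS | ⟨K₀, hK₀⟩
  · rw [hS]; simp
  refine le_sup_of_le_left ?_
  have hmem : ∀ K ∈ S, K ∈ T.elements ∧ x ∈ K := fun K hK => Finset.mem_filter.1 hK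
  have hh := (hT K₀ (hmem K₀ hK₀).1).h_pos
  have hR := (hT K₀ (hmem K₀ hK₀).1).R_nonneg
  have hz : ∀ K, ∃ z, K ∈ S → Metric.ball z (r * h) ⊆ convexHull ℝ (K : Set (E d)) := by
    intro K
    by_cases hK : K ∈ S
    · obtain ⟨z, hz⟩ := (hT K (hmem K hK).1).ball
      exact ⟨z, fun _ => hz⟩
    · exact ⟨0, fun h => absurd h hK⟩
  choose z hz using hz
  have hrh : 0 < r * h := by positivity
  have hdisj : Set.PairwiseDisjoint (S : Set (Finset (E d))) fun K => Metric.ball (z K) (r * h) := by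
    intro K hK K' hK' hne
    refine Set.disjoint_left.2 fun y hy hy' => hne ?_
    exact T.eq_of_interior (hmem K hK).1 (hmem K' hK').1
      (interior_maximal (hz K hK) Metric.isOpen_ball hy) (hz K' hK' hy')
  have h1 := measureReal_biUnion_finset (μ := (volume : Measure (E d))) hdisj
    (fun K _ => Metric.isOpen_ball.measurableSet) (fun K _ => measure_ball_lt_top.ne)
  have h2 : volume.real (⋃ K ∈ S, Metric.ball (z K) (r * h)) ≤
      volume.real (Metric.closedBall x (R * h)) := by
    refine measureReal_mono ?_ measure_closedBall_lt_top.ne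
    refine iUnion₂_subset fun K hK y hy => ?_
    rw [Metric.mem_closedBall, dist_eq_norm]
    exact (hT K (hmem K hK).1).diam y (hz K hK hy) x (vertex_mem (hmem K hK).2)
  have h3 : ∀ K ∈ S, volume.real (Metric.ball (z K) (r * h)) = (r * h) ^ d * ballVol d := by
    intro K _
    rw [← volume_closedBall_real (z K) hrh.le, measureReal_def, measureReal_def,
      Measure.addHaar_closedBall_eq_addHaar_ball]
  rw [h1, Finset.sum_congr rfl h3, Finset.sum_const, nsmul_eq_mul,
    volume_closedBall_real x (by positivity)] at h2
  have hb : 0 < ballVol d := by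
    have h4 : 0 < volume.real (Metric.ball (0 : E d) 1) :=
      ENNReal.toReal_pos (Metric.measure_ball_pos _ _ one_pos).ne' measure_ball_lt_top.ne
    have h5 := volume_closedBall_real (0 : E d) zero_le_one
    rw [one_pow, one_mul, measureReal_def, Measure.addHaar_closedBall_eq_addHaar_ball,
      ← measureReal_def] at h5
    rwa [← h5]
  rw [← mul_assoc] at h2
  have h6 := le_of_mul_le_mul_right h2 hb
  rw [div_pow, le_div_iff₀ (by positivity)]
  rw [mul_pow, mul_pow, ← mul_assoc] at h6
  exact le_of_mul_le_mul_right h6 (by positivity)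

theorem IsSimplex.volume_face {K : Finset (E d)} (hK : IsSimplex K) {e : Finset (E d)}
    (he : e ∈ K.powersetCard d) : volume (convexHull ℝ (e : Set (E d))) = 0 := by
  rw [Finset.mem_powersetCard] at he
  obtain ⟨a, ha, hae⟩ : ∃ a ∈ K, a ∉ e := by
    by_contra! hcon
    have := Finset.card_le_card hcon
    rw [hK.card_eq, he.2] at this
    omega
  refine measure_mono_null (convexHull_subset_affineSpan _)
    (Measure.addHaar_affineSubspace _ _ fun htop => ?_)
  have h1 := hK.lam_eq_zero_of_mem_affineSpan he.1 ha hae (x := a) (by rw [htop]; trivial)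
  rw [hK.lam_self ha] at h1
  exact one_ne_zero h1

/-- Lets hypotheses stated on the open set `Ω` be used almost everywhere on the closed elements. -/
theorem Mesh.volume_frontier (T : Mesh Ω) : volume (frontier Ω) = 0 := by
  have h1 : frontier Ω ⊆ ⋃ K ∈ T.elements, ⋃ e ∈ K.powersetCard d,
      convexHull ℝ (e : Set (E d)) := by
    intro x hx
    obtain ⟨K, hK, e, he, hxe, -⟩ := T.frontier_subset x hx
    simp only [mem_iUnion]
    exact ⟨K, hK, e, he, hxe⟩
  refine measure_mono_null h1 ((measure_biUnion_null_iff T.elements.countable_toSet).2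
    fun K hK => (measure_biUnion_null_iff (Finset.countable_toSet _)).2 fun e he => ?_)
  exact (T.isSimplex hK).volume_face he

theorem mem_powersetCard_iff {K : Finset (E d)} (hK : K.card = d + 1) {e : Finset (E d)} :
    e ∈ K.powersetCard d ↔ ∃ a ∈ K, e = K.erase a := by
  rw [Finset.mem_powersetCard]
  constructor
  · rintro ⟨h1, h2⟩
    have h3 : (K \ e).card = 1 := by rw [Finset.card_sdiff_of_subset h1]; omega
    obtain ⟨a, ha⟩ := Finset.card_eq_one.1 h3
    have haK : a ∈ K \ e := by rw [ha]; exact Finset.mem_singleton_self a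
    refine ⟨a, (Finset.mem_sdiff.1 haK).1, ?_⟩
    rw [Finset.erase_eq, ← ha, Finset.sdiff_sdiff_eq_self h1]
  · rintro ⟨a, ha, rfl⟩
    exact ⟨Finset.erase_subset _ _, by rw [Finset.card_erase_of_mem ha, hK]; rfl⟩

theorem Mesh.erase_mem_faces {K : Finset (E d)} (hK : K ∈ T.elements) {a : E d} (ha : a ∈ K) :
    K.erase a ∈ T.faces :=
  Finset.mem_biUnion.2 ⟨K, hK, (mem_powersetCard_iff (T.card_eq K hK)).2 ⟨a, ha, rfl⟩⟩

theorem Mesh.exists_erase_of_mem_faces {e : Finset (E d)} (he : e ∈ T.faces) :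
    ∃ K ∈ T.elements, ∃ a ∈ K, e = K.erase a := by
  obtain ⟨K, hK, h⟩ := Finset.mem_biUnion.1 he
  exact ⟨K, hK, (mem_powersetCard_iff (T.card_eq K hK)).1 h⟩

theorem Mesh.card_face {e : Finset (E d)} (he : e ∈ T.faces) : e.card = d := by
  obtain ⟨K, hK, h⟩ := Finset.mem_biUnion.1 he
  exact (Finset.mem_powersetCard.1 h).2

/-- The neighbourhood of a relative interior point of a face is covered by the element and its
neighbour. -/
theorem Mesh.exists_neighbor {K : Finset (E d)} (hK : K ∈ T.elements) {a : E d}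
    (ha : a ∈ K) {p : E d} (hp0 : lam K a p = 0) (hp : ∀ b ∈ K, b ≠ a → 0 < lam K b p)
    (hnb : ¬IsBoundaryFace Ω (K.erase a)) :
    ∃ K' ∈ T.elements, K' ≠ K ∧ K.erase a ⊆ K' ∧
      convexHull ℝ (K : Set (E d)) ∪ convexHull ℝ (K' : Set (E d)) ∈ 𝓝 p := by
  have hs := T.isSimplex hK
  have hpK : p ∈ convexHull ℝ (K : Set (E d)) := hs.mem_convexHull_iff.2 fun b hb => by
    by_cases hba : b = a
    · rw [hba, hp0]
    · exact (hp b hb hba).le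
  -- the point lies in the open domain
  have hpf : p ∉ frontier Ω := by
    intro hpf
    obtain ⟨K₁, hK₁, e, he, hpe, heb⟩ := T.frontier_subset p hpf
    have he' := Finset.mem_powersetCard.1 he
    have hsub : K.erase a ⊆ e := fun b hb =>
      T.mem_of_lam_pos_of_subset hK hK₁ he'.1 hpK hpe (Finset.mem_of_mem_erase hb)
        (hp b (Finset.mem_of_mem_erase hb) (Finset.ne_of_mem_erase hb))
    have heq : K.erase a = e := Finset.eq_of_subset_of_card_le hsub (by
      rw [he'.2, Finset.card_erase_of_mem ha, T.card_eq K hK]; simp)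
    exact hnb (by rw [heq]; exact heb)
  have hnear : ⋃ K' ∈ T.elements, convexHull ℝ (K' : Set (E d)) ∈ 𝓝 p := by
    rw [← T.closure_eq]
    have : p ∈ interior Ω := by
      by_contra hcon
      exact hpf ⟨T.elem_subset_closure hK hpK, hcon⟩
    exact Filter.mem_of_superset (mem_interior_iff_mem_nhds.1 this) subset_closure
  -- elements near `p` contain the face
  have hfar : ∀ᶠ y in 𝓝 p, ∀ K' ∈ T.elements, y ∈ convexHull ℝ (K' : Set (E d)) →
      p ∈ convexHull ℝ (K' : Set (E d)) := by
    rw [Filter.eventually_all_finset]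
    intro K' _
    by_cases h : p ∈ convexHull ℝ (K' : Set (E d))
    · exact Filter.Eventually.of_forall fun _ _ => h
    · filter_upwards [(isClosed_face K').isOpen_compl.mem_nhds h] with y hy hy'
      exact absurd hy' hy
  have hface : ∀ K' ∈ T.elements, p ∈ convexHull ℝ (K' : Set (E d)) → K.erase a ⊆ K' :=
    fun K' hK' hpK' b hb => T.mem_of_lam_pos hK hK' hpK hpK' (Finset.mem_of_mem_erase hb)
      (hp b (Finset.mem_of_mem_erase hb) (Finset.ne_of_mem_erase hb))
  have hposK : ∀ᶠ y in 𝓝 p, ∀ b ∈ K.erase a, 0 < lam K b y := by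
    rw [Filter.eventually_all_finset]
    exact fun b hb => (continuous_lam K b).continuousAt.eventually_const_lt
      (hp b (Finset.mem_of_mem_erase hb) (Finset.ne_of_mem_erase hb))
  obtain ⟨c, hcK, hca⟩ : ∃ c ∈ K, c ≠ a := by
    by_contra! hcon
    have h1 : K = {a} := Finset.eq_singleton_iff_unique_mem.2 ⟨ha, hcon⟩
    have h2 := hs.sum_lam p
    rw [h1, Finset.sum_singleton, ← h1, hp0] at h2
    exact zero_ne_one h2
  -- there are points on the other side
  have hline : ∀ s : ℝ, Filter.Tendsto (fun t : ℝ => p + (t * s) • (a - c)) (𝓝[>] 0) (𝓝 p) := by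
    intro s
    have : Continuous fun t : ℝ => p + (t * s) • (a - c) := by fun_prop
    have h1 := this.tendsto 0
    simp only [zero_mul, zero_smul, add_zero] at h1
    exact h1.mono_left nhdsWithin_le_nhds
  have hlam : ∀ t : ℝ, lam K a (p + t • (a - c)) = t := fun t => by
    rw [lam_add_smul, hp0, hs.lam_self ha, hs.lam_of_ne ha hcK hca.symm]
    ring
  obtain ⟨K', hK', hpK', hne⟩ : ∃ K' ∈ T.elements, p ∈ convexHull ℝ (K' : Set (E d)) ∧
      K' ≠ K := by
    obtain ⟨t, ⟨ht, h1⟩, ht0⟩ := ((((hline (-1)).eventually hnear).and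
      ((hline (-1)).eventually hfar)).and self_mem_nhdsWithin).exists
    obtain ⟨K', hK', hy⟩ := mem_iUnion₂.1 ht
    refine ⟨K', hK', h1 K' hK' hy, ?_⟩
    rintro rfl
    have h2 := hs.mem_convexHull_iff.1 hy a ha
    rw [hlam] at h2
    have : (0 : ℝ) < t := ht0
    linarith
  have heK' := hface K' hK' hpK'
  refine ⟨K', hK', hne, heK', ?_⟩
  have hs' := T.isSimplex hK'
  obtain ⟨a', ha', hea'⟩ : ∃ a' ∈ K', K.erase a = K'.erase a' := by
    refine (mem_powersetCard_iff (T.card_eq K' hK')).1 (Finset.mem_powersetCard.2 ⟨heK', ?_⟩)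
    rw [Finset.card_erase_of_mem ha, T.card_eq K hK]; rfl
  -- Both coordinates vanish on the common face, so they are proportional.
  have hmul : ∀ y, lam K' a' y = lam K' a' a * lam K a y := by
    intro y
    rw [hs.affine_apply (lam K' a') y, Finset.sum_eq_single a]
    · ring
    · intro b hb hba
      have h1 : b ∈ K'.erase a' := by rw [← hea']; exact Finset.mem_erase.2 ⟨hba, hb⟩
      rw [hs'.lam_of_ne ha' (Finset.mem_of_mem_erase h1) (Finset.ne_of_mem_erase h1).symm,
        mul_zero]
    · exact fun h => absurd ha h
  have hposK' : ∀ᶠ y in 𝓝 p, ∀ b ∈ K'.erase a', 0 < lam K' b y := by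
    rw [Filter.eventually_all_finset]
    intro b hb
    refine (continuous_lam K' b).continuousAt.eventually_const_lt ?_
    change 0 < lam K' b p
    rw [← hea'] at hb
    rw [← T.lam_eq hK hK' hpK hpK' (Finset.mem_of_mem_erase hb) (heK' hb)]
    exact hp b (Finset.mem_of_mem_erase hb) (Finset.ne_of_mem_erase hb)
  -- A positive factor would put both elements on the same side of the face, so their interiors
  -- would overlap. Hence they lie on opposite sides and the sign of `λ_a` decides which one
  -- contains a nearby point.
  have hneg : lam K' a' a < 0 := by
    by_contra! hcon
    rcases hcon.eq_or_lt with h0 | hpos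
    · have h1 := hmul a'
      rw [hs'.lam_self ha', ← h0, zero_mul] at h1
      exact one_ne_zero h1
    · obtain ⟨t, ⟨h1, h2⟩, ht0⟩ := ((((hline 1).eventually hposK).and
        ((hline 1).eventually hposK')).and self_mem_nhdsWithin).exists
      have ht : (0 : ℝ) < t := ht0
      set y := p + (t * 1) • (a - c) with hy
      have hya : 0 < lam K a y := by rw [hy, hlam]; linarith
      refine hne (T.eq_of_interior hK hK' (x := y) (hs.mem_interior_iff.2 fun b hb => ?_)
        (hs'.mem_convexHull_iff.2 fun b hb => ?_)).symm
      · by_cases hba : b = a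
        · rwa [hba]
        · exact h1 b (Finset.mem_erase.2 ⟨hba, hb⟩)
      · by_cases hba : b = a'
        · rw [hba, hmul]; positivity
        · exact (h2 b (Finset.mem_erase.2 ⟨hba, hb⟩)).le
  filter_upwards [hposK, hposK'] with y h1 h2
  rcases le_total 0 (lam K a y) with h | h
  · refine Or.inl (hs.mem_convexHull_iff.2 fun b hb => ?_)
    by_cases hba : b = a
    · rwa [hba]
    · exact (h1 b (Finset.mem_erase.2 ⟨hba, hb⟩)).le
  · refine Or.inr (hs'.mem_convexHull_iff.2 fun b hb => ?_)
    by_cases hba : b = a'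
    · rw [hba, hmul]; exact mul_nonneg_of_nonpos_of_nonpos hneg.le h
    · exact (h2 b (Finset.mem_erase.2 ⟨hba, hb⟩)).le

end WG

namespace WG

open scoped Classical Topology

/-! ### Connectivity of the elements at a vertex -/

variable {d : ℕ} {Ω : Set (E d)} (T : Mesh Ω)

/-- `K'` is an element with vertex `x` that shares with `K` an interior face containing `x`. -/
def Mesh.Adj (x : E d) (K K' : Finset (E d)) : Prop :=
  K' ∈ T.elements ∧ x ∈ K' ∧ ∃ e ∈ T.faces, x ∈ e ∧ e ⊆ K ∧ e ⊆ K' ∧ ¬IsBoundaryFace Ω e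

theorem Mesh.mem_of_reach {x : E d} {K K' : Finset (E d)} (hK : K ∈ T.elements) (hx : x ∈ K)
    (h : Relation.ReflTransGen (T.Adj x) K K') : K' ∈ T.elements ∧ x ∈ K' := by
  induction h with
  | refl => exact ⟨hK, hx⟩
  | tail _ h _ => exact ⟨h.1, h.2.1⟩

/-- Cones over codimension-two faces are null sets; a generic segment therefore crosses faces only
at relative interior points. -/
theorem volume_affineSpan_insert (hd : 2 ≤ d) (s : Finset (E d)) (hs : s.card = d - 1) (y : E d) :
    volume (affineSpan ℝ (insert y (s : Set (E d))) : Set (E d)) = 0 := by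
  refine Measure.addHaar_affineSubspace _ _ fun htop => ?_
  have h1 := finrank_vectorSpan_insert_le_set ℝ (s : Set (E d)) y
  have h2 := finrank_vectorSpan_image_finset_le ℝ id s (n := d - 2) (by omega)
  rw [Finset.image_id] at h2
  rw [← direction_affineSpan ℝ (insert y (s : Set (E d))), htop, AffineSubspace.direction_top,
    finrank_top, finrank_euclideanSpace_fin] at h1
  omega

/-- If no element reachable from `K` has a boundary face at the vertex `x`, then the reachable
elements cover a neighbourhood of `x`. -/
theorem Mesh.reach_mem_nhds (hd : 2 ≤ d) {x : E d} {K : Finset (E d)} (hK : K ∈ T.elements)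
    (hx : x ∈ K) (hno : ∀ K', Relation.ReflTransGen (T.Adj x) K K' →
      ∀ e ∈ T.faces, x ∈ e → e ⊆ K' → ¬IsBoundaryFace Ω e) :
    ⋃ K' ∈ T.elements.filter (Relation.ReflTransGen (T.Adj x) K),
      convexHull ℝ (K' : Set (E d)) ∈ 𝓝 x := by
  set S := T.elements.filter (Relation.ReflTransGen (T.Adj x) K)
  have hS : ∀ K' ∈ S, K' ∈ T.elements ∧ x ∈ K' ∧ Relation.ReflTransGen (T.Adj x) K K' :=
    fun K' h => ⟨(Finset.mem_filter.1 h).1, (T.mem_of_reach hK hx (Finset.mem_filter.1 h).2).2,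
      (Finset.mem_filter.1 h).2⟩
  set U := ⋃ K' ∈ S, convexHull ℝ (K' : Set (E d)) with hU
  have hUc : IsClosed U := isClosed_biUnion_finset fun K' _ => isClosed_face K'
  have hmemU : ∀ K' ∈ S, convexHull ℝ (K' : Set (E d)) ⊆ U := fun K' h =>
    subset_biUnion_of_mem (u := fun K : Finset (E d) => convexHull ℝ (K : Set (E d))) h
  have hKS : K ∈ S := Finset.mem_filter.2 ⟨hK, Relation.ReflTransGen.refl⟩
  have hs := T.isSimplex hK
  -- Within distance `δ` of `x` the coordinate at `x` is positive on every reached element, so only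
  -- faces containing `x` can be crossed.
  obtain ⟨δ, hδ, hball⟩ : ∃ δ > 0, ∀ y ∈ Metric.ball x δ, ∀ K' ∈ S, 0 < lam K' x y := by
    have h1 : ∀ᶠ y in 𝓝 x, ∀ K' ∈ S, 0 < lam K' x y := by
      rw [Filter.eventually_all_finset]
      intro K' hK'
      refine (continuous_lam K' x).continuousAt.eventually_const_lt ?_
      change 0 < lam K' x x
      rw [(T.isSimplex (hS K' hK').1).lam_self (hS K' hK').2.1]
      exact one_pos
    exact Metric.eventually_nhds_iff_ball.1 h1
  obtain ⟨y₀, hy₀, hy₀K⟩ : ∃ y₀ ∈ Metric.ball x δ, y₀ ∈ interior (convexHull ℝ (K : Set (E d))) := by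
    obtain ⟨c, hc⟩ := hs.interior_nonempty
    rw [hs.mem_interior_iff] at hc
    have h1 : Filter.Tendsto (fun t : ℝ => x + t • (c - x)) (𝓝[>] 0) (𝓝 x) := by
      have : Continuous fun t : ℝ => x + t • (c - x) := by fun_prop
      have h1 := this.tendsto 0
      simp only [zero_smul, add_zero] at h1
      exact h1.mono_left nhdsWithin_le_nhds
    obtain ⟨t, h2, ht0, ht1⟩ := ((h1.eventually (Metric.ball_mem_nhds x hδ)).and
      (Ioo_mem_nhdsGT (zero_lt_one' ℝ))).exists
    refine ⟨_, h2, hs.mem_interior_iff.2 fun b hb => ?_⟩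
    rw [lam_add_smul]
    have h3 := hc b hb
    have h4 := hs.mem_convexHull_iff.1 (vertex_mem hx) b hb
    nlinarith
  -- The exceptional endpoints: a segment from `y₀` that meets a codimension-two face of a reached
  -- element ends in one of these null subspaces.
  set N : Set (E d) := ⋃ K' ∈ S, ⋃ a ∈ K', ⋃ b ∈ K'.erase a,
    (affineSpan ℝ (insert y₀ (((K'.erase a).erase b : Finset (E d)) : Set (E d))) : Set (E d))
  have hN : volume N = 0 := by
    refine (measure_biUnion_null_iff S.countable_toSet).2 fun K' hK' =>
      (measure_biUnion_null_iff (Finset.countable_toSet _)).2 fun a ha =>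
      (measure_biUnion_null_iff (Finset.countable_toSet _)).2 fun b hb =>
      volume_affineSpan_insert hd _ ?_ _
    rw [Finset.card_erase_of_mem hb, Finset.card_erase_of_mem ha, T.card_eq K' (hS K' hK').1]
    omega
  have hgen : ∀ z ∈ Metric.ball x δ, z ∉ N → z ∈ U := by
    intro z hz hzN
    let f : ℝ → E d := fun t => y₀ + t • (z - y₀)
    have hfc : Continuous f := by fun_prop
    have hsub : Icc (0 : ℝ) 1 ⊆ f ⁻¹' U := by
      -- Continuity method along the segment: the parameters mapped into `U` form a closed set, and
      -- each such parameter below 1 has a neighbourhood mapped into `U`.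
      refine IsClosed.Icc_subset_of_forall_mem_nhdsWithin
        ((hUc.preimage hfc).inter isClosed_Icc) ?_ ?_
      · simp only [f, mem_preimage, zero_smul, add_zero]
        exact hmemU K hKS (interior_subset hy₀K)
      · rintro t ⟨htU, ht0, ht1⟩
        refine mem_nhdsWithin_of_mem_nhds (hfc.continuousAt.preimage_mem_nhds ?_)
        obtain ⟨K', hK', htK'⟩ := mem_iUnion₂.1 htU
        obtain ⟨hK'T, hxK', hreach⟩ := hS K' hK'
        have hs' := T.isSimplex hK'T
        have hftb : f t ∈ Metric.ball x δ := by
          have := (convex_ball x δ).add_smul_sub_mem hy₀ hz ⟨ht0, ht1.le⟩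
          exact this
        have hpos := hball _ hftb K' hK'
        have hnn := hs'.mem_convexHull_iff.1 htK'
        by_cases hall : ∀ b ∈ K', 0 < lam K' b (f t)
        · exact Filter.mem_of_superset (mem_interior_iff_mem_nhds.1 (hs'.mem_interior_iff.2 hall))
            (hmemU K' hK')
        push Not at hall
        obtain ⟨a, ha, ha0⟩ := hall
        have ha0' : lam K' a (f t) = 0 := le_antisymm ha0 (hnn a ha)
        -- Two vanishing coordinates would mean a codimension-two face, excluded by the choice of
        -- `z`; at `t = 0` the point is interior to `K`, so no coordinate vanishes.
        have hothers : ∀ b ∈ K', b ≠ a → 0 < lam K' b (f t) := by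
          intro b hb hba
          by_contra! hb0
          have hb0' : lam K' b (f t) = 0 := le_antisymm hb0 (hnn b hb)
          have hbe : b ∈ K'.erase a := Finset.mem_erase.2 ⟨hba, hb⟩
          have hflat : f t ∈ convexHull ℝ (((K'.erase a).erase b : Finset (E d)) : Set (E d)) := by
            rw [hs'.mem_convexHull_face_iff
              ((Finset.erase_subset _ _).trans (Finset.erase_subset _ _))]
            refine ⟨hnn, fun c hc hce => ?_⟩
            by_cases hca : c = a
            · rw [hca, ha0']
            · by_cases hcb : c = b
              · rw [hcb, hb0']
              · exact absurd (Finset.mem_erase.2 ⟨hcb, Finset.mem_erase.2 ⟨hca, hc⟩⟩) hce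
          rcases ht0.eq_or_lt with rfl | htpos
          · have hf0 : f 0 = y₀ := by simp [f]
            rw [hf0] at htK' ha0'
            have hKK := T.eq_of_interior hK hK'T hy₀K htK'
            subst hKK
            exact (hs.mem_interior_iff.1 hy₀K a ha).ne' ha0'
          · refine hzN ?_
            simp only [N, mem_iUnion]
            refine ⟨K', hK', a, ha, b, hbe, ?_⟩
            have h1 : z = AffineMap.lineMap y₀ (f t) t⁻¹ := by
              simp only [f, AffineMap.lineMap_apply, vsub_eq_sub, add_sub_cancel_left, vadd_eq_add,
                smul_smul, inv_mul_cancel₀ htpos.ne', one_smul, sub_add_cancel]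
            rw [h1]
            exact AffineMap.lineMap_mem _ (mem_affineSpan ℝ (mem_insert _ _))
              (affineSpan_mono ℝ (subset_insert _ _) (convexHull_subset_affineSpan _ hflat))
        have hxa : x ≠ a := by
          rintro rfl
          exact hpos.ne' ha0'
        have hxe : x ∈ K'.erase a := Finset.mem_erase.2 ⟨hxa, hxK'⟩
        have hef := T.erase_mem_faces hK'T ha
        have hnb := hno K' hreach _ hef hxe (Finset.erase_subset _ _)
        obtain ⟨K'', hK'', -, hsubK, hnhds⟩ := T.exists_neighbor hK'T ha ha0' hothers hnb
        have hK''S : K'' ∈ S := Finset.mem_filter.2 ⟨hK'', hreach.tail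
          ⟨hK'', hsubK hxe, _, hef, hxe, Finset.erase_subset _ _, hsubK, hnb⟩⟩
        exact Filter.mem_of_superset hnhds (union_subset (hmemU K' hK') (hmemU K'' hK''S))
    have h1 := hsub (right_mem_Icc.2 zero_le_one)
    simpa [f] using h1
  refine Filter.mem_of_superset (Metric.ball_mem_nhds x hδ) fun z hz => ?_
  by_contra hzU
  -- The uncovered part of the ball is open and contained in the null set `N`, hence empty.
  have hopen : IsOpen (Metric.ball x δ ∩ Uᶜ) := Metric.isOpen_ball.inter hUc.isOpen_compl
  have hsubN : Metric.ball x δ ∩ Uᶜ ⊆ N := fun y hy => by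
    by_contra hyN
    exact hy.2 (hgen y hy.1 hyN)
  exact (hopen.measure_pos volume ⟨z, hz, hzU⟩).ne' (measure_mono_null hsubN hN)

/-- Interior points of `K'` accumulate at `x`; one of them lies in a reached element, which must
then be `K'`. -/
theorem Mesh.reach_of_mem_nhds {x : E d} {K K' : Finset (E d)}
    (h : ⋃ K' ∈ T.elements.filter (Relation.ReflTransGen (T.Adj x) K),
      convexHull ℝ (K' : Set (E d)) ∈ 𝓝 x) (hK' : K' ∈ T.elements) (hx : x ∈ K') :
    Relation.ReflTransGen (T.Adj x) K K' := by
  have hs := T.isSimplex hK'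
  have h1 : x ∈ closure (interior (convexHull ℝ (K' : Set (E d)))) := by
    rw [(convex_convexHull ℝ _).closure_interior_eq_closure_of_nonempty_interior
      hs.interior_nonempty]
    exact subset_closure (vertex_mem hx)
  obtain ⟨y, hy, hyK⟩ := mem_closure_iff_nhds.1 h1 _ h
  obtain ⟨L, hL, hyL⟩ := mem_iUnion₂.1 hy
  obtain ⟨hLT, hLR⟩ := Finset.mem_filter.1 hL
  rwa [T.eq_of_interior hK' hLT hyK hyL]

/-- A chain of adjacent elements can be shortened to a path without repetitions, whose length is
below the number of elements at `x`. -/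
theorem Mesh.abs_sub_le_of_reach {x : E d} {K : Finset (E d)} (hK : K ∈ T.elements) (hx : x ∈ K)
    (f : Finset (E d) → ℝ) {M N : ℝ} (hM : 0 ≤ M)
    (hN : ((T.elements.filter fun K => x ∈ K).card : ℝ) ≤ N)
    (hf : ∀ K ∈ T.elements, x ∈ K → ∀ K', T.Adj x K K' → |f K - f K'| ≤ M) {K' : Finset (E d)}
    (h : Relation.ReflTransGen (T.Adj x) K K') : |f K - f K'| ≤ N * M := by
  let V := {K // K ∈ T.elements.filter fun K => x ∈ K}
  let G : SimpleGraph V := SimpleGraph.fromRel fun a b => T.Adj x a.1 b.1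
  have hmem : ∀ {K : Finset (E d)}, K ∈ T.elements → x ∈ K →
      K ∈ T.elements.filter fun K => x ∈ K := fun h1 h2 => Finset.mem_filter.2 ⟨h1, h2⟩
  have hreach : ∀ (h1 : K' ∈ T.elements) (h2 : x ∈ K'),
      G.Reachable ⟨K, hmem hK hx⟩ ⟨K', hmem h1 h2⟩ := by
    induction h with
    | refl => exact fun _ _ => SimpleGraph.Reachable.refl _
    | @tail L L' hL hLL' ih =>
      intro h1 h2
      obtain ⟨h3, h4⟩ := T.mem_of_reach hK hx hL
      refine (ih h3 h4).trans ?_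
      by_cases heq : L = L'
      · subst heq; exact SimpleGraph.Reachable.refl _
      · refine SimpleGraph.Adj.reachable ?_
        rw [SimpleGraph.fromRel_adj]
        exact ⟨fun h => heq (congrArg Subtype.val h), Or.inl hLL'⟩
  have hadj : ∀ a b : V, G.Adj a b → |f a.1 - f b.1| ≤ M := by
    intro a b hab
    rw [SimpleGraph.fromRel_adj] at hab
    have ha := Finset.mem_filter.1 a.2
    have hb := Finset.mem_filter.1 b.2
    rcases hab.2 with h | h
    · exact hf _ ha.1 ha.2 _ h
    · rw [abs_sub_comm]; exact hf _ hb.1 hb.2 _ h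
  have hwalk : ∀ {a b : V} (w : G.Walk a b), |f a.1 - f b.1| ≤ w.length * M := by
    intro a b w
    induction w with
    | nil => simp
    | @cons a b c hab w ih =>
      have h1 := hadj a b hab
      have h2 := abs_sub_le (f a.1) (f b.1) (f c.1)
      rw [SimpleGraph.Walk.length_cons]
      push_cast
      linarith
  obtain ⟨h1, h2⟩ := T.mem_of_reach hK hx h
  obtain ⟨w⟩ := hreach h1 h2
  refine (hwalk w.toPath.1).trans ?_
  have h3 := w.toPath.2.length_lt
  have h4 : Fintype.card V = (T.elements.filter fun K => x ∈ K).card := Fintype.card_coe _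
  rw [h4] at h3
  have h5 : (w.toPath.1.length : ℝ) ≤ N :=
    le_trans (by exact_mod_cast h3.le) hN
  gcongr

theorem ConvexWeights.value_eq_zero {T : Mesh Ω} (c : ConvexWeights T) {v : WeakFun T} {x : E d}
    (hb : ∀ e : T.faces, IsBoundaryFace Ω e.1 → v.2 e x = 0) (hxv : x ∈ T.vertices)
    (hxf : x ∈ frontier Ω) : c.value v x = 0 := by
  rw [ConvexWeights.value]
  have h1 : ∑ K' : T.elements with x ∈ K'.1, c.elem x K' * v.1 K' x = 0 :=
    Finset.sum_eq_zero fun K' hK' => by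
      rw [c.elem_boundary x hxv hxf K' (Finset.mem_filter.1 hK').2, zero_mul]
  have h2 : ∑ e : T.faces with x ∈ e.1, c.face x e * v.2 e x = 0 :=
    Finset.sum_eq_zero fun e he => by
      by_cases hbe : IsBoundaryFace Ω e.1
      · rw [hb e hbe, mul_zero]
      · rw [c.face_boundary x hxv hxf e (Finset.mem_filter.1 he).2 hbe, zero_mul]
  rw [h1, h2, add_zero]

/-- The convex combination of the values at a vertex is close to the value on each element. -/
theorem Mesh.abs_sub_value_le (hd : 2 ≤ d) (c : ConvexWeights T) {x : E d} {K : Finset (E d)}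
    (hK : K ∈ T.elements) (hx : x ∈ K) (v : WeakFun T) {M N : ℝ}
    (hN : ((T.elements.filter fun K => x ∈ K).card : ℝ) ≤ N)
    (hM : ∀ (K : T.elements) (e : T.faces), x ∈ e.1 → e.1 ⊆ K.1 → |v.1 K x - v.2 e x| ≤ M)
    (hb : ∀ e : T.faces, IsBoundaryFace Ω e.1 → v.2 e x = 0) :
    |v.1 ⟨K, hK⟩ x - c.value v x| ≤ (2 * N + 1) * M := by
  have hxv : x ∈ T.vertices := Finset.mem_biUnion.2 ⟨K, hK, hx⟩
  have hM0 : 0 ≤ M := by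
    obtain ⟨a, ha, hax⟩ := (T.isSimplex hK).exists_ne (by omega) hx
    exact (abs_nonneg _).trans (hM ⟨K, hK⟩ ⟨_, T.erase_mem_faces hK ha⟩
      (Finset.mem_erase.2 ⟨hax.symm, hx⟩) (Finset.erase_subset _ _))
  let f : Finset (E d) → ℝ := fun K => if h : K ∈ T.elements then v.1 ⟨K, h⟩ x else 0
  have hfK : ∀ (K : Finset (E d)) (h : K ∈ T.elements), f K = v.1 ⟨K, h⟩ x := fun K h => dif_pos h
  -- Crossing one face compares both values with `v_b` on that face, so each step of the chain costs
  -- `2 M`.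
  have hreach : ∀ K', Relation.ReflTransGen (T.Adj x) K K' → |f K - f K'| ≤ 2 * N * M := by
    intro K' hK'
    have h1 := T.abs_sub_le_of_reach hK hx f (M := 2 * M) (by positivity) hN ?_ hK'
    · linarith
    · rintro L hL hxL L' ⟨hL', hxL', e, he, hxe, heL, heL', -⟩
      rw [hfK L hL, hfK L' hL']
      have h1 := hM ⟨L, hL⟩ ⟨e, he⟩ hxe heL
      have h2 := hM ⟨L', hL'⟩ ⟨e, he⟩ hxe heL'
      rw [abs_sub_comm] at h2
      have h3 := abs_sub_le (v.1 ⟨L, hL⟩ x) (v.2 ⟨e, he⟩ x) (v.1 ⟨L', hL'⟩ x)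
      linarith
  rw [← hfK K hK]
  by_cases hno : ∀ K', Relation.ReflTransGen (T.Adj x) K K' →
      ∀ e ∈ T.faces, x ∈ e → e ⊆ K' → ¬IsBoundaryFace Ω e
  -- Without boundary faces every element at `x` is reached, so all values entering the convex
  -- combination are close to the value on `K`.
  · have hU := T.reach_mem_nhds hd hK hx hno
    have hel : ∀ K' : T.elements, x ∈ K'.1 → |f K - v.1 K' x| ≤ (2 * N + 1) * M := by
      intro K' hx'
      have h1 := hreach K' (T.reach_of_mem_nhds hU K'.2 hx')
      rw [hfK K'.1 K'.2] at h1
      linarith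
    have hfa : ∀ e : T.faces, x ∈ e.1 → |f K - v.2 e x| ≤ (2 * N + 1) * M := by
      intro e he
      obtain ⟨L, hL, a, ha, hea⟩ := T.exists_erase_of_mem_faces e.2
      have heL : e.1 ⊆ L := by rw [hea]; exact Finset.erase_subset _ _
      have h1 := hreach L (T.reach_of_mem_nhds hU hL (heL he))
      rw [hfK L hL] at h1
      have h2 := hM ⟨L, hL⟩ e he heL
      have h3 := abs_sub_le (f K) (v.1 ⟨L, hL⟩ x) (v.2 e x)
      linarith
    have h1 : f K - c.value v x = ∑ K' : T.elements with x ∈ K'.1, c.elem x K' * (f K - v.1 K' x) +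
        ∑ e : T.faces with x ∈ e.1, c.face x e * (f K - v.2 e x) := by
      have h2 := c.sum_eq_one x hxv
      simp only [mul_sub, Finset.sum_sub_distrib, ← Finset.sum_mul]
      rw [ConvexWeights.value]
      linear_combination (-f K) * h2
    rw [h1]
    refine (abs_add_le _ _).trans ?_
    have h2 : |∑ K' : T.elements with x ∈ K'.1, c.elem x K' * (f K - v.1 K' x)| ≤
        ∑ K' : T.elements with x ∈ K'.1, c.elem x K' * ((2 * N + 1) * M) := by
      refine (Finset.abs_sum_le_sum_abs _ _).trans (Finset.sum_le_sum fun K' hK' => ?_)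
      have hx' := (Finset.mem_filter.1 hK').2
      have h0 := c.elem_nonneg x hxv K' hx'
      rw [abs_mul, abs_of_nonneg h0]
      exact mul_le_mul_of_nonneg_left (hel K' hx') h0
    have h3 : |∑ e : T.faces with x ∈ e.1, c.face x e * (f K - v.2 e x)| ≤
        ∑ e : T.faces with x ∈ e.1, c.face x e * ((2 * N + 1) * M) := by
      refine (Finset.abs_sum_le_sum_abs _ _).trans (Finset.sum_le_sum fun e he => ?_)
      have hx' := (Finset.mem_filter.1 he).2
      have h0 := c.face_nonneg x hxv e hx'
      rw [abs_mul, abs_of_nonneg h0]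
      exact mul_le_mul_of_nonneg_left (hfa e hx') h0
    refine (add_le_add h2 h3).trans_eq ?_
    rw [← Finset.sum_mul, ← Finset.sum_mul, ← add_mul, c.sum_eq_one x hxv, one_mul]
  -- A boundary face is reached: `v_b` vanishes on it and `c.value v x` is 0 too, so it suffices to
  -- bound the value on `K` itself. Elements at `x` that are not reached play no role.
  · push Not at hno
    obtain ⟨L, hL, e, he, hxe, heL, hbd⟩ := hno
    have hxf : x ∈ frontier Ω := hbd (vertex_mem hxe)
    have hval : c.value v x = 0 := c.value_eq_zero hb hxv hxf
    rw [hval, sub_zero]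
    have h1 := hreach L hL
    obtain ⟨hLT, -⟩ := T.mem_of_reach hK hx hL
    have h2 := hM ⟨L, hLT⟩ ⟨e, he⟩ hxe heL
    rw [hb _ hbd, sub_zero, ← hfK] at h2
    have h3 := abs_sub_le (f K) (f L) 0
    rw [sub_zero, sub_zero] at h3
    linarith

end WG

namespace WG

open scoped Classical Topology

/-! ### Existence of the operator `P` -/

variable {d : ℕ} {Ω : Set (E d)}

/-- Well-definedness of the nodal interpolant where elements meet: only common vertices have nonzero
weight, and their weights agree. -/
theorem Mesh.sum_lam_mul_eq (T : Mesh Ω) {K K' : Finset (E d)} (hK : K ∈ T.elements)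
    (hK' : K' ∈ T.elements) {x : E d} (hx : x ∈ convexHull ℝ (K : Set (E d)))
    (hx' : x ∈ convexHull ℝ (K' : Set (E d))) (φ : E d → ℝ) :
    ∑ a ∈ K, lam K a x * φ a = ∑ a ∈ K', lam K' a x * φ a := by
  have key : ∀ {K K' : Finset (E d)}, K ∈ T.elements → K' ∈ T.elements →
      x ∈ convexHull ℝ (K : Set (E d)) → x ∈ convexHull ℝ (K' : Set (E d)) →
      ∑ a ∈ K ∩ K', lam K a x * φ a = ∑ a ∈ K, lam K a x * φ a := by
    intro K K' hK hK' hx hx'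
    refine Finset.sum_subset Finset.inter_subset_left fun a ha hna => ?_
    have h0 := (T.isSimplex hK).mem_convexHull_iff.1 hx a ha
    rcases h0.eq_or_lt with h | h
    · rw [← h, zero_mul]
    · exact absurd (Finset.mem_inter.2 ⟨ha, T.mem_of_lam_pos hK hK' hx hx' ha h⟩) hna
  rw [← key hK hK' hx hx', ← key hK' hK hx' hx, Finset.inter_comm K' K]
  refine Finset.sum_congr rfl fun a ha => ?_
  obtain ⟨h1, h2⟩ := Finset.mem_inter.1 ha
  rw [T.lam_eq hK hK' hx hx' h1 h2]

/-- The piecewise linear interpolant of nodal values, extended by zero. -/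
noncomputable def Mesh.interp (T : Mesh Ω) (φ : E d → ℝ) (x : E d) : ℝ :=
  if h : ∃ K ∈ T.elements, x ∈ convexHull ℝ (K : Set (E d)) then
    ∑ a ∈ h.choose, lam h.choose a x * φ a else 0

theorem Mesh.interp_eq (T : Mesh Ω) (φ : E d → ℝ) {K : Finset (E d)} (hK : K ∈ T.elements)
    {x : E d} (hx : x ∈ convexHull ℝ (K : Set (E d))) :
    T.interp φ x = ∑ a ∈ K, lam K a x * φ a := by
  have h : ∃ K ∈ T.elements, x ∈ convexHull ℝ (K : Set (E d)) := ⟨K, hK, hx⟩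
  rw [Mesh.interp, dif_pos h]
  exact T.sum_lam_mul_eq h.choose_spec.1 hK h.choose_spec.2 hx φ

theorem Mesh.interp_vertex (T : Mesh Ω) (φ : E d → ℝ) {x : E d} (hx : x ∈ T.vertices) :
    T.interp φ x = φ x := by
  obtain ⟨K, hK, hxK⟩ := Finset.mem_biUnion.1 hx
  change x ∈ K at hxK
  have hs := T.isSimplex hK
  rw [T.interp_eq φ hK (vertex_mem hxK), Finset.sum_eq_single x, hs.lam_self hxK, one_mul]
  · intro b hb hbx
    rw [hs.lam_of_ne hb hxK hbx, zero_mul]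
  · exact fun h => absurd hxK h

/-- A frontier point lies on a face contained in the frontier, whose vertices carry all the weight
and have nodal value zero. -/
theorem Mesh.interp_eq_zero (T : Mesh Ω) (hΩ : IsOpen Ω) {φ : E d → ℝ}
    (hφ : ∀ x ∈ T.vertices, x ∈ frontier Ω → φ x = 0) {x : E d} (hx : x ∉ Ω) :
    T.interp φ x = 0 := by
  by_cases hxc : x ∈ closure Ω
  · have hxf : x ∈ frontier Ω := ⟨hxc, by rwa [hΩ.interior_eq]⟩
    obtain ⟨K, hK, e, he, hxe, heb⟩ := T.frontier_subset x hxf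
    have heK := (Finset.mem_powersetCard.1 he).1
    have hs := T.isSimplex hK
    rw [T.interp_eq φ hK (face_subset heK hxe)]
    refine Finset.sum_eq_zero fun a ha => ?_
    by_cases hae : a ∈ e
    · rw [hφ a (Finset.mem_biUnion.2 ⟨K, hK, ha⟩) (heb (vertex_mem hae)), mul_zero]
    · rw [((hs.mem_convexHull_face_iff heK).1 hxe).2 a ha hae, zero_mul]
  · rw [Mesh.interp, dif_neg]
    rintro ⟨K, hK, hxK⟩
    exact hxc (T.elem_subset_closure hK hxK)

theorem Mesh.interp_mem (T : Mesh Ω) (hΩ : IsOpen Ω) {φ : E d → ℝ}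
    (hφ : ∀ x ∈ T.vertices, x ∈ frontier Ω → φ x = 0) : T.interp φ ∈ confVh T := by
  have hpoly : ∀ K : Finset (E d), (fun x => ∑ a ∈ K, lam K a x * φ a) ∈ polySpace d 1 :=
    fun K => sum_fun_mem_polySpace _ fun a _ => mul_const_mem_polySpace (lam_mem_polySpace K a) _
  refine ⟨?_, fun K hK => ⟨_, hpoly K, fun x hx => T.interp_eq φ hK hx⟩,
    fun x hx => T.interp_eq_zero hΩ hφ hx⟩
  -- The elements together with the complement of `Ω` form a finite closed cover, on each member of
  -- which the interpolant is continuous.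
  let F : Option T.elements → Set (E d) := fun o =>
    o.elim Ωᶜ fun K => convexHull ℝ (K.1 : Set (E d))
  refine LocallyFinite.continuous (f := F) (locallyFinite_of_finite F) ?_ ?_ ?_
  · refine eq_univ_of_forall fun x => ?_
    by_cases hx : x ∈ Ω
    · have h1 := subset_closure hx
      rw [T.closure_eq] at h1
      obtain ⟨K, hK, hxK⟩ := mem_iUnion₂.1 h1
      exact mem_iUnion.2 ⟨some ⟨K, hK⟩, hxK⟩
    · exact mem_iUnion.2 ⟨none, hx⟩
  · rintro (_ | K)
    · exact hΩ.isClosed_compl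
    · exact isClosed_face K.1
  · rintro (_ | K)
    · exact (continuousOn_const (c := (0 : ℝ))).congr fun x hx => T.interp_eq_zero hΩ hφ hx
    · exact (continuous_of_mem_polySpace (hpoly K.1)).continuousOn.congr
        fun x hx => T.interp_eq φ K.2 hx

theorem ConvexWeights.value_add {T : Mesh Ω} (c : ConvexWeights T) (u v : WeakFun T) (x : E d) :
    c.value (u + v) x = c.value u x + c.value v x := by
  simp only [ConvexWeights.value, Prod.fst_add, Prod.snd_add, Pi.add_apply, mul_add,
    Finset.sum_add_distrib]
  ring

theorem ConvexWeights.value_smul {T : Mesh Ω} (c : ConvexWeights T) (t : ℝ) (v : WeakFun T)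
    (x : E d) : c.value (t • v) x = t * c.value v x := by
  simp only [ConvexWeights.value, Prod.smul_fst, Prod.smul_snd, Pi.smul_apply, smul_eq_mul,
    mul_add, Finset.mul_sum, mul_left_comm]

/-- The nodal interpolant witnesses the existence required by the `Classical.epsilon` in the
definition. -/
theorem opP_spec (hΩ : IsOpen Ω) {T : Mesh Ω} (pr : Pair) (j : ℕ) (c : ConvexWeights T)
    (v : Vh T pr j) {x : E d} (hx : x ∈ T.vertices) :
    (opP pr j c v : E d → ℝ) x = c.value (v : WeakFun T) x := by
  have hmem : ∀ v : Vh T pr j, T.interp (c.value (v : WeakFun T)) ∈ confVh T := fun v =>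
    T.interp_mem hΩ fun x hxv hxf => c.value_eq_zero (fun e he => by rw [v.2.2.2 e he]; rfl) hxv hxf
  have hex : ∃ P : Vh T pr j →ₗ[ℝ] confVh T, ∀ v : Vh T pr j, ∀ x ∈ T.vertices,
      (P v : E d → ℝ) x = c.value (v : WeakFun T) x := by
    refine ⟨{ toFun := fun v => ⟨T.interp (c.value (v : WeakFun T)), hmem v⟩
              map_add' := fun u v => ?_
              map_smul' := fun t v => ?_ }, fun v x hx => T.interp_vertex _ hx⟩
    · ext x
      simp only [Submodule.coe_add, Pi.add_apply, Mesh.interp]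
      split_ifs with h
      · simp only [c.value_add, mul_add, Finset.sum_add_distrib]
      · rw [add_zero]
    · ext x
      simp only [Submodule.coe_smul, Pi.smul_apply, Mesh.interp, RingHom.id_apply, smul_eq_mul]
      split_ifs with h
      · simp only [c.value_smul, Finset.mul_sum, mul_left_comm]
      · rw [mul_zero]
  exact Classical.epsilon_spec hex v x hx

/-! ### Riesz representation on finite-dimensional spaces -/

/-- A definite form on a finite-dimensional space identifies the space with its dual. The parameter
space `W` makes the representative linear in the data, so operators are obtained at once. -/
theorem exists_riesz {V W : Type*} [AddCommGroup V] [Module ℝ V] [Module.Finite ℝ V]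
    [AddCommGroup W] [Module ℝ W] (B : V →ₗ[ℝ] V →ₗ[ℝ] ℝ) (hB : ∀ v, B v v = 0 → v = 0)
    (F : W →ₗ[ℝ] V →ₗ[ℝ] ℝ) : ∃ L : W →ₗ[ℝ] V, ∀ w q, B (L w) q = F w q := by
  have hinj : Function.Injective B := by
    rw [injective_iff_map_eq_zero]
    intro v hv
    exact hB v (by rw [hv]; rfl)
  let e : V ≃ₗ[ℝ] (V →ₗ[ℝ] ℝ) := LinearEquiv.ofInjectiveOfFinrankEq B hinj
    (Subspace.dual_finrank_eq (K := ℝ) (V := V)).symm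
  refine ⟨e.symm.toLinearMap.comp F, fun w q => ?_⟩
  have h1 : e (e.symm (F w)) = F w := e.apply_symm_apply _
  have h2 : ∀ v, e v = B v := fun v => rfl
  rw [h2] at h1
  simp only [LinearMap.comp_apply, LinearEquiv.coe_coe]
  rw [h1]

end WG

namespace WG

open scoped Classical Topology

/-! ### Existence of the weak gradient -/

variable {d : ℕ} {Ω : Set (E d)}

theorem mem_facePoly {e : Finset (E d)} {l : ℕ} {f : E d → ℝ} :
    f ∈ facePoly e l ↔ ∃ p ∈ polySpace d l, (convexHull ℝ (e : Set (E d))).indicator p = f :=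
  Iff.rfl

theorem continuousOn_of_mem_facePoly {e : Finset (E d)} {l : ℕ} {f : E d → ℝ}
    (hf : f ∈ facePoly e l) : ContinuousOn f (convexHull ℝ (e : Set (E d))) := by
  obtain ⟨p, hp, rfl⟩ := mem_facePoly.1 hf
  exact (continuous_of_mem_polySpace hp).continuousOn.congr fun x hx => indicator_of_mem hx _

theorem integrableOn_elem_of_continuousOn {K : Finset (E d)} {f : E d → ℝ}
    (hf : ContinuousOn f (convexHull ℝ (K : Set (E d)))) :
    IntegrableOn f (convexHull ℝ (K : Set (E d))) :=
  hf.integrableOn_compact (isCompact_face K)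

theorem Mesh.integrableOn_face (T : Mesh Ω) (hd : 1 ≤ d) {e : Finset (E d)} (he : e ∈ T.faces)
    {f : E d → ℝ} (hf : ContinuousOn f (convexHull ℝ (e : Set (E d)))) :
    IntegrableOn f (convexHull ℝ (e : Set (E d))) μHE[d - 1] := by
  obtain ⟨K, hK, a, ha, hea⟩ := T.exists_erase_of_mem_faces he
  -- Integrability of the constant 1 yields that the face has finite surface measure.
  have h1 := (T.isSimplex hK).integrableOn_face hd ha (continuous_const (y := (1 : ℝ)))
  rw [← hea, integrableOn_const_iff] at h1
  have h2 : μHE[d - 1] (convexHull ℝ (e : Set (E d))) ≠ ⊤ := by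
    rcases h1 with h1 | h1
    · exact absurd h1 (by simp)
    · exact h1.ne
  obtain ⟨C, hC⟩ := (isCompact_face e).exists_bound_of_continuousOn hf
  haveI : IsFiniteMeasure (μHE[d - 1].restrict (convexHull ℝ (e : Set (E d)))) :=
    ⟨by rw [Measure.restrict_apply_univ]; exact h2.lt_top⟩
  exact Integrable.of_bound (hf.aestronglyMeasurable (isClosed_face e).measurableSet) C
    (ae_restrict_of_forall_mem (isClosed_face e).measurableSet hC)

theorem intElem_add {K : Finset (E d)} {f g : E d → ℝ}
    (hf : ContinuousOn f (convexHull ℝ (K : Set (E d))))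
    (hg : ContinuousOn g (convexHull ℝ (K : Set (E d)))) :
    intElem K (fun x => f x + g x) = intElem K f + intElem K g :=
  integral_add (integrableOn_elem_of_continuousOn hf) (integrableOn_elem_of_continuousOn hg)

theorem Mesh.intFace_add (T : Mesh Ω) (hd : 1 ≤ d) {e : Finset (E d)} (he : e ∈ T.faces)
    {f g : E d → ℝ} (hf : ContinuousOn f (convexHull ℝ (e : Set (E d))))
    (hg : ContinuousOn g (convexHull ℝ (e : Set (E d)))) :
    intFace e (fun x => f x + g x) = intFace e f + intFace e g :=
  integral_add (T.integrableOn_face hd he hf) (T.integrableOn_face hd he hg)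

theorem intElem_const_mul (K : Finset (E d)) (t : ℝ) (f : E d → ℝ) :
    intElem K (fun x => t * f x) = t * intElem K f := integral_const_mul t f

theorem intFace_const_mul (e : Finset (E d)) (t : ℝ) (f : E d → ℝ) :
    intFace e (fun x => t * f x) = t * intFace e f := integral_const_mul t f

theorem sumFaces_add (T : Mesh Ω) (K : T.elements) (F G : T.faces → ℝ) :
    sumFaces T K (fun e => F e + G e) = sumFaces T K F + sumFaces T K G := Finset.sum_add_distrib

theorem sumFaces_const_mul (T : Mesh Ω) (K : T.elements) (t : ℝ) (F : T.faces → ℝ) :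
    sumFaces T K (fun e => t * F e) = t * sumFaces T K F := (Finset.mul_sum _ _ _).symm

theorem differentiable_of_mem_vecPoly {k : ℕ} {q : E d → E d} (hq : q ∈ vecPoly d k) (i : Fin d) :
    Differentiable ℝ fun x => q x i := differentiable_of_mem_polySpace (hq i)

theorem divergence_add {k : ℕ} {p q : E d → E d} (hp : p ∈ vecPoly d k) (hq : q ∈ vecPoly d k)
    (x : E d) : divergence (p + q) x = divergence p x + divergence q x := by
  simp only [divergence, ← Finset.sum_add_distrib]
  refine Finset.sum_congr rfl fun i _ => ?_
  have h := fderiv_fun_add (differentiable_of_mem_vecPoly hp i x)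
    (differentiable_of_mem_vecPoly hq i x)
  simp only [Pi.add_apply, PiLp.add_apply]
  rw [h]
  rfl

theorem divergence_smul {k : ℕ} (t : ℝ) {q : E d → E d} (hq : q ∈ vecPoly d k)
    (x : E d) : divergence (t • q) x = t * divergence q x := by
  simp only [divergence, Finset.mul_sum]
  refine Finset.sum_congr rfl fun i _ => ?_
  have h := fderiv_fun_const_smul (differentiable_of_mem_vecPoly hq i x) t
  simp only [Pi.smul_apply, PiLp.smul_apply]
  rw [h]
  rfl

instance (d k : ℕ) : Module.Finite ℝ (vecPoly d k) := by
  let f : vecPoly d k →ₗ[ℝ] (Fin d → polySpace d k) :=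
    { toFun := fun q i => ⟨fun x => (q : E d → E d) x i, q.2 i⟩
      map_add' := fun p q => rfl
      map_smul' := fun t q => rfl }
  refine Module.Finite.of_injective f fun p q hpq => ?_
  ext x i
  exact congrFun (congrArg Subtype.val (congrFun hpq i)) x

instance (pr : Pair) (d j : ℕ) : Module.Finite ℝ (pr.gradSpace d j) :=
  Module.Finite.of_injective (Submodule.inclusion (gradSpace_le pr j))
    (Submodule.inclusion_injective _)

theorem IsSimplex.eq_zero_of_intElem_sq {K : Finset (E d)} (hK : IsSimplex K) {k : ℕ} {p : E d → ℝ}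
    (hp : p ∈ polySpace d k) (h : intElem K (fun x => p x ^ 2) ≤ 0) : p = 0 :=
  eq_zero_of_setIntegral_sq_eq_zero hp isOpen_interior hK.interior_nonempty interior_subset
    hK.isBounded h

theorem IsSimplex.eq_zero_of_intElem_norm_sq {K : Finset (E d)} (hK : IsSimplex K) {k : ℕ}
    {q : E d → E d} (hq : q ∈ vecPoly d k) (h : intElem K (fun x => ‖q x‖ ^ 2) ≤ 0) : q = 0 := by
  have hc := continuous_of_mem_vecPoly hq
  funext x
  ext i
  have h1 : (fun x => q x i) = 0 := by
    refine hK.eq_zero_of_intElem_sq (hq i) (le_trans ?_ h)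
    refine integral_mono (hK.integrableOn_elem (by fun_prop)) (hK.integrableOn_elem (by fun_prop))
      fun x => ?_
    change q x i ^ 2 ≤ ‖q x‖ ^ 2
    rw [← sq_abs]
    have := PiLp.norm_apply_le (q x) i
    rw [Real.norm_eq_abs] at this
    gcongr
  exact congrFun h1 x

/-- The `L²` inner product of polynomial vector fields on a simplex. -/
noncomputable def IsSimplex.gradForm {K : Finset (E d)} (hK : IsSimplex K) (pr : Pair) (j : ℕ) :
    pr.gradSpace d j →ₗ[ℝ] pr.gradSpace d j →ₗ[ℝ] ℝ :=
  LinearMap.mk₂ ℝ (fun p q => intElem K fun x => inner ℝ ((p : E d → E d) x) ((q : E d → E d) x))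
    (fun p p' q => by
      have h1 := continuous_of_mem_gradSpace p.2
      have h2 := continuous_of_mem_gradSpace p'.2
      have h3 := continuous_of_mem_gradSpace q.2
      simp only [Submodule.coe_add, Pi.add_apply, inner_add_left]
      exact intElem_add (by fun_prop) (by fun_prop))
    (fun c p q => by
      simp only [Submodule.coe_smul, Pi.smul_apply, real_inner_smul_left, smul_eq_mul]
      exact intElem_const_mul K c _)
    (fun p q q' => by
      have h1 := continuous_of_mem_gradSpace p.2
      have h2 := continuous_of_mem_gradSpace q.2
      have h3 := continuous_of_mem_gradSpace q'.2
      simp only [Submodule.coe_add, Pi.add_apply, inner_add_right]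
      exact intElem_add (by fun_prop) (by fun_prop))
    (fun c p q => by
      simp only [Submodule.coe_smul, Pi.smul_apply, real_inner_smul_right, smul_eq_mul]
      exact intElem_const_mul K c _)

theorem IsSimplex.gradForm_apply {K : Finset (E d)} (hK : IsSimplex K) (pr : Pair) (j : ℕ)
    (p q : pr.gradSpace d j) : hK.gradForm pr j p q =
      intElem K fun x => inner ℝ ((p : E d → E d) x) ((q : E d → E d) x) := rfl

theorem IsSimplex.gradForm_definite {K : Finset (E d)} (hK : IsSimplex K) (pr : Pair) (j : ℕ)
    (p : pr.gradSpace d j) (h : hK.gradForm pr j p p = 0) : p = 0 := by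
  rw [hK.gradForm_apply] at h
  simp only [real_inner_self_eq_norm_sq] at h
  exact Subtype.ext (hK.eq_zero_of_intElem_norm_sq (gradSpace_le pr j p.2) h.le)

/-- The right-hand side of the definition of the weak gradient. -/
noncomputable def gradRhs (T : Mesh Ω) (hd : 1 ≤ d) (pr : Pair) (j : ℕ) (K : T.elements) :
    Vh T pr j →ₗ[ℝ] pr.gradSpace d j →ₗ[ℝ] ℝ :=
  LinearMap.mk₂ ℝ (fun v q =>
      -intElem K.1 (fun x => (v : WeakFun T).1 K x * divergence (q : E d → E d) x) +
        sumFaces T K fun e => intFace e.1 fun x =>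
          (v : WeakFun T).2 e x * inner ℝ ((q : E d → E d) x) (outwardNormal K.1 e.1))
    (fun u v q => by
      have h1 := continuous_of_mem_polySpace (u.2.1 K)
      have h2 := continuous_of_mem_polySpace (v.2.1 K)
      have h3 := continuous_of_mem_gradSpace q.2
      have h4 := continuous_of_mem_polySpace (divergence_mem_polySpace (gradSpace_le pr j q.2))
      have h5 := fun e => continuousOn_of_mem_facePoly (u.2.2.1 e)
      have h6 := fun e => continuousOn_of_mem_facePoly (v.2.2.1 e)
      simp only [Submodule.coe_add, Prod.fst_add, Prod.snd_add, Pi.add_apply, add_mul]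
      rw [intElem_add (by fun_prop) (by fun_prop)]
      have h7 : ∀ e : T.faces, (intFace e.1 fun x =>
          (u : WeakFun T).2 e x * inner ℝ ((q : E d → E d) x) (outwardNormal K.1 e.1) +
          (v : WeakFun T).2 e x * inner ℝ ((q : E d → E d) x) (outwardNormal K.1 e.1)) = _ :=
        fun e => T.intFace_add hd e.2 ((h5 e).mul (by fun_prop)) ((h6 e).mul (by fun_prop))
      simp only [h7, sumFaces_add]
      ring)
    (fun c v q => by
      simp only [Submodule.coe_smul, Prod.smul_fst, Prod.smul_snd, Pi.smul_apply, smul_eq_mul,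
        mul_assoc, intElem_const_mul, intFace_const_mul, sumFaces_const_mul]
      ring)
    (fun v p q => by
      have h1 := continuous_of_mem_polySpace (v.2.1 K)
      have h2 := continuous_of_mem_gradSpace p.2
      have h3 := continuous_of_mem_gradSpace q.2
      have h4 := continuous_of_mem_polySpace (divergence_mem_polySpace (gradSpace_le pr j p.2))
      have h4' := continuous_of_mem_polySpace (divergence_mem_polySpace (gradSpace_le pr j q.2))
      have h5 := fun e => continuousOn_of_mem_facePoly (v.2.2.1 e)
      simp only [Submodule.coe_add, Pi.add_apply, inner_add_left, mul_add,
        divergence_add (gradSpace_le pr j p.2) (gradSpace_le pr j q.2)]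
      rw [intElem_add (by fun_prop) (by fun_prop)]
      have h7 : ∀ e : T.faces, (intFace e.1 fun x =>
          (v : WeakFun T).2 e x * inner ℝ ((p : E d → E d) x) (outwardNormal K.1 e.1) +
          (v : WeakFun T).2 e x * inner ℝ ((q : E d → E d) x) (outwardNormal K.1 e.1)) = _ :=
        fun e => T.intFace_add hd e.2 ((h5 e).mul (by fun_prop)) ((h5 e).mul (by fun_prop))
      simp only [h7, sumFaces_add]
      ring)
    (fun c v q => by
      simp only [Submodule.coe_smul, Pi.smul_apply, real_inner_smul_left, mul_left_comm _ c,
        divergence_smul c (gradSpace_le pr j q.2), intElem_const_mul, intFace_const_mul,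
        sumFaces_const_mul, smul_eq_mul]
      ring)

/-- Existence in a form linear in `v`; with uniqueness it makes the chosen `weakGrad` additive and
homogeneous. -/
theorem exists_weakGradLin (T : Mesh Ω) (hd : 1 ≤ d) (pr : Pair) (j : ℕ) (K : T.elements) :
    ∃ L : Vh T pr j →ₗ[ℝ] pr.gradSpace d j,
      ∀ v : Vh T pr j, IsWeakGrad pr j (v : WeakFun T) K (L v) := by
  obtain ⟨L, hL⟩ := exists_riesz ((T.isSimplex K.2).gradForm pr j)
    ((T.isSimplex K.2).gradForm_definite pr j) (gradRhs T hd pr j K)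
  exact ⟨L, fun v => ⟨(L v).2, fun q hq => hL v ⟨q, hq⟩⟩⟩

theorem IsWeakGrad.unique {T : Mesh Ω} {pr : Pair} {j : ℕ} {v : WeakFun T} {K : T.elements}
    {g g' : E d → E d} (hg : IsWeakGrad pr j v K g) (hg' : IsWeakGrad pr j v K g') : g = g' := by
  have hs := T.isSimplex K.2
  have key : ∀ p p' : pr.gradSpace d j, (∀ q, hs.gradForm pr j p q = hs.gradForm pr j p' q) →
      p = p' := fun p p' h => sub_eq_zero.1 (hs.gradForm_definite pr j _ (by
    rw [LinearMap.map_sub₂, h, sub_self]))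
  exact congrArg Subtype.val (key ⟨g, hg.1⟩ ⟨g', hg'.1⟩ fun q =>
    (hg.2 q q.2).trans (hg'.2 q q.2).symm)

theorem isWeakGrad_weakGrad {T : Mesh Ω} (hd : 1 ≤ d) {pr : Pair} {j : ℕ} (v : Vh T pr j)
    (K : T.elements) : IsWeakGrad pr j (v : WeakFun T) K (weakGrad pr j (v : WeakFun T) K) := by
  obtain ⟨L, hL⟩ := exists_weakGradLin T hd pr j K
  exact Classical.epsilon_spec ⟨_, hL v⟩

theorem weakGrad_add {T : Mesh Ω} (hd : 1 ≤ d) {pr : Pair} {j : ℕ} (u v : Vh T pr j)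
    (K : T.elements) : weakGrad pr j ((u + v : Vh T pr j) : WeakFun T) K =
      weakGrad pr j (u : WeakFun T) K + weakGrad pr j (v : WeakFun T) K := by
  obtain ⟨L, hL⟩ := exists_weakGradLin T hd pr j K
  rw [(isWeakGrad_weakGrad hd u K).unique (hL u), (isWeakGrad_weakGrad hd v K).unique (hL v),
    (isWeakGrad_weakGrad hd (u + v) K).unique (hL (u + v)), map_add]
  rfl

theorem weakGrad_smul {T : Mesh Ω} (hd : 1 ≤ d) {pr : Pair} {j : ℕ} (t : ℝ) (v : Vh T pr j)
    (K : T.elements) : weakGrad pr j ((t • v : Vh T pr j) : WeakFun T) K =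
      t • weakGrad pr j (v : WeakFun T) K := by
  obtain ⟨L, hL⟩ := exists_weakGradLin T hd pr j K
  rw [(isWeakGrad_weakGrad hd v K).unique (hL v),
    (isWeakGrad_weakGrad hd (t • v) K).unique (hL (t • v)), map_smul]
  rfl

end WG

namespace WG

open scoped Classical Topology

/-! ### The discrete inner product -/

variable {d : ℕ} {Ω : Set (E d)}

/-- Any single simplex has some shape constants at scale 1, so quantitative inequalities can be
quoted to prove qualitative definiteness. -/
theorem IsSimplex.exists_hasShape {K : Finset (E d)} (hK : IsSimplex K) :
    ∃ r R, HasShape r R 1 K := by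
  obtain ⟨z, hz⟩ := hK.interior_nonempty
  obtain ⟨r, hr, hball⟩ := Metric.mem_nhds_iff.1 (mem_interior_iff_mem_nhds.1 hz)
  obtain ⟨R, hR⟩ := Metric.isBounded_iff.1 hK.isBounded
  refine ⟨r, R, hK, one_pos, hr, ⟨z, by rwa [mul_one]⟩, fun x hx y hy => ?_⟩
  rw [mul_one, ← dist_eq_norm]
  exact hR hx hy

theorem IsSimplex.eq_zero_of_intFace_sq {K : Finset (E d)} (hK : IsSimplex K) (hd : 1 ≤ d)
    {a : E d} (ha : a ∈ K) {k : ℕ} {p : E d → ℝ} (hp : p ∈ polySpace d k)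
    (h : intFace (K.erase a) (fun x => p x ^ 2) = 0) {x : E d}
    (hx : x ∈ convexHull ℝ ((K.erase a : Finset (E d)) : Set (E d))) : p x = 0 := by
  obtain ⟨r, R, hS⟩ := hK.exists_hasShape
  obtain ⟨C, hC, H⟩ := exists_face_inverse d k hd R 0 hS.r_pos
  have h1 := H K 1 hS a ha p hp x ((hK.mem_face_erase_iff ha).1 hx).2 x hx (by simp)
  rw [h, mul_zero, mul_zero] at h1
  exact pow_eq_zero_iff two_ne_zero |>.1 (le_antisymm h1 (sq_nonneg _))

theorem Mesh.eq_zero_of_intFace_sq (T : Mesh Ω) (hd : 1 ≤ d) {e : Finset (E d)} (he : e ∈ T.faces)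
    {l : ℕ} {f : E d → ℝ} (hf : f ∈ facePoly e l) (h : intFace e (fun x => f x ^ 2) = 0) :
    f = 0 := by
  obtain ⟨K, hK, a, ha, rfl⟩ := T.exists_erase_of_mem_faces he
  obtain ⟨p, hp, rfl⟩ := mem_facePoly.1 hf
  have h1 : intFace (K.erase a) (fun x => p x ^ 2) = 0 := by
    rw [← h]
    refine setIntegral_congr_fun (isClosed_face _).measurableSet fun x hx => ?_
    simp only [indicator_of_mem hx]
  funext x
  by_cases hx : x ∈ convexHull ℝ ((K.erase a : Finset (E d)) : Set (E d))
  · rw [indicator_of_mem hx, (T.isSimplex hK).eq_zero_of_intFace_sq hd ha hp h1 hx]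
    rfl
  · rw [indicator_of_notMem hx]
    rfl

instance (e : Finset (E d)) (l : ℕ) : Module.Finite ℝ (facePoly e l) := by
  unfold facePoly
  infer_instance

instance (T : Mesh Ω) (pr : Pair) (j : ℕ) : Module.Finite ℝ (Vh T pr j) := by
  let f : Vh T pr j →ₗ[ℝ] (T.elements → polySpace d j) ×
      ((e : T.faces) → facePoly e.1 (pr.faceDeg j)) :=
    { toFun := fun v => (fun K => ⟨(v : WeakFun T).1 K, v.2.1 K⟩,
        fun e => ⟨(v : WeakFun T).2 e, v.2.2.1 e⟩)
      map_add' := fun p q => rfl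
      map_smul' := fun t q => rfl }
  refine Module.Finite.of_injective f fun u v huv => Subtype.ext (Prod.ext ?_ ?_)
  · funext K
    exact congrArg Subtype.val (congrFun (congrArg Prod.fst huv) K)
  · funext e
    exact congrArg Subtype.val (congrFun (congrArg Prod.snd huv) e)

theorem innerH_comm {T : Mesh Ω} (h : ℝ) (u v : WeakFun T) : innerH h u v = innerH h v u := by
  simp only [innerH, mul_comm]

theorem innerH_self {T : Mesh Ω} (h : ℝ) (v : WeakFun T) : innerH h v v = normSq0h h v := by
  simp only [innerH, normSq0h, sq]

theorem innerH_smul_left {T : Mesh Ω} (h t : ℝ) (u v : WeakFun T) :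
    innerH h (t • u) v = t * innerH h u v := by
  simp only [innerH, Prod.smul_fst, Prod.smul_snd, Pi.smul_apply, smul_eq_mul, ← mul_sub,
    mul_assoc, intElem_const_mul, intFace_const_mul, sumFaces_const_mul, Finset.mul_sum]
  refine Finset.sum_congr rfl fun K _ => ?_
  ring

theorem innerH_add_left {T : Mesh Ω} (hd : 1 ≤ d) (h : ℝ) {pr : Pair} {j : ℕ}
    (u v w : Vh T pr j) : innerH h ((u + v : Vh T pr j) : WeakFun T) (w : WeakFun T) =
      innerH h (u : WeakFun T) (w : WeakFun T) + innerH h (v : WeakFun T) (w : WeakFun T) := by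
  simp only [innerH, ← Finset.sum_add_distrib]
  refine Finset.sum_congr rfl fun K _ => ?_
  have h1 := continuous_of_mem_polySpace (u.2.1 K)
  have h2 := continuous_of_mem_polySpace (v.2.1 K)
  have h3 := continuous_of_mem_polySpace (w.2.1 K)
  have h4 := fun e => continuousOn_of_mem_facePoly (u.2.2.1 e)
  have h5 := fun e => continuousOn_of_mem_facePoly (v.2.2.1 e)
  have h6 := fun e => continuousOn_of_mem_facePoly (w.2.2.1 e)
  simp only [Submodule.coe_add, Prod.fst_add, Prod.snd_add, Pi.add_apply, add_mul,
    add_sub_add_comm]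
  rw [intElem_add (by fun_prop) (by fun_prop)]
  have h7 : ∀ e : T.faces, intFace e.1 (fun x =>
      ((u : WeakFun T).1 K x - (u : WeakFun T).2 e x) *
        ((w : WeakFun T).1 K x - (w : WeakFun T).2 e x) +
      ((v : WeakFun T).1 K x - (v : WeakFun T).2 e x) *
        ((w : WeakFun T).1 K x - (w : WeakFun T).2 e x)) = _ :=
    fun e => T.intFace_add hd e.2
      ((h1.continuousOn.sub (h4 e)).mul (h3.continuousOn.sub (h6 e)))
      ((h2.continuousOn.sub (h5 e)).mul (h3.continuousOn.sub (h6 e)))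
  simp only [h7, sumFaces_add]
  ring

/-- The discrete inner product as a bilinear form on `V_h`. -/
noncomputable def innerForm (T : Mesh Ω) (hd : 1 ≤ d) (h : ℝ) (pr : Pair) (j : ℕ) :
    Vh T pr j →ₗ[ℝ] Vh T pr j →ₗ[ℝ] ℝ :=
  LinearMap.mk₂ ℝ (fun u v => innerH h (u : WeakFun T) (v : WeakFun T))
    (fun u v w => innerH_add_left hd h u v w)
    (fun t u v => innerH_smul_left h t _ _)
    (fun u v w => by
      simp only [innerH_comm h (u : WeakFun T)]
      exact innerH_add_left hd h v w u)
    (fun t u v => by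
      simp only [innerH_comm h (u : WeakFun T)]
      exact innerH_smul_left h t _ _)

theorem innerForm_apply (T : Mesh Ω) (hd : 1 ≤ d) (h : ℝ) (pr : Pair) (j : ℕ)
    (u v : Vh T pr j) : innerForm T hd h pr j u v = innerH h (u : WeakFun T) (v : WeakFun T) := rfl

theorem sumFaces_nonneg {T : Mesh Ω} (K : T.elements) {F : T.faces → ℝ} (hF : ∀ e, 0 ≤ F e) :
    0 ≤ sumFaces T K F := Finset.sum_nonneg fun e _ => hF e

theorem normSq0h_nonneg {T : Mesh Ω} {h : ℝ} (hh : 0 ≤ h) (v : WeakFun T) : 0 ≤ normSq0h h v :=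
  Finset.sum_nonneg fun K _ => add_nonneg (intElem_nonneg fun x => sq_nonneg _)
    (mul_nonneg hh (sumFaces_nonneg K fun e => intFace_nonneg fun x => sq_nonneg _))

theorem seminormSq1h_nonneg {T : Mesh Ω} {h : ℝ} (hh : 0 ≤ h) (v : WeakFun T) :
    0 ≤ seminormSq1h h v :=
  Finset.sum_nonneg fun K _ => add_nonneg (intElem_nonneg fun x => sq_nonneg _)
    (mul_nonneg (inv_nonneg.2 hh) (sumFaces_nonneg K fun e => intFace_nonneg fun x => sq_nonneg _))

/-- The element terms force `v_0 = 0`; the jump terms then reduce to the norms of `v_b` on the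
faces. -/
theorem eq_zero_of_normSq0h {T : Mesh Ω} (hd : 1 ≤ d) {h : ℝ} (hh : 0 < h) {pr : Pair} {j : ℕ}
    (v : Vh T pr j) (hv : normSq0h h (v : WeakFun T) = 0) : v = 0 := by
  have h1 := fun K e => intFace_nonneg (e := (e : T.faces).1)
    (f := fun x => ((v : WeakFun T).1 K x - (v : WeakFun T).2 e x) ^ 2) fun x => sq_nonneg _
  have h2 : ∀ K : T.elements, 0 ≤ intElem K.1 fun x => (v : WeakFun T).1 K x ^ 2 :=
    fun K => intElem_nonneg fun x => sq_nonneg _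
  have h3 : ∀ K : T.elements, 0 ≤ h * sumFaces T K fun e =>
      intFace e.1 fun x => ((v : WeakFun T).1 K x - (v : WeakFun T).2 e x) ^ 2 := fun K =>
    mul_nonneg hh.le (sumFaces_nonneg K fun e => h1 K e)
  rw [normSq0h, Finset.sum_eq_zero_iff_of_nonneg fun K _ => add_nonneg (h2 K) (h3 K)] at hv
  have h4 : ∀ K, (v : WeakFun T).1 K = 0 := fun K => by
    have := hv K (Finset.mem_univ K)
    exact (T.isSimplex K.2).eq_zero_of_intElem_sq (v.2.1 K) (by linarith [h2 K, h3 K])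
  refine Subtype.ext (Prod.ext (funext h4) (funext fun e => ?_))
  obtain ⟨K, hK, a, ha, hea⟩ := T.exists_erase_of_mem_faces e.2
  have h5 := hv ⟨K, hK⟩ (Finset.mem_univ _)
  have h6 : sumFaces T ⟨K, hK⟩ (fun e => intFace e.1 fun x =>
      ((v : WeakFun T).1 ⟨K, hK⟩ x - (v : WeakFun T).2 e x) ^ 2) = 0 := by
    have h7 : h * sumFaces T ⟨K, hK⟩ (fun e => intFace e.1 fun x =>
      ((v : WeakFun T).1 ⟨K, hK⟩ x - (v : WeakFun T).2 e x) ^ 2) = 0 := by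
      linarith [h2 ⟨K, hK⟩, h3 ⟨K, hK⟩]
    exact (mul_eq_zero.1 h7).resolve_left hh.ne'
  rw [sumFaces, Finset.sum_eq_zero_iff_of_nonneg fun e _ => h1 ⟨K, hK⟩ e] at h6
  have h8 := h6 e (Finset.mem_filter.2 ⟨Finset.mem_univ e, by
    rw [hea]; exact Finset.erase_subset _ _⟩)
  rw [h4] at h8
  simp only [Pi.zero_apply, zero_sub, neg_sq] at h8
  exact T.eq_zero_of_intFace_sq hd e.2 (v.2.2.1 e) h8

/-! ### The operator `Π` -/

theorem exists_projection {X : Type*} [MeasurableSpace X] (μ : Measure X)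
    (V W : Submodule ℝ (X → ℝ)) [Module.Finite ℝ V]
    (hV : ∀ p ∈ V, ∀ q ∈ V, Integrable (fun x => p x * q x) μ)
    (hdef : ∀ p ∈ V, ∫ x, p x ^ 2 ∂μ = 0 → p = 0)
    (hW : ∀ w ∈ W, ∀ q ∈ V, Integrable (fun x => w x * q x) μ) :
    ∃ L : W →ₗ[ℝ] V, ∀ (w : W) (q : V),
      ∫ x, (L w : X → ℝ) x * (q : X → ℝ) x ∂μ = ∫ x, (w : X → ℝ) x * (q : X → ℝ) x ∂μ := by
  obtain ⟨L, hL⟩ := exists_riesz (l2Form μ V hV)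
    (fun p hp => Subtype.ext (hdef p p.2 (by simpa only [l2Form_apply, ← sq] using hp)))
    (LinearMap.mk₂ ℝ (fun (w : W) (q : V) => ∫ x, (w : X → ℝ) x * (q : X → ℝ) x ∂μ)
      (fun p p' q => by
        simp only [Submodule.coe_add, Pi.add_apply, add_mul]
        exact integral_add (hW p p.2 q q.2) (hW p' p'.2 q q.2))
      (fun c p q => by
        simp only [Submodule.coe_smul, Pi.smul_apply, smul_eq_mul, mul_assoc]
        exact integral_const_mul c _)
      (fun p q q' => by
        simp only [Submodule.coe_add, Pi.add_apply, mul_add]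
        exact integral_add (hW p p.2 q q.2) (hW p p.2 q' q'.2))
      (fun c p q => by
        simp only [Submodule.coe_smul, Pi.smul_apply, smul_eq_mul, mul_left_comm _ c]
        exact integral_const_mul c _))
  exact ⟨L, fun w q => hL w q⟩

theorem confVh_eq_zero {T : Mesh Ω} (hΩ : IsOpen Ω) {w : E d → ℝ} (hw : w ∈ confVh T) {x : E d}
    (hx : x ∈ frontier Ω) : w x = 0 :=
  hw.2.2 x fun h => (hΩ.frontier_eq ▸ hx).2 h

theorem opPi_spec (hΩ : IsOpen Ω) (T : Mesh Ω) (hd : 1 ≤ d) (pr : Pair) (j : ℕ) (w : confVh T) :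
    (∀ K : T.elements, ∀ q ∈ polySpace d j,
      intElem K.1 (fun x => (opPi T pr j w : WeakFun T).1 K x * q x) =
        intElem K.1 fun x => (w : E d → ℝ) x * q x) ∧
    (∀ e : T.faces, ∀ q ∈ facePoly e.1 (pr.faceDeg j),
      intFace e.1 (fun x => (opPi T pr j w : WeakFun T).2 e x * q x) =
        intFace e.1 fun x => (w : E d → ℝ) x * q x) := by
  have h0 : ∀ K : T.elements, ∃ L : confVh T →ₗ[ℝ] polySpace d j,
      ∀ (w : confVh T) (q : polySpace d j),
      intElem K.1 (fun x => (L w : E d → ℝ) x * (q : E d → ℝ) x) =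
        intElem K.1 fun x => (w : E d → ℝ) x * (q : E d → ℝ) x := fun K => by
    refine exists_projection (volume.restrict (convexHull ℝ (K.1 : Set (E d))))
      (polySpace d j) (confVh T)
      (fun p hp q hq => ?_) (fun p hp h => ?_) fun w hw q hq => ?_
    · have h1 := continuous_of_mem_polySpace hp
      have h2 := continuous_of_mem_polySpace hq
      exact integrableOn_elem_of_continuousOn (by fun_prop)
    · exact (T.isSimplex K.2).eq_zero_of_intElem_sq hp h.le
    · have h1 := hw.1
      have h2 := continuous_of_mem_polySpace hq
      exact integrableOn_elem_of_continuousOn (by fun_prop)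
  have hb : ∀ e : T.faces, 
      ∃ L : confVh T →ₗ[ℝ] facePoly e.1 (pr.faceDeg j),
      ∀ (w : confVh T) (q : facePoly e.1 (pr.faceDeg j)),
      intFace e.1 (fun x => (L w : E d → ℝ) x * (q : E d → ℝ) x) =
        intFace e.1 fun x => (w : E d → ℝ) x * (q : E d → ℝ) x := fun e => by
    refine exists_projection (μHE[d - 1].restrict (convexHull ℝ (e.1 : Set (E d))))
      (facePoly e.1 (pr.faceDeg j)) (confVh T)
      (fun p hp q hq => ?_) (fun p hp h => ?_) fun w hw q hq => ?_
    · exact T.integrableOn_face hd e.2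
        ((continuousOn_of_mem_facePoly hp).mul (continuousOn_of_mem_facePoly hq))
    · exact T.eq_zero_of_intFace_sq hd e.2 hp h
    · exact T.integrableOn_face hd e.2 (hw.1.continuousOn.mul (continuousOn_of_mem_facePoly hq))
  choose L₀ hL₀ using h0
  choose L₁ hL₁ using hb
  -- A conforming function vanishes on boundary faces, hence so does its projection; this puts the
  -- result in `V_h`.
  have hzero : ∀ (w : confVh T) (e : T.faces), IsBoundaryFace Ω e.1 →
      (L₁ e w : E d → ℝ) = 0 := by
    intro w e he
    refine T.eq_zero_of_intFace_sq hd e.2 (L₁ e w).2 ?_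
    simp only [sq]
    rw [hL₁ e w (L₁ e w)]
    refine setIntegral_eq_zero_of_forall_eq_zero fun x hx => ?_
    rw [confVh_eq_zero hΩ w.2 (he hx), zero_mul]
  have hex : ∃ Q : confVh T →ₗ[ℝ] Vh T pr j, ∀ w : confVh T,
      (∀ K : T.elements, ∀ q ∈ polySpace d j,
        intElem K.1 (fun x => (Q w : WeakFun T).1 K x * q x) =
          intElem K.1 fun x => (w : E d → ℝ) x * q x) ∧
      (∀ e : T.faces, ∀ q ∈ facePoly e.1 (pr.faceDeg j),
        intFace e.1 (fun x => (Q w : WeakFun T).2 e x * q x) =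
          intFace e.1 fun x => (w : E d → ℝ) x * q x) := by
    refine ⟨{ toFun := fun w => ⟨(fun K => L₀ K w, fun e => L₁ e w),
                fun K => (L₀ K w).2, fun e => (L₁ e w).2, fun e he => hzero w e he⟩
              map_add' := fun u w => ?_
              map_smul' := fun t w => ?_ },
      fun w => ⟨fun K q hq => hL₀ K w ⟨q, hq⟩, fun e q hq => hL₁ e w ⟨q, hq⟩⟩⟩
    · simp only [map_add]
      rfl
    · simp only [map_smul]
      rfl
  exact Classical.epsilon_spec hex w

end WG

namespace WG

open scoped Classical Topology

/-! ### Symmetric operators without nonzero eigenvalues -/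

/-- With `B` as inner product `A` is symmetric, so its eigenspaces span; if 0 is the only possible
eigenvalue they all lie in the kernel. -/
theorem eq_zero_of_symmetric {V : Type*} [AddCommGroup V] [Module ℝ V] [Module.Finite ℝ V]
    (B : V →ₗ[ℝ] V →ₗ[ℝ] ℝ) (hsymm : ∀ u v, B u v = B v u) (hpos : ∀ v, 0 ≤ B v v)
    (hdef : ∀ v, B v v = 0 → v = 0) (A : Module.End ℝ V) (hA : ∀ u v, B (A u) v = B u (A v))
    (hev : ∀ μ, A.HasEigenvalue μ → μ = 0) : A = 0 := by
  let core : InnerProductSpace.Core ℝ V :=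
    { inner := fun u v => B u v
      conj_inner_symm := fun u v => hsymm v u
      re_inner_nonneg := fun v => hpos v
      add_left := fun u v w => by simp
      smul_left := fun u v r => by simp
      definite := fun v hv => hdef v hv }
  letI : NormedAddCommGroup V := core.toNormedAddCommGroup
  letI : InnerProductSpace ℝ V := InnerProductSpace.ofCore core.toCore
  have hT : A.IsSymmetric := fun u v => hA u v
  have h1 := hT.orthogonalComplement_iSup_eigenspaces_eq_bot
  rw [Submodule.orthogonal_eq_bot_iff] at h1
  have h2 : (⨆ μ, Module.End.eigenspace A μ) ≤ LinearMap.ker A := by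
    refine iSup_le fun μ => ?_
    by_cases hμ : Module.End.eigenspace A μ = ⊥
    · rw [hμ]; exact bot_le
    · rw [hev μ (Module.End.hasEigenvalue_iff.2 hμ), Module.End.eigenspace_zero]
  rw [h1, top_le_iff] at h2
  exact LinearMap.ker_eq_top.1 h2

theorem spectralRadius_le_of_eigenvalue {V : Type*} [AddCommGroup V] [Module ℝ V] [Module.Finite ℝ V]
    (A : Module.End ℝ V) {M : ℝ} (h : ∀ μ, A.HasEigenvalue μ → |μ| ≤ M) :
    spectralRadius ℝ A ≤ ENNReal.ofReal M := by
  refine iSup₂_le fun μ hμ => ?_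
  have h1 := h μ (Module.End.hasEigenvalue_iff_mem_spectrum.2 hμ)
  rw [show ((‖μ‖₊ : NNReal) : ENNReal) = ENNReal.ofReal |μ| from (ofReal_norm μ).symm]
  exact ENNReal.ofReal_le_ofReal h1

theorem eigenvalue_eq_zero {V : Type*} [AddCommGroup V] [Module ℝ V] [Module.Finite ℝ V]
    (A : Module.End ℝ V) (h : spectralRadius ℝ A = 0) {μ : ℝ} (hμ : A.HasEigenvalue μ) : μ = 0 := by
  have h1 : (‖μ‖₊ : ENNReal) ≤ spectralRadius ℝ A :=
    le_iSup₂ (f := fun k (_ : k ∈ spectrum ℝ A) => (‖k‖₊ : ENNReal)) μ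
      (Module.End.hasEigenvalue_iff_mem_spectrum.1 hμ)
  rw [h, nonpos_iff_eq_zero, ENNReal.coe_eq_zero, nnnorm_eq_zero] at h1
  exact h1

/-! ### The diffusion form -/

variable {d : ℕ} {Ω : Set (E d)}

theorem pairing_eq_sum (M : Matrix (Fin d) (Fin d) ℝ) (p q : E d) :
    pairing M p q = ∑ i, ∑ k, M i k * (p k * q i) := by
  simp only [pairing, dotProduct, Matrix.mulVec, Finset.sum_mul, mul_assoc]

theorem pairing_add_left (M : Matrix (Fin d) (Fin d) ℝ) (p p' q : E d) :
    pairing M (p + p') q = pairing M p q + pairing M p' q := by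
  simp only [pairing_eq_sum, PiLp.add_apply, add_mul, mul_add, Finset.sum_add_distrib]

theorem pairing_smul_left (M : Matrix (Fin d) (Fin d) ℝ) (t : ℝ) (p q : E d) :
    pairing M (t • p) q = t * pairing M p q := by
  simp only [pairing_eq_sum, PiLp.smul_apply, smul_eq_mul, Finset.mul_sum]
  refine Finset.sum_congr rfl fun i _ => Finset.sum_congr rfl fun k _ => ?_
  ring

theorem pairing_comm {M : Matrix (Fin d) (Fin d) ℝ} (hM : M.IsSymm) (p q : E d) :
    pairing M p q = pairing M q p := by
  simp only [pairing_eq_sum]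
  rw [Finset.sum_comm]
  refine Finset.sum_congr rfl fun i _ => Finset.sum_congr rfl fun k _ => ?_
  rw [hM.apply, mul_comm (p i)]

theorem pairing_self (M : Matrix (Fin d) (Fin d) ℝ) (p : E d) :
    pairing M p p = (fun i => p i) ⬝ᵥ (M *ᵥ fun i => p i) := dotProduct_comm _ _

theorem dotProduct_self_eq (p : E d) : ((fun i => p i) ⬝ᵥ fun i => p i) = ‖p‖ ^ 2 := by
  rw [EuclideanSpace.real_norm_sq_eq]
  simp only [dotProduct, sq]

theorem IsDiffusion.le_pairing {α β : ℝ} {𝔸 : E d → Matrix (Fin d) (Fin d) ℝ}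
    (h : IsDiffusion Ω α β 𝔸) {x : E d} (hx : x ∈ Ω) (p : E d) :
    α * ‖p‖ ^ 2 ≤ pairing (𝔸 x) p p := by
  rw [pairing_self, ← dotProduct_self_eq]
  exact h.lower x hx _

theorem IsDiffusion.pairing_le {α β : ℝ} {𝔸 : E d → Matrix (Fin d) (Fin d) ℝ}
    (h : IsDiffusion Ω α β 𝔸) {x : E d} (hx : x ∈ Ω) (p : E d) :
    pairing (𝔸 x) p p ≤ β * ‖p‖ ^ 2 := by
  rw [pairing_self, ← dotProduct_self_eq]
  exact h.upper x hx _

/-- Polarization of the quadratic form on coordinate vectors. The bound is needed for integrability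
of the energy densities. -/
theorem IsDiffusion.abs_entry_le {α β : ℝ} {𝔸 : E d → Matrix (Fin d) (Fin d) ℝ}
    (h : IsDiffusion Ω α β 𝔸) {x : E d} (hx : x ∈ Ω) (i k : Fin d) :
    |𝔸 x i k| ≤ 4 * (|α| + |β|) := by
  let u : E d := EuclideanSpace.single i 1
  let w : E d := EuclideanSpace.single k 1
  have huw : pairing (𝔸 x) w u = 𝔸 x i k := by
    rw [pairing_eq_sum, Finset.sum_eq_single i, Finset.sum_eq_single k]
    · simp [u, w]
    · intro b _ hb; simp [u, w, hb]
    · simp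
    · intro b _ hb; simp [u, w, hb]
    · simp
  have hb : ∀ p : E d, |pairing (𝔸 x) p p| ≤ (|α| + |β|) * ‖p‖ ^ 2 := by
    intro p
    have h1 := h.le_pairing hx p
    have h2 := h.pairing_le hx p
    have h3 : 0 ≤ ‖p‖ ^ 2 := by positivity
    rw [abs_le]
    constructor <;>
    nlinarith [neg_abs_le α, le_abs_self β, mul_nonneg (abs_nonneg α) h3,
      mul_nonneg (abs_nonneg β) h3, mul_le_mul_of_nonneg_right (neg_abs_le α) h3,
      mul_le_mul_of_nonneg_right (le_abs_self β) h3]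
  have hs := h.symm x hx
  have h4 : pairing (𝔸 x) (w + u) (w + u) =
      pairing (𝔸 x) w w + 2 * pairing (𝔸 x) w u + pairing (𝔸 x) u u := by
    rw [pairing_add_left, pairing_comm hs w (w + u), pairing_comm hs u (w + u), pairing_add_left,
      pairing_add_left, pairing_comm hs u w]
    ring
  have hu : ‖u‖ = 1 := by simp [u]
  have hw : ‖w‖ = 1 := by simp [w]
  have huw2 : ‖w + u‖ ≤ 2 := (norm_add_le _ _).trans (by rw [hu, hw]; norm_num)
  have h5 := hb (w + u)
  have h6 := hb w
  have h7 := hb u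
  rw [hw] at h6
  rw [hu] at h7
  have h8 : ‖w + u‖ ^ 2 ≤ 4 := by nlinarith [norm_nonneg (w + u)]
  have h9 : (|α| + |β|) * ‖w + u‖ ^ 2 ≤ (|α| + |β|) * 4 := by gcongr
  rw [← huw]
  rw [abs_le] at h5 h6 h7 ⊢
  have hab : 0 ≤ |α| + |β| := by positivity
  constructor <;> linarith [h5.1, h5.2, h6.1, h6.2, h7.1, h7.2]

/-- A closed element lies in the closure of `Ω`, and the frontier has measure zero. -/
theorem Mesh.ae_mem (T : Mesh Ω) (hΩ : IsOpen Ω) {K : Finset (E d)} (hK : K ∈ T.elements) :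
    ∀ᵐ x ∂volume.restrict (convexHull ℝ (K : Set (E d))), x ∈ Ω := by
  rw [ae_restrict_iff' (isClosed_face K).measurableSet]
  have h1 : ∀ᵐ x ∂(volume : Measure (E d)), x ∉ frontier Ω := measure_eq_zero_iff_ae_notMem.1
    T.volume_frontier
  filter_upwards [h1] with x hx hxK
  by_contra hxΩ
  exact hx ⟨T.elem_subset_closure hK hxK, by rwa [hΩ.interior_eq]⟩

theorem IsDiffusion.integrableOn {α β : ℝ} {𝔸 : E d → Matrix (Fin d) (Fin d) ℝ}
    (h : IsDiffusion Ω α β 𝔸) (T : Mesh Ω) (hΩ : IsOpen Ω) {K : Finset (E d)}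
    (hK : K ∈ T.elements) {p q : E d → E d} (hp : Continuous p) (hq : Continuous q) :
    IntegrableOn (fun x => pairing (𝔸 x) (p x) (q x)) (convexHull ℝ (K : Set (E d))) := by
  simp only [pairing_eq_sum]
  refine integrable_finsetSum _ fun i _ => integrable_finsetSum _ fun k _ => ?_
  refine Integrable.bdd_mul (c := 4 * (|α| + |β|))
    (integrableOn_elem_of_continuousOn (by fun_prop)) ?_ ?_
  -- The entries are measurable only on `Ω`, but the element agrees with its intersection with `Ω`
  -- up to a null set.
  · have h1 : volume.restrict (convexHull ℝ (K : Set (E d))) =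
        (volume.restrict Ω).restrict (convexHull ℝ (K : Set (E d))) := by
      rw [Measure.restrict_restrict (isClosed_face K).measurableSet]
      refine (Measure.restrict_congr_set ?_).symm
      have h2 := (ae_restrict_iff' (isClosed_face K).measurableSet).1 (T.ae_mem hΩ hK)
      filter_upwards [h2] with x hx
      exact propext ⟨fun h => h.1, fun h => ⟨h, hx h⟩⟩
    rw [h1]
    exact ((h.measurable i k).mono_measure Measure.restrict_le_self).aestronglyMeasurable
  · filter_upwards [T.ae_mem hΩ hK] with x hx
    exact h.abs_entry_le hx i k

theorem IsDiffusion.intElem_comm {α β : ℝ} {𝔸 : E d → Matrix (Fin d) (Fin d) ℝ}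
    (h : IsDiffusion Ω α β 𝔸) (T : Mesh Ω) (hΩ : IsOpen Ω) {K : Finset (E d)}
    (hK : K ∈ T.elements) (p q : E d → E d) :
    intElem K (fun x => pairing (𝔸 x) (p x) (q x)) =
      intElem K fun x => pairing (𝔸 x) (q x) (p x) := by
  refine integral_congr_ae ?_
  filter_upwards [T.ae_mem hΩ hK] with x hx
  exact pairing_comm (h.symm x hx) _ _

theorem aForm_comm {T : Mesh Ω} {α β : ℝ} {𝔸 : E d → Matrix (Fin d) (Fin d) ℝ}
    (h : IsDiffusion Ω α β 𝔸) (hΩ : IsOpen Ω) (pr : Pair) (j : ℕ) (u v : WeakFun T) :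
    aForm pr j 𝔸 u v = aForm pr j 𝔸 v u :=
  Finset.sum_congr rfl fun K _ => h.intElem_comm T hΩ K.2 _ _

theorem aForm_add_left {T : Mesh Ω} {α β : ℝ} {𝔸 : E d → Matrix (Fin d) (Fin d) ℝ}
    (h : IsDiffusion Ω α β 𝔸) (hd : 1 ≤ d) (hΩ : IsOpen Ω) (pr : Pair) (j : ℕ)
    (u v w : Vh T pr j) : aForm pr j 𝔸 ((u + v : Vh T pr j) : WeakFun T) (w : WeakFun T) =
      aForm pr j 𝔸 (u : WeakFun T) (w : WeakFun T) +
        aForm pr j 𝔸 (v : WeakFun T) (w : WeakFun T) := by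
  simp only [aForm, ← Finset.sum_add_distrib]
  refine Finset.sum_congr rfl fun K _ => ?_
  have hc := fun u : Vh T pr j => continuous_of_mem_gradSpace (isWeakGrad_weakGrad hd u K).1
  simp only [weakGrad_add hd, Pi.add_apply, pairing_add_left]
  exact integral_add (h.integrableOn T hΩ K.2 (hc u) (hc w))
    (h.integrableOn T hΩ K.2 (hc v) (hc w))

theorem aForm_smul_left {T : Mesh Ω} {𝔸 : E d → Matrix (Fin d) (Fin d) ℝ} (hd : 1 ≤ d)
    (pr : Pair) (j : ℕ) (t : ℝ) (u v : Vh T pr j) :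
    aForm pr j 𝔸 ((t • u : Vh T pr j) : WeakFun T) (v : WeakFun T) =
      t * aForm pr j 𝔸 (u : WeakFun T) (v : WeakFun T) := by
  simp only [aForm, Finset.mul_sum]
  refine Finset.sum_congr rfl fun K _ => ?_
  simp only [weakGrad_smul hd, Pi.smul_apply, pairing_smul_left, intElem_const_mul]

theorem opA_spec {T : Mesh Ω} {α β : ℝ} {𝔸 : E d → Matrix (Fin d) (Fin d) ℝ}
    (h𝔸 : IsDiffusion Ω α β 𝔸) (hd : 1 ≤ d) (hΩ : IsOpen Ω) {h : ℝ} (hh : 0 < h) (pr : Pair)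
    (j : ℕ) (u v : Vh T pr j) :
    innerH h (opA T pr j h 𝔸 u : WeakFun T) (v : WeakFun T) =
      aForm pr j 𝔸 (u : WeakFun T) (v : WeakFun T) := by
  obtain ⟨L, hL⟩ := exists_riesz (innerForm T hd h pr j)
    (fun v hv => eq_zero_of_normSq0h hd hh v (by rwa [innerForm_apply, innerH_self] at hv))
    (LinearMap.mk₂ ℝ (fun u v : Vh T pr j => aForm pr j 𝔸 (u : WeakFun T) (v : WeakFun T))
      (fun u v w => aForm_add_left h𝔸 hd hΩ pr j u v w)
      (fun t u v => aForm_smul_left hd pr j t u v)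
      (fun u v w => by
        simp only [aForm_comm h𝔸 hΩ pr j (u : WeakFun T)]
        exact aForm_add_left h𝔸 hd hΩ pr j v w u)
      (fun t u v => by
        simp only [aForm_comm h𝔸 hΩ pr j (u : WeakFun T)]
        exact aForm_smul_left hd pr j t v u))
  have hex : ∃ A : Module.End ℝ (Vh T pr j), ∀ u v : Vh T pr j,
      innerH h (A u : WeakFun T) (v : WeakFun T) =
        aForm pr j 𝔸 (u : WeakFun T) (v : WeakFun T) := ⟨L, fun u v => hL u v⟩
  exact Classical.epsilon_spec hex u v

theorem le_aForm {T : Mesh Ω} {α β : ℝ} {𝔸 : E d → Matrix (Fin d) (Fin d) ℝ}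
    (h𝔸 : IsDiffusion Ω α β 𝔸) (hd : 1 ≤ d) (hΩ : IsOpen Ω) (pr : Pair) (j : ℕ) (v : Vh T pr j) :
    α * ∑ K : T.elements, intElem K.1 (fun x => ‖weakGrad pr j (v : WeakFun T) K x‖ ^ 2) ≤
      aForm pr j 𝔸 (v : WeakFun T) (v : WeakFun T) := by
  rw [Finset.mul_sum]
  refine Finset.sum_le_sum fun K _ => ?_
  have hc := continuous_of_mem_gradSpace (isWeakGrad_weakGrad hd v K).1
  rw [← intElem_const_mul]
  refine integral_mono_ae (integrableOn_elem_of_continuousOn (by fun_prop))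
    (h𝔸.integrableOn T hΩ K.2 hc hc) ?_
  filter_upwards [T.ae_mem hΩ K.2] with x hx
  exact h𝔸.le_pairing hx _

theorem aForm_le {T : Mesh Ω} {α β : ℝ} {𝔸 : E d → Matrix (Fin d) (Fin d) ℝ}
    (h𝔸 : IsDiffusion Ω α β 𝔸) (hd : 1 ≤ d) (hΩ : IsOpen Ω) (pr : Pair) (j : ℕ) (v : Vh T pr j) :
    aForm pr j 𝔸 (v : WeakFun T) (v : WeakFun T) ≤
      β * ∑ K : T.elements, intElem K.1 (fun x => ‖weakGrad pr j (v : WeakFun T) K x‖ ^ 2) := by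
  rw [Finset.mul_sum]
  refine Finset.sum_le_sum fun K _ => ?_
  have hc := continuous_of_mem_gradSpace (isWeakGrad_weakGrad hd v K).1
  rw [← intElem_const_mul]
  refine integral_mono_ae (h𝔸.integrableOn T hΩ K.2 hc hc)
    (integrableOn_elem_of_continuousOn (by fun_prop)) ?_
  filter_upwards [T.ae_mem hΩ K.2] with x hx
  exact h𝔸.pairing_le hx _

/-- A bound of the energy form by the discrete inner product bounds the spectral radius; and a
vanishing spectral radius forces the energy form to vanish. -/
theorem rhoA_le {T : Mesh Ω} {α β : ℝ} {𝔸 : E d → Matrix (Fin d) (Fin d) ℝ}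
    (h𝔸 : IsDiffusion Ω α β 𝔸) (hα : 0 ≤ α) (hd : 1 ≤ d) (hΩ : IsOpen Ω) {h : ℝ} (hh : 0 < h)
    (pr : Pair) (j : ℕ) {M : ℝ} (hM0 : 0 ≤ M)
    (hM : ∀ v : Vh T pr j, aForm pr j 𝔸 (v : WeakFun T) (v : WeakFun T) ≤
      M * normSq0h h (v : WeakFun T)) :
    rhoA T pr j h 𝔸 ≤ M ∧ (rhoA T pr j h 𝔸 = 0 →
      ∀ v : Vh T pr j, aForm pr j 𝔸 (v : WeakFun T) (v : WeakFun T) = 0) := by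
  have hdef : ∀ v : Vh T pr j, innerForm T hd h pr j v v = 0 → v = 0 := fun v hv =>
    eq_zero_of_normSq0h hd hh v (by rwa [innerForm_apply, innerH_self] at hv)
  have h1 : spectralRadius ℝ (opA T pr j h 𝔸) ≤ ENNReal.ofReal M := by
    refine spectralRadius_le_of_eigenvalue _ fun μ hμ => ?_
    obtain ⟨v, hv⟩ := hμ.exists_hasEigenvector
    -- For an eigenvector this is a Rayleigh quotient identity: `μ ‖v‖_{0,h}² = a(v, v)`, so `μ`
    -- lies between 0 and `M`.
    have h2 := opA_spec h𝔸 hd hΩ hh pr j v v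
    rw [hv.apply_eq_smul, Submodule.coe_smul, innerH_smul_left, innerH_self] at h2
    have h3 : 0 < normSq0h h (v : WeakFun T) := (normSq0h_nonneg hh.le _).lt_of_ne' fun h0 =>
      hv.2 (eq_zero_of_normSq0h hd hh v h0)
    have h4 := hM v
    have h5 : 0 ≤ aForm pr j 𝔸 (v : WeakFun T) (v : WeakFun T) :=
      le_trans (mul_nonneg hα (Finset.sum_nonneg fun K _ =>
        intElem_nonneg fun x => sq_nonneg _)) (le_aForm h𝔸 hd hΩ pr j v)
    rw [← h2] at h4 h5
    rw [abs_of_nonneg (nonneg_of_mul_nonneg_left h5 h3)]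
    exact le_of_mul_le_mul_right h4 h3
  refine ⟨ENNReal.toReal_le_of_le_ofReal hM0 h1, fun h0 v => ?_⟩
  have h2 : spectralRadius ℝ (opA T pr j h 𝔸) = 0 := by
    -- `toReal` also sends `⊤` to 0; the upper bound already proved excludes that value.
    rcases (ENNReal.toReal_eq_zero_iff _).1 h0 with h2 | h2
    · exact h2
    · rw [h2] at h1
      exact absurd h1 (by simp)
  have h3 : opA T pr j h 𝔸 = 0 := by
    refine eq_zero_of_symmetric (innerForm T hd h pr j) (fun u v => innerH_comm h _ _)
      (fun v => ?_) hdef _ (fun u v => ?_) fun μ hμ => eigenvalue_eq_zero _ h2 hμ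
    · rw [innerForm_apply, innerH_self]
      exact normSq0h_nonneg hh.le _
    · rw [innerForm_apply, innerForm_apply, innerH_comm h (u : WeakFun T), opA_spec h𝔸 hd hΩ hh,
        opA_spec h𝔸 hd hΩ hh, aForm_comm h𝔸 hΩ]
  rw [← opA_spec h𝔸 hd hΩ hh, h3, ← innerForm_apply T hd]
  simp

end WG

namespace WG

open scoped Classical Topology

/-! ### From the mesh to single elements -/

variable {d : ℕ} {Ω : Set (E d)}

/-- Faces of a simplex correspond to their opposite vertices; this links the mesh-wide sums to the
estimates on a single simplex. -/
theorem sumFaces_eq {T : Mesh Ω} (K : T.elements) (F : T.faces → ℝ) (G : E d → ℝ)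
    (h : ∀ (a : E d) (ha : a ∈ K.1), F ⟨K.1.erase a, T.erase_mem_faces K.2 ha⟩ = G a) :
    sumFaces T K F = ∑ a ∈ K.1, G a := by
  refine (Finset.sum_bij (fun a ha => (⟨K.1.erase a, T.erase_mem_faces K.2 ha⟩ : T.faces))
    (fun a ha => ?_) (fun a ha b hb hab => ?_) (fun e he => ?_) fun a ha => (h a ha).symm).symm
  · exact Finset.mem_filter.2 ⟨Finset.mem_univ _, Finset.erase_subset _ _⟩
  · by_contra hne
    have h1 : a ∈ K.1.erase b := Finset.mem_erase.2 ⟨hne, ha⟩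
    have h2 : K.1.erase a = K.1.erase b := congrArg Subtype.val hab
    rw [← h2] at h1
    exact Finset.notMem_erase a _ h1
  · have h1 := (Finset.mem_filter.1 he).2
    obtain ⟨a, ha, hea⟩ := (mem_powersetCard_iff (T.card_eq _ K.2)).1
      (Finset.mem_powersetCard.2 ⟨h1, T.card_face e.2⟩)
    exact ⟨a, ha, Subtype.ext hea.symm⟩

/-- The restriction of a weak function to the boundary of an element, given by polynomials. -/
theorem exists_local_faces {T : Mesh Ω} {pr : Pair} {j : ℕ} (v : Vh T pr j) (K : T.elements) :
    ∃ b : E d → E d → ℝ, (∀ a ∈ K.1, b a ∈ polySpace d (pr.faceDeg j)) ∧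
      ∀ (a : E d) (ha : a ∈ K.1), ∀ x ∈ convexHull ℝ ((K.1.erase a : Finset (E d)) : Set (E d)),
        (v : WeakFun T).2 ⟨K.1.erase a, T.erase_mem_faces K.2 ha⟩ x = b a x := by
  have h : ∀ a : E d, ∃ p : E d → ℝ, ∀ ha : a ∈ K.1, p ∈ polySpace d (pr.faceDeg j) ∧
      ∀ x ∈ convexHull ℝ ((K.1.erase a : Finset (E d)) : Set (E d)),
        (v : WeakFun T).2 ⟨K.1.erase a, T.erase_mem_faces K.2 ha⟩ x = p x := by
    intro a
    by_cases ha : a ∈ K.1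
    · obtain ⟨p, hp, hpv⟩ := mem_facePoly.1 (v.2.2.1 ⟨K.1.erase a, T.erase_mem_faces K.2 ha⟩)
      exact ⟨p, fun _ => ⟨hp, fun x hx => by rw [← hpv, indicator_of_mem hx]⟩⟩
    · exact ⟨0, fun h => absurd h ha⟩
  choose b hb using h
  exact ⟨b, fun a ha => (hb a ha).1, fun a ha => (hb a ha).2⟩

theorem sumFaces_intFace_eq {T : Mesh Ω} {v : WeakFun T} {K : T.elements} {b : E d → E d → ℝ}
    (hb : ∀ (a : E d) (ha : a ∈ K.1),
      ∀ x ∈ convexHull ℝ ((K.1.erase a : Finset (E d)) : Set (E d)),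
        v.2 ⟨K.1.erase a, T.erase_mem_faces K.2 ha⟩ x = b a x)
    (Φ : Finset (E d) → E d → ℝ → ℝ) :
    sumFaces T K (fun e => intFace e.1 fun x => Φ e.1 x (v.2 e x)) =
      ∑ a ∈ K.1, intFace (K.1.erase a) fun x => Φ (K.1.erase a) x (b a x) := by
  refine sumFaces_eq K _ _ fun a ha =>
    setIntegral_congr_fun (isClosed_face _).measurableSet fun x hx => ?_
  simp only [hb a ha x hx]

theorem isLocalWeakGrad_weakGrad {T : Mesh Ω} (hd : 1 ≤ d) {pr : Pair} {j : ℕ} (v : Vh T pr j)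
    (K : T.elements) {b : E d → E d → ℝ}
    (hb : ∀ (a : E d) (ha : a ∈ K.1),
      ∀ x ∈ convexHull ℝ ((K.1.erase a : Finset (E d)) : Set (E d)),
        (v : WeakFun T).2 ⟨K.1.erase a, T.erase_mem_faces K.2 ha⟩ x = b a x) :
    IsLocalWeakGrad pr j K.1 ((v : WeakFun T).1 K) b (weakGrad pr j (v : WeakFun T) K) := by
  obtain ⟨h1, h2⟩ := isWeakGrad_weakGrad hd v K
  refine ⟨h1, fun q hq => ?_⟩
  rw [h2 q hq, sumFaces_intFace_eq hb fun e x t => t * inner ℝ (q x) (outwardNormal K.1 e)]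

theorem exists_seminorm_le (d j : ℕ) (pr : Pair) (hd : 1 ≤ d) {r R : ℝ} (hr : 0 < r)
    (hR : 0 ≤ R) :
    ∃ C, 0 < C ∧ ∀ (Ω : Set (E d)) (T : Mesh Ω) (h : ℝ), (∀ K ∈ T.elements, HasShape r R h K) →
      ∀ v : Vh T pr j, seminormSq1h h (v : WeakFun T) ≤
        C * ∑ K : T.elements, intElem K.1 fun x => ‖weakGrad pr j (v : WeakFun T) K x‖ ^ 2 := by
  obtain ⟨C, hC, H⟩ := exists_local_coercive d j pr hd R hr hR
  refine ⟨C, hC, fun Ω T h hT v => ?_⟩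
  rw [seminormSq1h, Finset.mul_sum]
  refine Finset.sum_le_sum fun K _ => ?_
  obtain ⟨b, hbp, hb⟩ := exists_local_faces v K
  rw [sumFaces_intFace_eq hb fun _ x t => ((v : WeakFun T).1 K x - t) ^ 2]
  exact H K.1 h (hT K.1 K.2) _ (v.2.1 K) b hbp _ (isLocalWeakGrad_weakGrad hd v K hb)

/-- The inverse inequality for `∇v_0` costs `h⁻²`, and so does passing from `h⁻¹` to `h` in front of
the jumps. This bounds the spectral radius. -/
theorem exists_weakGrad_le (d j : ℕ) (pr : Pair) (hd : 1 ≤ d) {r R : ℝ} (hr : 0 < r)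
    (hR : 0 ≤ R) :
    ∃ C, 0 < C ∧ ∀ (Ω : Set (E d)) (T : Mesh Ω) (h : ℝ), (∀ K ∈ T.elements, HasShape r R h K) →
      ∀ v : Vh T pr j,
        ∑ K : T.elements, intElem K.1 (fun x => ‖weakGrad pr j (v : WeakFun T) K x‖ ^ 2) ≤
          C * ((h ^ 2)⁻¹ * normSq0h h (v : WeakFun T)) := by
  obtain ⟨C₁, hC₁, H₁⟩ := exists_local_bounded d j pr hd R hr
  obtain ⟨C₂, hC₂, H₂⟩ := exists_gradient_inverse d j R hr hR
  refine ⟨C₁ * (C₂ + 1), by positivity, fun Ω T h hT v => ?_⟩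
  rw [normSq0h, Finset.mul_sum, Finset.mul_sum]
  refine Finset.sum_le_sum fun K _ => ?_
  have hS := hT K.1 K.2
  have hh := hS.h_pos
  obtain ⟨b, hbp, hb⟩ := exists_local_faces v K
  rw [sumFaces_intFace_eq hb fun _ x t => ((v : WeakFun T).1 K x - t) ^ 2]
  refine (H₁ K.1 h hS _ (v.2.1 K) b hbp _ (isLocalWeakGrad_weakGrad hd v K hb)).trans ?_
  have h2 := H₂ K.1 h hS _ (v.2.1 K)
  set X := intElem K.1 fun x => (v : WeakFun T).1 K x ^ 2
  set Y := ∑ a ∈ K.1, intFace (K.1.erase a) fun x => ((v : WeakFun T).1 K x - b a x) ^ 2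
  have hX : 0 ≤ X := intElem_nonneg fun x => sq_nonneg _
  have hY : 0 ≤ Y := Finset.sum_nonneg fun a _ => intFace_nonneg fun x => sq_nonneg _
  have h3 : h⁻¹ * Y = (h ^ 2)⁻¹ * (h * Y) := by field_simp
  have h4 : 0 ≤ (h ^ 2)⁻¹ * X := by positivity
  have h5 : 0 ≤ (h ^ 2)⁻¹ * (h * Y) := by positivity
  rw [h3, mul_assoc C₁]
  refine mul_le_mul_of_nonneg_left ?_ hC₁.le
  rw [mul_add]
  nlinarith

/-! ### Piecewise linear functions -/

theorem affine_of_mem_polySpace_one {p : E d → ℝ} (hp : p ∈ polySpace d 1) (x y : E d) :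
    p x = p y + fderiv ℝ p 0 (x - y) := by
  have hdiff := differentiable_of_mem_polySpace hp
  have hconst : ∀ z, fderiv ℝ p z = fderiv ℝ p 0 := by
    intro z
    ext u
    have h1 := fderiv_apply_mem_polySpace hp u
    have h2 := is_const_of_fderiv_eq_zero (differentiable_of_mem_polySpace h1)
      (fun z => fderiv_eq_zero_of_mem_polySpace_zero h1 z) z 0
    exact h2
  have h3 : ∀ z, fderiv ℝ (fun z => p z - fderiv ℝ p 0 z) z = 0 := by
    intro z
    rw [fderiv_fun_sub (hdiff z) (fderiv ℝ p 0).differentiableAt, hconst,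
      ContinuousLinearMap.fderiv, sub_self]
  have h4 := is_const_of_fderiv_eq_zero (hdiff.sub (fderiv ℝ p 0).differentiable) h3 x y
  simp only [Pi.sub_apply] at h4
  rw [map_sub]
  linarith

theorem IsSimplex.eq_sum_lam {K : Finset (E d)} (hK : IsSimplex K) {p : E d → ℝ}
    (hp : p ∈ polySpace d 1) (x : E d) : p x = ∑ a ∈ K, lam K a x * p a := by
  have h1 : ∀ a, p a = p x + fderiv ℝ p 0 (a - x) := fun a => affine_of_mem_polySpace_one hp a x
  have h2 : ∑ a ∈ K, lam K a x * fderiv ℝ p 0 (a - x) = 0 := by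
    have h3 : ∑ a ∈ K, lam K a x * fderiv ℝ p 0 (a - x) =
        fderiv ℝ p 0 (∑ a ∈ K, lam K a x • (a - x)) := by simp
    have h4 : ∑ a ∈ K, lam K a x • (a - x) = 0 := by
      simp only [smul_sub, Finset.sum_sub_distrib, ← Finset.sum_smul]
      rw [hK.sum_lam_smul, hK.sum_lam, one_smul, sub_self]
    rw [h3, h4, map_zero]
  calc p x = ∑ a ∈ K, lam K a x * p x + ∑ a ∈ K, lam K a x * fderiv ℝ p 0 (a - x) := by
        rw [h2, add_zero, ← Finset.sum_mul, hK.sum_lam, one_mul]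
    _ = _ := by
        rw [← Finset.sum_add_distrib]
        exact Finset.sum_congr rfl fun a _ => by rw [h1 a]; ring

/-- The frontier of a simplex is null. This matters for gradients of piecewise linear functions,
which agree with those of the local polynomials only in the interior. -/
theorem intElem_congr_interior {K : Finset (E d)} {f g : E d → ℝ}
    (h : ∀ x ∈ interior (convexHull ℝ (K : Set (E d))), f x = g x) : intElem K f = intElem K g := by
  refine integral_congr_ae ?_
  have h1 : ∀ᵐ x ∂(volume : Measure (E d)), x ∉ frontier (convexHull ℝ (K : Set (E d))) :=
    measure_eq_zero_iff_ae_notMem.1 ((convex_convexHull ℝ _).addHaar_frontier volume)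
  rw [Filter.EventuallyEq, ae_restrict_iff' (isClosed_face K).measurableSet]
  filter_upwards [h1] with x hx hxK
  refine h x ?_
  by_contra hcon
  exact hx ⟨subset_closure hxK, hcon⟩

theorem gradient_congr_interior {s : Set (E d)} {f g : E d → ℝ} (h : EqOn f g s) {x : E d}
    (hx : x ∈ interior s) : gradient f x = gradient g x := by
  have h1 : f =ᶠ[𝓝 x] g := by
    filter_upwards [mem_interior_iff_mem_nhds.1 hx] with y hy using h hy
  rw [gradient, gradient, h1.fderiv_eq]

/-! ### Local approximation estimates -/

theorem exists_fderiv_sup (d j : ℕ) {r : ℝ} (R : ℝ) (hr : 0 < r) :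
    ∃ C, 0 < C ∧ ∀ (K : Finset (E d)) (h : ℝ), HasShape r R h K → ∀ v ∈ polySpace d j,
      ∀ x ∈ convexHull ℝ (K : Set (E d)),
        ‖fderiv ℝ v x‖ ^ 2 ≤ C * ((h ^ d)⁻¹ * intElem K fun x => ‖gradient v x‖ ^ 2) := by
  obtain ⟨C, hC, H⟩ := exists_elem_inverse d (j - 1) R hr
  refine ⟨C, hC, fun K h hK v hv x hx => ?_⟩
  have hc : ∀ i : Fin d, Continuous fun x => fderiv ℝ v x (EuclideanSpace.single i 1) ^ 2 :=
    fun i => (continuous_of_mem_polySpace (fderiv_apply_mem_polySpace hv _)).pow 2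
  have e1 : intElem K (fun x => ‖gradient v x‖ ^ 2) =
      ∑ i, intElem K fun x => fderiv ℝ v x (EuclideanSpace.single i 1) ^ 2 := by
    unfold intElem
    simp only [norm_gradient, norm_clm_sq]
    rw [integral_finsetSum _ fun i _ => integrableOn_elem_of_continuousOn
      (hc i).continuousOn]
  rw [e1, norm_clm_sq, Finset.mul_sum, Finset.mul_sum]
  exact Finset.sum_le_sum fun i _ => (H K h hK _ (fderiv_apply_mem_polySpace hv _) x hx).1

/-- A polynomial is approximated by the linear interpolant of nodal values close to its own. -/
theorem exists_interp_le (d j : ℕ) {r : ℝ} (R : ℝ) (hr : 0 < r) (hR : 0 ≤ R) :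
    ∃ C, 0 < C ∧ ∀ (K : Finset (E d)) (h : ℝ), HasShape r R h K → ∀ v ∈ polySpace d j,
      ∀ p ∈ polySpace d 1, ∀ D : ℝ, (∀ a ∈ K, |v a - p a| ≤ D) →
        intElem K (fun x => (v x - p x) ^ 2) ≤
          C * (h ^ 2 * intElem K (fun x => ‖gradient v x‖ ^ 2) + h ^ d * D ^ 2) := by
  obtain ⟨C, hC, H⟩ := exists_fderiv_sup d j R hr
  have hb := ballVol_nonneg d
  refine ⟨R ^ d * ballVol d * (2 * R ^ 2 * C + 2) + 1, by positivity,
    fun K h hK v hv p hp D hD => ?_⟩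
  have hh := hK.h_pos
  have hs := hK.simplex
  set G := intElem K fun x => ‖gradient v x‖ ^ 2
  have hG : 0 ≤ G := intElem_nonneg fun x => sq_nonneg _
  set S := Real.sqrt (C * ((h ^ d)⁻¹ * G)) with hS
  have hS2 : S ^ 2 = C * ((h ^ d)⁻¹ * G) := Real.sq_sqrt (by positivity)
  have hD0 : 0 ≤ D := by
    obtain ⟨a, ha⟩ := hs.nonempty
    exact (abs_nonneg _).trans (hD a ha)
  -- Write `v(x) - p(x) = ∑ λ_a(x) (v(x) - p(a))`: each term is a variation of `v` between `x` and
  -- `a`, bounded by the mean value inequality, plus the nodal error.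
  have hsup : ∀ x ∈ convexHull ℝ (K : Set (E d)), |v x - p x| ≤ S * (R * h) + D := by
    intro x hx
    have hlam := hs.mem_convexHull_iff.1 hx
    have h1 : v x - p x = ∑ a ∈ K, lam K a x * (v x - p a) := by
      simp only [mul_sub, Finset.sum_sub_distrib, ← Finset.sum_mul]
      rw [hs.sum_lam, one_mul, ← hs.eq_sum_lam hp]
    have h2 : ∀ a ∈ K, |v x - p a| ≤ S * (R * h) + D := by
      intro a ha
      have h3 := (convex_convexHull ℝ (K : Set (E d))).norm_image_sub_le_of_norm_fderiv_le
        (f := v) (C := S) (𝕜 := ℝ) (fun y _ => differentiable_of_mem_polySpace hv y)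
        (fun y hy => Real.le_sqrt_of_sq_le (H K h hK v hv y hy)) (vertex_mem ha) hx
      have h4 := hK.diam x hx a (vertex_mem ha)
      have h5 := abs_sub_le (v x) (v a) (p a)
      rw [Real.norm_eq_abs] at h3
      have h6 : S * ‖x - a‖ ≤ S * (R * h) := by gcongr
      linarith [hD a ha]
    rw [h1]
    refine (Finset.abs_sum_le_sum_abs _ _).trans ?_
    calc ∑ a ∈ K, |lam K a x * (v x - p a)| ≤ ∑ a ∈ K, lam K a x * (S * (R * h) + D) := by
          refine Finset.sum_le_sum fun a ha => ?_
          rw [abs_mul, abs_of_nonneg (hlam a ha)]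
          exact mul_le_mul_of_nonneg_left (h2 a ha) (hlam a ha)
      _ = _ := by rw [← Finset.sum_mul, hs.sum_lam, one_mul]
  have h1 := hK.intElem_le (f := fun x => (v x - p x) ^ 2)
    (M := 2 * R ^ 2 * h ^ 2 * (C * ((h ^ d)⁻¹ * G)) + 2 * D ^ 2) (by positivity) fun x hx => by
      rw [abs_of_nonneg (sq_nonneg _), ← sq_abs, ← hS2]
      have h2 := hsup x hx
      have h3 : |v x - p x| ^ 2 ≤ (S * (R * h) + D) ^ 2 := by gcongr
      nlinarith [sq_nonneg (S * (R * h) - D)]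
  refine h1.trans ?_
  have h2 : h ^ d * (2 * R ^ 2 * h ^ 2 * (C * ((h ^ d)⁻¹ * G)) + 2 * D ^ 2) =
      2 * R ^ 2 * C * (h ^ 2 * G) + 2 * (h ^ d * D ^ 2) := by field_simp
  rw [h2]
  have h3 : 0 ≤ h ^ 2 * G := by positivity
  have h4 : 0 ≤ h ^ d * D ^ 2 := by positivity
  have h5 : 2 * R ^ 2 * C * (h ^ 2 * G) + 2 * (h ^ d * D ^ 2) ≤
      (2 * R ^ 2 * C + 2) * (h ^ 2 * G + h ^ d * D ^ 2) := by
    have : 0 ≤ 2 * R ^ 2 * C := by positivity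
    nlinarith [mul_nonneg this h4]
  calc R ^ d * ballVol d * (2 * R ^ 2 * C * (h ^ 2 * G) + 2 * (h ^ d * D ^ 2))
      ≤ R ^ d * ballVol d * ((2 * R ^ 2 * C + 2) * (h ^ 2 * G + h ^ d * D ^ 2)) := by gcongr
    _ ≤ _ := by
      rw [← mul_assoc, add_mul (R ^ d * ballVol d * (2 * R ^ 2 * C + 2)), one_mul]
      linarith

/-- An orthogonal projection is a contraction: the hypothesis says that `u` and `g` have the same
pairing with `u`, and Young's inequality finishes. -/
theorem integral_sq_le_of_projection {X : Type*} [MeasurableSpace X] {μ : Measure X}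
    {u g : X → ℝ} (hu : Integrable (fun x => u x ^ 2) μ) (hg : Integrable (fun x => g x ^ 2) μ)
    (h : ∫ x, u x ^ 2 ∂μ = ∫ x, g x * u x ∂μ) : ∫ x, u x ^ 2 ∂μ ≤ ∫ x, g x ^ 2 ∂μ := by
  by_cases hgu : Integrable (fun x => g x * u x) μ
  · have h1 : ∫ x, g x * u x ∂μ ≤ ∫ x, (g x ^ 2 / 2 + u x ^ 2 / 2) ∂μ :=
      integral_mono hgu ((hg.div_const 2).add (hu.div_const 2)) fun x => by
        simp only
        nlinarith [sq_nonneg (g x - u x)]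
    rw [integral_add (hg.div_const 2) (hu.div_const 2), integral_div, integral_div] at h1
    linarith
  -- If the product is not integrable its integral is 0 by convention, and so is the left side.
  · rw [h, integral_undef hgu]
    exact integral_nonneg fun x => sq_nonneg _

end WG

namespace WG

open scoped Classical Topology

/-! ### Approximation by the conforming companion -/

variable {d : ℕ} {Ω : Set (E d)}

/-- The squared jump `‖v_0 - v_b‖²` over the boundary of the element `K`. -/
noncomputable def jumpSq {T : Mesh Ω} (v : WeakFun T) (K : T.elements) : ℝ :=
  sumFaces T K fun e => intFace e.1 fun x => (v.1 K x - v.2 e x) ^ 2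

theorem jumpSq_nonneg {T : Mesh Ω} (v : WeakFun T) (K : T.elements) : 0 ≤ jumpSq v K :=
  sumFaces_nonneg K fun _ => intFace_nonneg fun _ => sq_nonneg _

theorem intFace_le_jumpSq {T : Mesh Ω} (v : WeakFun T) (K : T.elements) {e : T.faces}
    (he : e.1 ⊆ K.1) : intFace e.1 (fun x => (v.1 K x - v.2 e x) ^ 2) ≤ jumpSq v K :=
  Finset.single_le_sum (f := fun e : T.faces => intFace e.1 fun x => (v.1 K x - v.2 e x) ^ 2)
    (fun _ _ => intFace_nonneg fun _ => sq_nonneg _)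
    (Finset.mem_filter.2 ⟨Finset.mem_univ e, he⟩)

/-- Both traces have degree at most `j + 1` for either pair, so the inverse inequality on the face
bounds the pointwise jump. -/
theorem exists_jump_le (d j : ℕ) (pr : Pair) (hd : 1 ≤ d) {r : ℝ} (R : ℝ) (hr : 0 < r) :
    ∃ C, 0 < C ∧ ∀ (Ω : Set (E d)) (T : Mesh Ω) (h : ℝ), (∀ K ∈ T.elements, HasShape r R h K) →
      ∀ (v : Vh T pr j) (K : T.elements) (e : T.faces), e.1 ⊆ K.1 →
        ∀ x ∈ convexHull ℝ (e.1 : Set (E d)),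
          ((v : WeakFun T).1 K x - (v : WeakFun T).2 e x) ^ 2 ≤
            C * ((h ^ (d - 1))⁻¹ * jumpSq (v : WeakFun T) K) := by
  obtain ⟨C, hC, H⟩ := exists_face_inverse d (j + 1) hd R 0 hr
  refine ⟨C, hC, fun Ω T h hT v K e he x hx => ?_⟩
  have hS := hT K.1 K.2
  have hh := hS.h_pos
  obtain ⟨a, ha, hea⟩ := (mem_powersetCard_iff (T.card_eq _ K.2)).1
    (Finset.mem_powersetCard.2 ⟨he, T.card_face e.2⟩)
  obtain ⟨p, hp, hpv⟩ := mem_facePoly.1 (v.2.2.1 e)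
  have hpx : ∀ y ∈ convexHull ℝ (e.1 : Set (E d)), (v : WeakFun T).2 e y = p y := fun y hy => by
    rw [← hpv, indicator_of_mem hy]
  have hmem : (fun y => (v : WeakFun T).1 K y - p y) ∈ polySpace d (j + 1) :=
    sub_fun_mem_polySpace (polySpace_mono (by omega) (v.2.1 K))
      (polySpace_mono (by cases pr <;> simp [Pair.faceDeg]) hp)
  have hx' : x ∈ convexHull ℝ ((K.1.erase a : Finset (E d)) : Set (E d)) := by rwa [← hea]
  have h1 := H K.1 h hS a ha _ hmem x ((hS.simplex.mem_face_erase_iff ha).1 hx').2 x hx' (by simp)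
  have h2 : intFace (K.1.erase a) (fun y => ((v : WeakFun T).1 K y - p y) ^ 2) =
      intFace e.1 fun y => ((v : WeakFun T).1 K y - (v : WeakFun T).2 e y) ^ 2 := by
    rw [← hea]
    refine setIntegral_congr_fun (isClosed_face _).measurableSet fun y hy => ?_
    simp only [hpx y hy]
  rw [h2] at h1
  rw [hpx x hx]
  refine h1.trans ?_
  have := intFace_le_jumpSq (v : WeakFun T) K he
  gcongr

theorem Mesh.card_elements_le (T : Mesh Ω) (a : E d) :
    (Finset.univ.filter fun K : T.elements => a ∈ K.1).card ≤
      (T.elements.filter fun K => a ∈ K).card :=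
  Finset.card_le_card_of_injOn Subtype.val
    (fun K hK => Finset.mem_filter.2 ⟨K.2, (Finset.mem_filter.1 hK).2⟩)
    Subtype.val_injective.injOn

/-- Each element is counted a bounded number of times in the sum over the vertex patches. -/
theorem Mesh.sum_patch_le (T : Mesh Ω) {N : ℝ}
    (hN : ∀ x : E d, ((T.elements.filter fun K => x ∈ K).card : ℝ) ≤ N) (Y : T.elements → ℝ)
    (hY : ∀ K, 0 ≤ Y K) :
    ∑ K : T.elements, ∑ a ∈ K.1, ∑ K' : T.elements with a ∈ K'.1, Y K' ≤
      N * ((d + 1) * ∑ K : T.elements, Y K) := by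
  have hmem : ∀ (K : T.elements) (a : E d), K ∈ Finset.univ ∧ a ∈ K.1 ↔
      (K ∈ Finset.univ.filter fun K : T.elements => a ∈ K.1) ∧ a ∈ T.vertices := by
    intro K a
    simp only [Finset.mem_univ, true_and, Finset.mem_filter]
    exact ⟨fun h => ⟨h, Finset.mem_biUnion.2 ⟨K.1, K.2, h⟩⟩, fun h => h.1⟩
  -- Interchange elements and vertices: at most `N` elements share a vertex, and each element has `d
  -- + 1` vertices.
  rw [Finset.sum_comm' (f := fun _ a => ∑ K' : T.elements with a ∈ K'.1, Y K') hmem]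
  calc ∑ a ∈ T.vertices, ∑ _K : T.elements with a ∈ _K.1, ∑ K' : T.elements with a ∈ K'.1, Y K'
      ≤ ∑ a ∈ T.vertices, N * ∑ K' : T.elements with a ∈ K'.1, Y K' := by
        refine Finset.sum_le_sum fun a _ => ?_
        rw [Finset.sum_const, nsmul_eq_mul]
        refine mul_le_mul_of_nonneg_right (le_trans ?_ (hN a)) (Finset.sum_nonneg fun K _ => hY K)
        exact_mod_cast T.card_elements_le a
    _ = N * ((d + 1) * ∑ K : T.elements, Y K) := by
        have h1 : ∑ a ∈ T.vertices, ∑ K' : T.elements with a ∈ K'.1, Y K' =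
            ∑ K : T.elements, ∑ _a ∈ K.1, Y K := (Finset.sum_comm' hmem).symm
        rw [← Finset.mul_sum, h1]
        congr 1
        rw [Finset.mul_sum]
        refine Finset.sum_congr rfl fun K _ => ?_
        rw [Finset.sum_const, T.card_eq K.1 K.2, nsmul_eq_mul]
        push_cast
        ring

theorem Mesh.le_sum_patch (T : Mesh Ω) {Y : T.elements → ℝ} (hY : ∀ K, 0 ≤ Y K)
    {K K' : T.elements} {a : E d} (ha : a ∈ K.1) (ha' : a ∈ K'.1) :
    Y K' ≤ ∑ a ∈ K.1, ∑ K' : T.elements with a ∈ K'.1, Y K' := by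
  have h1 := Finset.single_le_sum (f := fun a => ∑ K' : T.elements with a ∈ K'.1, Y K')
    (fun a _ => Finset.sum_nonneg fun K' _ => hY K') ha
  refine le_trans ?_ h1
  exact Finset.single_le_sum (fun K' _ => hY K')
    (Finset.mem_filter.2 ⟨Finset.mem_univ _, ha'⟩)

theorem seminormSq1h_eq {T : Mesh Ω} (h : ℝ) (v : WeakFun T) : seminormSq1h h v =
    ∑ K : T.elements, intElem K.1 (fun x => ‖gradient (v.1 K) x‖ ^ 2) +
      h⁻¹ * ∑ K : T.elements, jumpSq v K := by
  rw [seminormSq1h, Finset.mul_sum, ← Finset.sum_add_distrib]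
  rfl

/-- A single-valued function cancels in the jumps, which are therefore those of `v`. -/
theorem seminormSq1h_sub_toWeak {T : Mesh Ω} (h : ℝ) (v : WeakFun T) (w : E d → ℝ) :
    seminormSq1h h (v - toWeak T w) =
      ∑ K : T.elements, intElem K.1 (fun x => ‖gradient (v.1 K - w) x‖ ^ 2) +
        h⁻¹ * ∑ K : T.elements, jumpSq v K := by
  rw [seminormSq1h, Finset.mul_sum, ← Finset.sum_add_distrib]
  simp only [toWeak, Prod.fst_sub, Prod.snd_sub, Pi.sub_apply, sub_sub_sub_cancel_right]
  rfl

theorem normSq0h_sub_toWeak {T : Mesh Ω} (h : ℝ) (v : WeakFun T) (w : E d → ℝ) :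
    normSq0h h (v - toWeak T w) =
      ∑ K : T.elements, intElem K.1 (fun x => (v.1 K x - w x) ^ 2) +
        h * ∑ K : T.elements, jumpSq v K := by
  rw [normSq0h, Finset.mul_sum, ← Finset.sum_add_distrib]
  simp only [toWeak, Prod.fst_sub, Prod.snd_sub, Pi.sub_apply, sub_sub_sub_cancel_right]
  rfl

/-- The nodal errors of `P v` are bounded by the jumps over the vertex patch, and `exists_interp_le`
turns them into an `L²` bound; the overlap of the patches is bounded by `Mesh.sum_patch_le`. -/
theorem exists_opP_l2 (d j : ℕ) (pr : Pair) (hd : 2 ≤ d) {r R : ℝ} (hr : 0 < r) (hR : 0 ≤ R) :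
    ∃ C, 0 < C ∧ ∀ (Ω : Set (E d)) (_ : IsOpen Ω) (T : Mesh Ω) (h : ℝ) (_ : 0 < h),
      (∀ K ∈ T.elements, HasShape r R h K) → ∀ (c : ConvexWeights T) (v : Vh T pr j),
        ∑ K : T.elements, intElem K.1 (fun x =>
          ((v : WeakFun T).1 K x - (opP pr j c v : E d → ℝ) x) ^ 2) ≤
          C * (h ^ 2 * seminormSq1h h (v : WeakFun T)) := by
  obtain ⟨C₁, hC₁, H₁⟩ := exists_interp_le d j R hr hR
  obtain ⟨C₂, hC₂, H₂⟩ := exists_jump_le d j pr (by omega) R hr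
  obtain ⟨N, hN, HN⟩ := exists_card_bound d (by omega) R hr
  refine ⟨C₁ * (1 + (2 * N + 1) ^ 2 * C₂ * (N * (d + 1))), by positivity,
    fun Ω hΩ T h hh hT c v => ?_⟩
  set w := opP pr j c v
  obtain ⟨G, hGdef⟩ : ∃ G : T.elements → ℝ, ∀ K, G K =
    intElem K.1 fun x => ‖gradient ((v : WeakFun T).1 K) x‖ ^ 2 := ⟨_, fun _ => rfl⟩
  have hG : ∀ K, 0 ≤ G K := fun K => by rw [hGdef]; exact intElem_nonneg fun x => sq_nonneg _
  obtain ⟨Y, hYdef⟩ : ∃ Y : T.elements → ℝ, ∀ K, Y K = jumpSq (v : WeakFun T) K :=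
    ⟨_, fun _ => rfl⟩
  have hY : ∀ K, 0 ≤ Y K := fun K => by rw [hYdef]; exact jumpSq_nonneg _ K
  obtain ⟨Z, hZdef⟩ : ∃ Z : T.elements → ℝ, ∀ K, Z K =
    ∑ a ∈ K.1, ∑ K' : T.elements with a ∈ K'.1, Y K' := ⟨_, fun _ => rfl⟩
  have hZ : ∀ K, 0 ≤ Z K := fun K => by
    rw [hZdef]
    exact Finset.sum_nonneg fun a _ => Finset.sum_nonneg fun K' _ => hY K'
  have key : ∀ K : T.elements, intElem K.1 (fun x =>
      ((v : WeakFun T).1 K x - (w : E d → ℝ) x) ^ 2) ≤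
      C₁ * (h ^ 2 * G K + (2 * N + 1) ^ 2 * C₂ * (h * Z K)) := by
    intro K
    obtain ⟨p, hp, hwp⟩ := w.2.2.1 K.1 K.2
    have h1 : intElem K.1 (fun x => ((v : WeakFun T).1 K x - (w : E d → ℝ) x) ^ 2) =
        intElem K.1 fun x => ((v : WeakFun T).1 K x - p x) ^ 2 :=
      setIntegral_congr_fun (isClosed_face _).measurableSet fun x hx => by simp only [hwp hx]
    have hD : ∀ a ∈ K.1, |(v : WeakFun T).1 K a - p a| ≤
        (2 * N + 1) * Real.sqrt (C₂ * ((h ^ (d - 1))⁻¹ * Z K)) := by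
      intro a ha
      rw [← hwp (vertex_mem ha), opP_spec hΩ pr j c v (Finset.mem_biUnion.2 ⟨K.1, K.2, ha⟩)]
      refine T.abs_sub_value_le hd c K.2 ha (v : WeakFun T) (HN Ω T h hT a)
        (fun K' e hae heK' => ?_) fun e he => by rw [v.2.2.2 e he]; rfl
      refine Real.abs_le_sqrt ((H₂ Ω T h hT v K' e heK' a (vertex_mem hae)).trans ?_)
      have h2 : Y K' ≤ Z K := by
        rw [hZdef]
        exact T.le_sum_patch hY ha (heK' hae)
      rw [← hYdef]
      gcongr
    have h3 := H₁ K.1 h (hT K.1 K.2) _ (v.2.1 K) p hp _ hD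
    rw [h1]
    refine h3.trans_eq ?_
    rw [← hGdef, mul_pow, Real.sq_sqrt (by have := hZ K; positivity)]
    -- The factor `h^d` of the nodal term against `h^{-(d-1)}` from the faces leaves `h`, the weight
    -- of the jumps in `h² |v|_{1,h}²`.
    have h4 : h ^ d = h * h ^ (d - 1) := by rw [← pow_succ']; congr 1; omega
    rw [h4]
    field_simp
  refine (Finset.sum_le_sum fun K _ => key K).trans ?_
  have hsum := T.sum_patch_le (HN Ω T h hT) Y hY
  simp only [← hZdef] at hsum
  rw [← Finset.mul_sum, Finset.sum_add_distrib, ← Finset.mul_sum, ← Finset.mul_sum,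
    ← Finset.mul_sum, seminormSq1h_eq]
  simp only [← hGdef, ← hYdef]
  have hSG : 0 ≤ ∑ K, G K := Finset.sum_nonneg fun K _ => hG K
  have hSY : 0 ≤ ∑ K, Y K := Finset.sum_nonneg fun K _ => hY K
  generalize ∑ K, G K = SG at *
  generalize ∑ K, Y K = SY at *
  have h5 : h ^ 2 * (SG + h⁻¹ * SY) = h ^ 2 * SG + h * SY := by field_simp
  rw [mul_assoc C₁ (1 + (2 * N + 1) ^ 2 * C₂ * (N * (d + 1)))]
  refine mul_le_mul_of_nonneg_left ?_ hC₁.le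
  rw [h5]
  have h6 : (2 * N + 1) ^ 2 * C₂ * (h * ∑ K, Z K) ≤
      (2 * N + 1) ^ 2 * C₂ * (h * (N * ((d + 1) * SY))) := by
    gcongr
  have h7 : 0 ≤ (2 * N + 1) ^ 2 * C₂ * (N * (d + 1)) * (h ^ 2 * SG) := by positivity
  have h8 : 0 ≤ h * SY := by positivity
  linarith

/-- On each element `v_0 - P v` is a polynomial of degree at most `j + 1`, so the inverse inequality
deduces this from the `L²` estimate. -/
theorem exists_opP_h1 (d j : ℕ) (pr : Pair) (hd : 2 ≤ d) {r R : ℝ} (hr : 0 < r) (hR : 0 ≤ R) :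
    ∃ C, 0 < C ∧ ∀ (Ω : Set (E d)) (_ : IsOpen Ω) (T : Mesh Ω) (h : ℝ) (_ : 0 < h),
      (∀ K ∈ T.elements, HasShape r R h K) → ∀ (c : ConvexWeights T) (v : Vh T pr j),
        ∑ K : T.elements, intElem K.1 (fun x =>
          ‖gradient ((v : WeakFun T).1 K - (opP pr j c v : E d → ℝ)) x‖ ^ 2) ≤
          C * seminormSq1h h (v : WeakFun T) := by
  obtain ⟨C₁, hC₁, H₁⟩ := exists_opP_l2 d j pr hd hr hR
  obtain ⟨C₂, hC₂, H₂⟩ := exists_gradient_inverse d (j + 1) R hr hR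
  refine ⟨C₂ * C₁, by positivity, fun Ω hΩ T h hh hT c v => ?_⟩
  have h1 := H₁ Ω hΩ T h hh hT c v
  set w := opP pr j c v
  have key : ∀ K : T.elements, intElem K.1 (fun x =>
      ‖gradient ((v : WeakFun T).1 K - (w : E d → ℝ)) x‖ ^ 2) ≤
      C₂ * ((h ^ 2)⁻¹ * intElem K.1 (fun x =>
          ((v : WeakFun T).1 K x - (w : E d → ℝ) x) ^ 2)) := by
    intro K
    obtain ⟨p, hp, hwp⟩ := w.2.2.1 K.1 K.2
    have h2 : (fun x => (v : WeakFun T).1 K x - p x) ∈ polySpace d (j + 1) :=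
      sub_fun_mem_polySpace (polySpace_mono (by omega) (v.2.1 K))
        (polySpace_mono (by omega) hp)
    have h3 := H₂ K.1 h (hT K.1 K.2) _ h2
    have h4 : intElem K.1 (fun x => ((v : WeakFun T).1 K x - (w : E d → ℝ) x) ^ 2) =
        intElem K.1 fun x => ((v : WeakFun T).1 K x - p x) ^ 2 :=
      setIntegral_congr_fun (isClosed_face _).measurableSet fun x hx => by simp only [hwp hx]
    rw [h4]
    refine le_trans (le_of_eq ?_) h3
    refine intElem_congr_interior fun x hx => ?_
    rw [gradient_congr_interior (s := convexHull ℝ (K.1 : Set (E d))) (g := fun x =>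
      (v : WeakFun T).1 K x - p x) (fun y hy => by simp only [Pi.sub_apply, hwp hy]) hx]
  refine (Finset.sum_le_sum fun K _ => key K).trans ?_
  rw [← Finset.mul_sum, ← Finset.mul_sum, mul_assoc]
  refine mul_le_mul_of_nonneg_left ?_ hC₂.le
  rw [inv_mul_le_iff₀ (by positivity)]
  linarith

end WG

namespace WG

open scoped Classical Topology

/-! ### The energy norm of the conforming companion -/

variable {d : ℕ} {Ω : Set (E d)}

/-- Subadditivity suffices for the energy bound, so disjointness of the elements up to null sets
never has to be established. -/
theorem setIntegral_biUnion_le {X ι : Type*} [MeasurableSpace X] {μ : Measure X} (s : Finset ι)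
    (t : ι → Set X) {f : X → ℝ} (hf : ∀ x, 0 ≤ f x) (hi : ∀ i ∈ s, IntegrableOn f (t i) μ) :
    ∫ x in ⋃ i ∈ s, t i, f x ∂μ ≤ ∑ i ∈ s, ∫ x in t i, f x ∂μ := by
  induction s using Finset.induction_on with
  | empty => simp
  | insert a s ha ih =>
    have h1 := hi a (Finset.mem_insert_self a s)
    have h2 : IntegrableOn f (⋃ i ∈ s, t i) μ :=
      integrableOn_finset_iUnion.2 fun i his => hi i (Finset.mem_insert_of_mem his)
    rw [Finset.set_biUnion_insert, Finset.sum_insert ha]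
    calc ∫ x in t a ∪ ⋃ i ∈ s, t i, f x ∂μ
        ≤ ∫ x, f x ∂(μ.restrict (t a) + μ.restrict (⋃ i ∈ s, t i)) :=
          integral_mono_measure (Measure.restrict_union_le _ _)
            (Filter.Eventually.of_forall hf) (Integrable.add_measure h1 h2)
      _ = ∫ x in t a, f x ∂μ + ∫ x in ⋃ i ∈ s, t i, f x ∂μ := integral_add_measure h1 h2
      _ ≤ _ := by
        have := ih fun i his => hi i (Finset.mem_insert_of_mem his)
        linarith

theorem confVh_integrableOn_gradient {T : Mesh Ω} {w : E d → ℝ} (hw : w ∈ confVh T)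
    {K : Finset (E d)} (hK : K ∈ T.elements) :
    IntegrableOn (fun x => ‖gradient w x‖ ^ 2) (convexHull ℝ (K : Set (E d))) := by
  obtain ⟨p, hp, hwp⟩ := hw.2.1 K hK
  have h1 : IntegrableOn (fun x => ‖gradient p x‖ ^ 2) (convexHull ℝ (K : Set (E d))) :=
    integrableOn_elem_of_continuousOn (by have := continuous_gradient hp; fun_prop)
  refine h1.congr ?_
  have h2 : ∀ᵐ x ∂(volume : Measure (E d)), x ∉ frontier (convexHull ℝ (K : Set (E d))) :=
    measure_eq_zero_iff_ae_notMem.1 ((convex_convexHull ℝ _).addHaar_frontier volume)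
  rw [Filter.EventuallyEq, ae_restrict_iff' (isClosed_face K).measurableSet]
  filter_upwards [h2] with x hx hxK
  have hxi : x ∈ interior (convexHull ℝ (K : Set (E d))) := by
    by_contra hcon
    exact hx ⟨subset_closure hxK, hcon⟩
  rw [gradient_congr_interior hwp hxi]

theorem integral_pairing_gradient_le {α β : ℝ} {𝔸 : E d → Matrix (Fin d) (Fin d) ℝ}
    (h𝔸 : IsDiffusion Ω α β 𝔸) (hα : 0 ≤ α) (hΩ : IsOpen Ω) {T : Mesh Ω} {w : E d → ℝ}
    (hw : w ∈ confVh T) :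
    ∫ x in Ω, pairing (𝔸 x) (gradient w x) (gradient w x) ≤
      |β| * ∑ K : T.elements, intElem K.1 fun x => ‖gradient w x‖ ^ 2 := by
  have hU : IntegrableOn (fun x => ‖gradient w x‖ ^ 2)
      (⋃ K ∈ T.elements, convexHull ℝ (K : Set (E d))) :=
    integrableOn_finset_iUnion.2 fun K hK => confVh_integrableOn_gradient hw hK
  have hsub : Ω ⊆ ⋃ K ∈ T.elements, convexHull ℝ (K : Set (E d)) := by
    rw [← T.closure_eq]
    exact subset_closure
  have hΩi := hU.mono_set hsub
  have h1 : ∫ x in Ω, pairing (𝔸 x) (gradient w x) (gradient w x) ≤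
      ∫ x in Ω, |β| * ‖gradient w x‖ ^ 2 := by
    -- Nonnegativity of the left integrand replaces its integrability.
    refine integral_mono_of_nonneg ?_ (hΩi.const_mul _) ?_
    · filter_upwards [ae_restrict_mem hΩ.measurableSet] with x hx
      exact le_trans (by positivity) (h𝔸.le_pairing hx _)
    · filter_upwards [ae_restrict_mem hΩ.measurableSet] with x hx
      refine (h𝔸.pairing_le hx _).trans ?_
      have := le_abs_self β
      gcongr
  refine h1.trans ?_
  rw [integral_const_mul]
  refine mul_le_mul_of_nonneg_left ?_ (abs_nonneg β)
  calc ∫ x in Ω, ‖gradient w x‖ ^ 2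
      ≤ ∫ x in ⋃ K ∈ T.elements, convexHull ℝ (K : Set (E d)), ‖gradient w x‖ ^ 2 :=
        setIntegral_mono_set hU (Filter.Eventually.of_forall fun x => sq_nonneg _)
          hsub.eventuallyLE
    _ ≤ ∑ K ∈ T.elements, ∫ x in convexHull ℝ (K : Set (E d)), ‖gradient w x‖ ^ 2 :=
        setIntegral_biUnion_le T.elements (fun K : Finset (E d) => convexHull ℝ (K : Set (E d)))
          (fun x => sq_nonneg _) fun K hK => confVh_integrableOn_gradient hw hK
    _ = _ := (Finset.sum_coe_sort T.elements fun K => intElem K fun x => ‖gradient w x‖ ^ 2).symm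

theorem intElem_gradient_le {T : Mesh Ω} {w : E d → ℝ} (hw : w ∈ confVh T) (K : T.elements)
    {j : ℕ} {v : E d → ℝ} (hv : v ∈ polySpace d j) :
    intElem K.1 (fun x => ‖gradient w x‖ ^ 2) ≤
      2 * intElem K.1 (fun x => ‖gradient v x‖ ^ 2) +
        2 * intElem K.1 fun x => ‖gradient (v - w) x‖ ^ 2 := by
  obtain ⟨p, hp, hwp⟩ := hw.2.1 K.1 K.2
  have hvp : EqOn (v - w) (fun x => v x - p x) (convexHull ℝ (K.1 : Set (E d))) := fun x hx => by
    simp only [Pi.sub_apply, hwp hx]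
  have hmem : (fun x => v x - p x) ∈ polySpace d (j + 1) :=
    sub_fun_mem_polySpace (polySpace_mono (by omega) hv) (polySpace_mono (by omega) hp)
  rw [intElem_congr_interior (f := fun x => ‖gradient w x‖ ^ 2) (g := fun x => ‖gradient p x‖ ^ 2)
      fun x hx => by simp only [gradient_congr_interior hwp hx],
    intElem_congr_interior (f := fun x => ‖gradient (v - w) x‖ ^ 2)
      (g := fun x => ‖gradient (fun x => v x - p x) x‖ ^ 2)
      fun x hx => by simp only [gradient_congr_interior hvp hx],
    ← intElem_const_mul, ← intElem_const_mul]
  have c1 := continuous_gradient hv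
  have c2 := continuous_gradient hp
  have c3 := continuous_gradient hmem
  rw [← intElem_add (by fun_prop) (by fun_prop)]
  refine integral_mono (integrableOn_elem_of_continuousOn (by fun_prop))
    (integrableOn_elem_of_continuousOn (by fun_prop)) fun x => ?_
  have h1 : gradient p x = gradient v x - gradient (fun x => v x - p x) x := by
    rw [gradient, gradient, gradient, fderiv_fun_sub (differentiable_of_mem_polySpace hv x)
      (differentiable_of_mem_polySpace hp x), map_sub, sub_sub_cancel]
  simp only
  rw [h1]
  have h2 := norm_sub_le (gradient v x) (gradient (fun x => v x - p x) x)
  have h3 : ‖gradient v x - gradient (fun x => v x - p x) x‖ ^ 2 ≤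
      (‖gradient v x‖ + ‖gradient (fun x => v x - p x) x‖) ^ 2 := by gcongr
  nlinarith [sq_nonneg (‖gradient v x‖ - ‖gradient (fun x => v x - p x) x‖)]

/-! ### Stability of the projection `Π` -/

theorem Mesh.intFace_mono (T : Mesh Ω) (hd : 1 ≤ d) {e : Finset (E d)} (he : e ∈ T.faces)
    {f g : E d → ℝ} (hf : ContinuousOn f (convexHull ℝ (e : Set (E d))))
    (hg : ContinuousOn g (convexHull ℝ (e : Set (E d))))
    (h : ∀ x ∈ convexHull ℝ (e : Set (E d)), f x ≤ g x) : intFace e f ≤ intFace e g :=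
  setIntegral_mono_on (T.integrableOn_face hd he hf) (T.integrableOn_face hd he hg)
    (isClosed_face e).measurableSet h

theorem Mesh.intFace_sq_add_le (T : Mesh Ω) (hd : 1 ≤ d) {e : Finset (E d)} (he : e ∈ T.faces)
    {f g k : E d → ℝ} (hf : ContinuousOn f (convexHull ℝ (e : Set (E d))))
    (hg : ContinuousOn g (convexHull ℝ (e : Set (E d))))
    (hk : ∀ x ∈ convexHull ℝ (e : Set (E d)), k x = f x - g x) :
    intFace e (fun x => k x ^ 2) ≤
      2 * intFace e (fun x => f x ^ 2) + 2 * intFace e fun x => g x ^ 2 := by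
  have hkc : ContinuousOn k (convexHull ℝ (e : Set (E d))) := (hf.sub hg).congr hk
  have hf2 : ContinuousOn (fun x => 2 * f x ^ 2) (convexHull ℝ (e : Set (E d))) :=
    continuousOn_const.mul (hf.pow 2)
  have hg2 : ContinuousOn (fun x => 2 * g x ^ 2) (convexHull ℝ (e : Set (E d))) :=
    continuousOn_const.mul (hg.pow 2)
  rw [← intFace_const_mul, ← intFace_const_mul, ← T.intFace_add hd he hf2 hg2]
  refine T.intFace_mono hd he (hkc.pow 2) (hf2.add hg2) fun x hx => ?_
  rw [hk x hx]
  nlinarith [sq_nonneg (f x + g x)]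

/-- `Q_0` fixes `v_0`, so `v_0 - Q_0 w` is the projection of `v_0 - w`, and projections contract. -/
theorem opPi_elem_le (hΩ : IsOpen Ω) {T : Mesh Ω} (hd : 1 ≤ d) {pr : Pair} {j : ℕ}
    (v : Vh T pr j) (w : confVh T) (K : T.elements) :
    intElem K.1 (fun x => ((v : WeakFun T).1 K x - (opPi T pr j w : WeakFun T).1 K x) ^ 2) ≤
      intElem K.1 fun x => ((v : WeakFun T).1 K x - (w : E d → ℝ) x) ^ 2 := by
  have hq : (fun x => (v : WeakFun T).1 K x - (opPi T pr j w : WeakFun T).1 K x) ∈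
      polySpace d j := sub_fun_mem_polySpace (v.2.1 K) ((opPi T pr j w).2.1 K)
  have hspec := (opPi_spec hΩ T hd pr j w).1 K _ hq
  have c1 := continuous_of_mem_polySpace (v.2.1 K)
  have c2 := continuous_of_mem_polySpace ((opPi T pr j w).2.1 K)
  have c3 := w.2.1
  refine integral_sq_le_of_projection (integrableOn_elem_of_continuousOn (by fun_prop))
    (integrableOn_elem_of_continuousOn (by fun_prop)) ?_
  simp only [sq, sub_mul _ _ ((v : WeakFun T).1 K _ - (opPi T pr j w : WeakFun T).1 K _)]
  rw [integral_sub (integrableOn_elem_of_continuousOn (by fun_prop))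
    (integrableOn_elem_of_continuousOn (by fun_prop)),
    integral_sub (integrableOn_elem_of_continuousOn (by fun_prop))
    (integrableOn_elem_of_continuousOn (by fun_prop))]
  congr 1

theorem opPi_face_le (hΩ : IsOpen Ω) {T : Mesh Ω} (hd : 1 ≤ d) {pr : Pair} {j : ℕ}
    (v : Vh T pr j) (w : confVh T) (e : T.faces) :
    intFace e.1 (fun x => ((v : WeakFun T).2 e x - (opPi T pr j w : WeakFun T).2 e x) ^ 2) ≤
      intFace e.1 fun x => ((v : WeakFun T).2 e x - (w : E d → ℝ) x) ^ 2 := by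
  have hq : (v : WeakFun T).2 e - (opPi T pr j w : WeakFun T).2 e ∈
      facePoly e.1 (pr.faceDeg j) := Submodule.sub_mem _ (v.2.2.1 e) ((opPi T pr j w).2.2.1 e)
  have hspec := (opPi_spec hΩ T hd pr j w).2 e _ hq
  have c1 := continuousOn_of_mem_facePoly (v.2.2.1 e)
  have c2 := continuousOn_of_mem_facePoly ((opPi T pr j w).2.2.1 e)
  have c3 := w.2.1.continuousOn (s := convexHull ℝ (e.1 : Set (E d)))
  refine integral_sq_le_of_projection (T.integrableOn_face hd e.2 ((c1.sub c2).pow 2))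
    (T.integrableOn_face hd e.2 ((c1.sub c3).pow 2)) ?_
  simp only [sq, sub_mul _ _ ((v : WeakFun T).2 e _ - (opPi T pr j w : WeakFun T).2 e _)]
  have hi : ∀ {f : E d → ℝ}, ContinuousOn f (convexHull ℝ (e.1 : Set (E d))) →
      IntegrableOn (fun x => f x * ((v : WeakFun T).2 e x - (opPi T pr j w : WeakFun T).2 e x))
        (convexHull ℝ (e.1 : Set (E d))) μHE[d - 1] :=
    fun hf => T.integrableOn_face hd e.2 (hf.mul (c1.sub c2))
  rw [integral_sub (hi c1) (hi c2), integral_sub (hi c1) (hi c3)]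
  congr 1

theorem exists_opPi_stable (d j : ℕ) (pr : Pair) (hd : 1 ≤ d) {r : ℝ} (R : ℝ) (hr : 0 < r) :
    ∃ C, 0 < C ∧ ∀ (Ω : Set (E d)) (_ : IsOpen Ω) (T : Mesh Ω) (h : ℝ) (_ : 0 < h),
      (∀ K ∈ T.elements, HasShape r R h K) → ∀ (v : Vh T pr j) (w : confVh T),
        normSq0h h ((v : WeakFun T) - (opPi T pr j w : WeakFun T)) ≤
          C * normSq0h h ((v : WeakFun T) - toWeak T (w : E d → ℝ)) := by
  obtain ⟨C, hC, H⟩ := exists_trace d (j + 1) hd R hr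
  -- On a face the jump of `v - Π w` splits into the trace of `v_0 - Q_0 w` and `v_b - Q_b w`; the
  -- latter is contracted to `v_b - w`, which splits into the trace of `v_0 - w` and the jump of
  -- `v`. The two traces cost `2 C + 4 C` on each of the `d + 1` faces, the jump costs 4, and the
  -- element term costs 1.
  refine ⟨5 + 6 * C * (d + 1), by positivity, fun Ω hΩ T h hh hT v w => ?_⟩
  rw [normSq0h_sub_toWeak, normSq0h, Finset.mul_sum, ← Finset.sum_add_distrib, Finset.mul_sum]
  refine Finset.sum_le_sum fun K _ => ?_
  have hS := hT K.1 K.2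
  have hs := hS.simplex
  set q := opPi T pr j w
  obtain ⟨p, hp, hwp⟩ := w.2.2.1 K.1 K.2
  simp only [Prod.fst_sub, Prod.snd_sub, Pi.sub_apply]
  obtain ⟨X, hXdef⟩ : ∃ X, X = intElem K.1 fun x =>
    ((v : WeakFun T).1 K x - (w : E d → ℝ) x) ^ 2 := ⟨_, rfl⟩
  have hX : 0 ≤ X := by rw [hXdef]; exact intElem_nonneg fun x => sq_nonneg _
  have hXp : intElem K.1 (fun x => ((v : WeakFun T).1 K x - p x) ^ 2) = X := by
    rw [hXdef]
    exact setIntegral_congr_fun (isClosed_face _).measurableSet fun x hx => by simp only [hwp hx]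
  have h1 := opPi_elem_le hΩ hd v w K
  rw [← hXdef] at h1 ⊢
  have cv := continuous_of_mem_polySpace (v.2.1 K)
  have cq := continuous_of_mem_polySpace (q.2.1 K)
  have cp := continuous_of_mem_polySpace hp
  have cw := w.2.1
  have hface : ∀ e : T.faces, e.1 ⊆ K.1 → intFace e.1 (fun x =>
      ((v : WeakFun T).1 K x - (q : WeakFun T).1 K x -
        ((v : WeakFun T).2 e x - (q : WeakFun T).2 e x)) ^ 2) ≤
      6 * C * (h⁻¹ * X) + 4 * intFace e.1 fun x =>
        ((v : WeakFun T).1 K x - (v : WeakFun T).2 e x) ^ 2 := by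
    intro e he
    obtain ⟨a, ha, hea⟩ := (mem_powersetCard_iff (T.card_eq _ K.2)).1
      (Finset.mem_powersetCard.2 ⟨he, T.card_face e.2⟩)
    have cve := continuousOn_of_mem_facePoly (v.2.2.1 e)
    have cqe := continuousOn_of_mem_facePoly (q.2.2.1 e)
    have f1 := T.intFace_sq_add_le hd e.2 (k := fun x =>
      ((v : WeakFun T).1 K x - (q : WeakFun T).1 K x -
        ((v : WeakFun T).2 e x - (q : WeakFun T).2 e x))) (cv.sub cq).continuousOn
        (cve.sub cqe) fun x _ => rfl
    have f2 := opPi_face_le hΩ hd v w e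
    have f3 := T.intFace_sq_add_le hd e.2 (k := fun x =>
      (v : WeakFun T).2 e x - (w : E d → ℝ) x) (cv.sub cp).continuousOn
        (cv.continuousOn.sub cve) fun x hx => by
          rw [hwp (face_subset he hx)]
          simp only [Pi.sub_apply]
          ring
    have t1 := H K.1 h hS a ha _ (sub_fun_mem_polySpace
      (polySpace_mono (by omega : j ≤ j + 1) (v.2.1 K)) (polySpace_mono (by omega) (q.2.1 K)))
    have t2 := H K.1 h hS a ha _ (sub_fun_mem_polySpace
      (polySpace_mono (by omega : j ≤ j + 1) (v.2.1 K)) (polySpace_mono (by omega) hp))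
    rw [← hea] at t1 t2
    rw [hXp] at t2
    have t3 : C * (h⁻¹ * intElem K.1 fun x =>
        ((v : WeakFun T).1 K x - (q : WeakFun T).1 K x) ^ 2) ≤ C * (h⁻¹ * X) := by gcongr
    simp only [Pi.sub_apply] at f1 f2 f3
    linarith
  have hsum : sumFaces T K (fun e => intFace e.1 fun x =>
      ((v : WeakFun T).1 K x - (q : WeakFun T).1 K x -
        ((v : WeakFun T).2 e x - (q : WeakFun T).2 e x)) ^ 2) ≤
      (d + 1) * (6 * C * (h⁻¹ * X)) + 4 * jumpSq (v : WeakFun T) K := by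
    calc _ ≤ sumFaces T K (fun e => 6 * C * (h⁻¹ * X) + 4 * intFace e.1 fun x =>
          ((v : WeakFun T).1 K x - (v : WeakFun T).2 e x) ^ 2) :=
          Finset.sum_le_sum fun e he => hface e (Finset.mem_filter.1 he).2
      _ = _ := by
        rw [sumFaces_add, sumFaces_const_mul T K 4,
          sumFaces_eq K (fun _ => 6 * C * (h⁻¹ * X)) (fun _ => 6 * C * (h⁻¹ * X))
            fun _ _ => rfl, Finset.sum_const, T.card_eq _ K.2, nsmul_eq_mul]
        push_cast
        rfl
  have hJ := jumpSq_nonneg (v : WeakFun T) K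
  have h2 := mul_le_mul_of_nonneg_left hsum hh.le
  have h3 : h * ((d + 1) * (6 * C * (h⁻¹ * X)) + 4 * jumpSq (v : WeakFun T) K) =
      6 * C * (d + 1) * X + 4 * (h * jumpSq (v : WeakFun T) K) := by field_simp
  rw [h3] at h2
  have h4 : 0 ≤ h * jumpSq (v : WeakFun T) K := by positivity
  have h5 : 0 ≤ 6 * C * (d + 1) * (h * jumpSq (v : WeakFun T) K) := by positivity
  nlinarith

end WG

/-! ### Assembly of the three estimates -/

/-- Exchanges the scale `s = h²` for `ρ⁻¹`. In the case `ρ = 0` the right side is 0 by convention,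
and the assumption that `a` then vanishes saves the inequality. -/
theorem WG.le_mul_inv_of_bounds {ρ a X c M s : ℝ} (hc : 0 ≤ c) (ha : 0 ≤ a) (hs : 0 < s)
    (hρ0 : 0 ≤ ρ) (hρ : ρ ≤ M * s⁻¹) (hz : ρ = 0 → a = 0) (hX : X ≤ c * (s * a)) :
    X ≤ c * M * (ρ⁻¹ * a) := by
  rcases hρ0.eq_or_lt with h0 | hpos
  · rw [hz h0.symm, mul_zero, mul_zero]
    rwa [hz h0.symm, mul_zero, mul_zero] at hX
  · have h1 : s ≤ M * ρ⁻¹ := by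
      rw [← div_eq_mul_inv, le_div_iff₀ hpos]
      rw [← div_eq_mul_inv, le_div_iff₀ hs] at hρ
      linarith
    calc X ≤ c * (s * a) := hX
      _ ≤ c * (M * ρ⁻¹ * a) := by gcongr
      _ = c * M * (ρ⁻¹ * a) := by ring

theorem mainTheorem6 (d : ℕ) (hd : d = 2 ∨ d = 3) (pr : WG.Pair) (j : ℕ)
    (σ γ α β : ℝ) (hσ : 0 < σ) (hγ : 0 < γ) (hα : 0 < α) :
    ∃ C : ℝ, 0 < C ∧
      ∀ (Ω : Set (WG.E d)), IsOpen Ω → Ω.Nonempty →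
      ∀ (T : WG.Mesh Ω) (h : ℝ), 0 < h → T.IsShapeRegular σ → T.IsQuasiUniform γ h →
      ∀ (𝔸 : WG.E d → Matrix (Fin d) (Fin d) ℝ), WG.IsDiffusion Ω α β 𝔸 →
      ∀ (c : WG.ConvexWeights T) (v : WG.Vh T pr j),
        (WG.normSq0h h ((v : WG.WeakFun T) - WG.toWeak T (WG.opP pr j c v)) +
            h ^ 2 * WG.seminormSq1h h ((v : WG.WeakFun T) - WG.toWeak T (WG.opP pr j c v)) ≤
          C * (h ^ 2 * WG.seminormSq1h h (v : WG.WeakFun T))) ∧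
        WG.normConfA Ω 𝔸 (WG.opP pr j c v) ≤ C * WG.normA pr j 𝔸 (v : WG.WeakFun T) ∧
        WG.normSq0h h ((v : WG.WeakFun T) - (WG.opPi T pr j (WG.opP pr j c v) : WG.WeakFun T)) ≤
          C * ((WG.rhoA T pr j h 𝔸)⁻¹ * WG.normA pr j 𝔸 (v : WG.WeakFun T) ^ 2) := by
  have hd2 : 2 ≤ d := by omega
  have hd1 : 1 ≤ d := by omega
  have hr : 0 < 1 / (γ * σ) := by positivity
  obtain ⟨C₁, hC₁, H₁⟩ := WG.exists_opP_l2 d j pr hd2 hr hγ.le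
  obtain ⟨C₂, hC₂, H₂⟩ := WG.exists_opP_h1 d j pr hd2 hr hγ.le
  obtain ⟨C₃, hC₃, H₃⟩ := WG.exists_seminorm_le d j pr hd1 hr hγ.le
  obtain ⟨C₄, hC₄, H₄⟩ := WG.exists_weakGrad_le d j pr hd1 hr hγ.le
  obtain ⟨C₅, hC₅, H₅⟩ := WG.exists_opPi_stable d j pr hd1 γ hr
  -- One summand for each of the three estimates.
  refine ⟨(C₁ + C₂ + 2) + Real.sqrt (|β| * (2 + 2 * C₂) * C₃ / α) +
    C₅ * (C₁ + 1) * C₃ / α * (|β| * C₄), by positivity, ?_⟩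
  intro Ω hΩ hne T h hh hS hQ 𝔸 h𝔸 c v
  have hT : ∀ K ∈ T.elements, WG.HasShape (1 / (γ * σ)) γ h K := fun K hK =>
    T.hasShape hσ hγ hh hS hQ hK
  have h1 := H₁ Ω hΩ T h hh hT c v
  have h2 := H₂ Ω hΩ T h hh hT c v
  have h3 := H₃ Ω T h hT v
  have h4 := WG.le_aForm h𝔸 hd1 hΩ pr j v
  have hs0 := WG.seminormSq1h_nonneg hh.le (v : WG.WeakFun T)
  have hs := WG.seminormSq1h_eq h (v : WG.WeakFun T)
  have hG0 : 0 ≤ ∑ K : T.elements, WG.intElem K.1 fun x =>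
      ‖gradient ((v : WG.WeakFun T).1 K) x‖ ^ 2 :=
    Finset.sum_nonneg fun K _ => WG.intElem_nonneg fun x => sq_nonneg _
  have hY0 : 0 ≤ ∑ K : T.elements, WG.jumpSq (v : WG.WeakFun T) K :=
    Finset.sum_nonneg fun K _ => WG.jumpSq_nonneg _ K
  have hYs : h * ∑ K : T.elements, WG.jumpSq (v : WG.WeakFun T) K ≤
      h ^ 2 * WG.seminormSq1h h (v : WG.WeakFun T) := by
    rw [hs, mul_add, show h ^ 2 * (h⁻¹ * ∑ K : T.elements, WG.jumpSq (v : WG.WeakFun T) K) =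
      h * ∑ K : T.elements, WG.jumpSq (v : WG.WeakFun T) K by field_simp]
    have : 0 ≤ h ^ 2 * ∑ K : T.elements, WG.intElem K.1 fun x =>
      ‖gradient ((v : WG.WeakFun T).1 K) x‖ ^ 2 := by positivity
    linarith
  have h5 := WG.normSq0h_sub_toWeak h (v : WG.WeakFun T) (WG.opP pr j c v)
  have h6 := WG.seminormSq1h_sub_toWeak h (v : WG.WeakFun T) (WG.opP pr j c v)
  have hl2 : WG.normSq0h h ((v : WG.WeakFun T) - WG.toWeak T (WG.opP pr j c v)) ≤
      (C₁ + 1) * (h ^ 2 * WG.seminormSq1h h (v : WG.WeakFun T)) := by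
    rw [h5]
    linarith
  have hh1 : WG.seminormSq1h h ((v : WG.WeakFun T) - WG.toWeak T (WG.opP pr j c v)) ≤
      (C₂ + 1) * WG.seminormSq1h h (v : WG.WeakFun T) := by
    rw [h6]
    linarith
  have hsA : WG.seminormSq1h h (v : WG.WeakFun T) ≤
      C₃ / α * WG.aForm pr j 𝔸 (v : WG.WeakFun T) (v : WG.WeakFun T) := by
    refine h3.trans ?_
    rw [div_mul_eq_mul_div, le_div_iff₀ hα, mul_assoc, mul_comm _ α]
    exact mul_le_mul_of_nonneg_left h4 hC₃.le
  have hA0 : 0 ≤ WG.aForm pr j 𝔸 (v : WG.WeakFun T) (v : WG.WeakFun T) :=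
    le_trans (mul_nonneg hα.le (Finset.sum_nonneg fun K _ =>
      WG.intElem_nonneg fun x => sq_nonneg _)) h4
  have hc2 : 0 ≤ Real.sqrt (|β| * (2 + 2 * C₂) * C₃ / α) := Real.sqrt_nonneg _
  have hc3 : 0 ≤ C₅ * (C₁ + 1) * C₃ / α * (|β| * C₄) := by positivity
  refine ⟨?_, ?_, ?_⟩
  · have h7 : 0 ≤ h ^ 2 * WG.seminormSq1h h (v : WG.WeakFun T) := by positivity
    have h8 := mul_le_mul_of_nonneg_left hh1 (sq_nonneg h)
    calc _ ≤ (C₁ + C₂ + 2) * (h ^ 2 * WG.seminormSq1h h (v : WG.WeakFun T)) := by linarith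
      _ ≤ _ := mul_le_mul_of_nonneg_right (by linarith) h7
  · have h7 : ∑ K : T.elements, WG.intElem K.1 (fun x =>
        ‖gradient (WG.opP pr j c v : WG.E d → ℝ) x‖ ^ 2) ≤
        (2 + 2 * C₂) * WG.seminormSq1h h (v : WG.WeakFun T) := by
      have h8 := Finset.sum_le_sum fun (K : T.elements) (_ : K ∈ Finset.univ) =>
        WG.intElem_gradient_le (WG.opP pr j c v).2 K (v.2.1 K)
      rw [Finset.sum_add_distrib, ← Finset.mul_sum, ← Finset.mul_sum] at h8
      have h9 : 0 ≤ h⁻¹ * ∑ K : T.elements, WG.jumpSq (v : WG.WeakFun T) K := by positivity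
      linarith
    have h8 := WG.integral_pairing_gradient_le h𝔸 hα.le hΩ (WG.opP pr j c v).2
    calc WG.normConfA Ω 𝔸 (WG.opP pr j c v)
        ≤ Real.sqrt (|β| * (2 + 2 * C₂) * C₃ / α *
            WG.aForm pr j 𝔸 (v : WG.WeakFun T) (v : WG.WeakFun T)) := by
          refine Real.sqrt_le_sqrt (h8.trans ?_)
          calc _ ≤ |β| * ((2 + 2 * C₂) *
                (C₃ / α * WG.aForm pr j 𝔸 (v : WG.WeakFun T) (v : WG.WeakFun T))) := by
                refine mul_le_mul_of_nonneg_left (h7.trans ?_) (abs_nonneg β)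
                exact mul_le_mul_of_nonneg_left hsA (by positivity)
            _ = _ := by ring
      _ = Real.sqrt (|β| * (2 + 2 * C₂) * C₃ / α) * WG.normA pr j 𝔸 (v : WG.WeakFun T) := by
          rw [Real.sqrt_mul (by positivity)]
          rfl
      _ ≤ _ := mul_le_mul_of_nonneg_right (by linarith) (Real.sqrt_nonneg _)
  · have h7 := (H₅ Ω hΩ T h hh hT v (WG.opP pr j c v)).trans
      (mul_le_mul_of_nonneg_left hl2 hC₅.le)
    have h8 : WG.normSq0h h ((v : WG.WeakFun T) -
        (WG.opPi T pr j (WG.opP pr j c v) : WG.WeakFun T)) ≤ C₅ * (C₁ + 1) * C₃ / α *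
          (h ^ 2 * WG.aForm pr j 𝔸 (v : WG.WeakFun T) (v : WG.WeakFun T)) := by
      refine h7.trans ?_
      calc _ ≤ C₅ * ((C₁ + 1) * (h ^ 2 *
            (C₃ / α * WG.aForm pr j 𝔸 (v : WG.WeakFun T) (v : WG.WeakFun T)))) := by gcongr
        _ = _ := by ring
    -- The Rayleigh quotient of `A` is at most a constant times `h⁻²`, hence so is its spectral
    -- radius.
    have hM : ∀ u : WG.Vh T pr j, WG.aForm pr j 𝔸 (u : WG.WeakFun T) (u : WG.WeakFun T) ≤
        |β| * C₄ * (h ^ 2)⁻¹ * WG.normSq0h h (u : WG.WeakFun T) := by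
      intro u
      have e1 := WG.aForm_le h𝔸 hd1 hΩ pr j u
      have e2 := H₄ Ω T h hT u
      have e3 : 0 ≤ ∑ K : T.elements, WG.intElem K.1 fun x =>
          ‖WG.weakGrad pr j (u : WG.WeakFun T) K x‖ ^ 2 :=
        Finset.sum_nonneg fun K _ => WG.intElem_nonneg fun x => sq_nonneg _
      have e4 := mul_le_mul_of_nonneg_right (le_abs_self β) e3
      have e5 := mul_le_mul_of_nonneg_left e2 (abs_nonneg β)
      linarith
    obtain ⟨hρ, hρ0⟩ := WG.rhoA_le h𝔸 hα.le hd1 hΩ hh pr j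
      (M := |β| * C₄ * (h ^ 2)⁻¹) (by positivity) hM
    have hnA : WG.normA pr j 𝔸 (v : WG.WeakFun T) ^ 2 =
        WG.aForm pr j 𝔸 (v : WG.WeakFun T) (v : WG.WeakFun T) := Real.sq_sqrt hA0
    rw [hnA]
    have h9 := WG.le_mul_inv_of_bounds (by positivity) hA0 (pow_pos hh 2)
      ENNReal.toReal_nonneg hρ (fun h0 => hρ0 h0 v) h8
    have h10 : 0 ≤ (WG.rhoA T pr j h 𝔸)⁻¹ *
        WG.aForm pr j 𝔸 (v : WG.WeakFun T) (v : WG.WeakFun T) :=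
      mul_nonneg (inv_nonneg.2 ENNReal.toReal_nonneg) hA0
    exact h9.trans (mul_le_mul_of_nonneg_right (by linarith) h10)
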